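/- **Conjoining Matching.** An instance consists of a finite simple graph $G$ with $n$ nodes and edge weights $\gamma\colon E(G)\to\mathbb{Q}_{\ge 0}$, a partition $V(G)=V_1\uplus\dots\uplus V_t$ into nonempty parts, a number $\ell\in\mathbb{Q}_{\ge 0}$, and a pattern graph $H$ with $V(H)=\{V_1,\dots,V_t\}$, which may contain self-loops. The task is to find a perfect matching $M\subseteq E(G)$ of weight $\sum_{e\in M}\gamma(e)\le\ell$ such that for every $\{V_i,V_j\}\in E(H)$ (possibly $i=j$) there is an edge $\{u,v\}\in M$ with $u\in V_i$ and $v\in V_j$. The rational numbers are given by their integer numerators over a common denominator $D\ge 1$; so $D=1$ is the case of integer weights, and the integer $D\ell$ is the bound $\ell$ measured in the unit $1/D$ in which all weights are integral. **Lemma.** For every $c\in\mathbb{N}$ there are a randomized algorithm and constants $\kappa,C,d\in\mathbb{N}$ such that, on every instance as above (self-loops of $H$ allowed) and every sequence of coin flips, the algorithm halts after at most $$C\cdot 2^{|E(H)|}\cdot (n+1)^{d}\cdot (D\ell+1)^{d}$$ steps, and either outputs a perfect matching solving the instance or answers "no"; and if the instance has a solution, then the probability that the algorithm answers "no" is at most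 $1/(n+D\ell)^{c}$ (no condition if $n+D\ell=0$). In particular, for integer weights and integer $\ell$ (with $D=1$), the running time is $2^{|E(H)|}\cdot n^{O(1)}\cdot \ell^{O(1)}$ and the false negative rate is at most $1/(n+\ell)^{c}$. Here an algorithm is a program for a unit-cost word RAM with fair coin flips; it has to work for every word length $w$ such that each input number is less than $2^{w}$ and $w\ge\kappa\log_2(n+D\ell+2)$, with a time bound that does not depend on $w$. -/

import Mathlib

/-! ## Randomized word RAM

A machine with word length `w`: registers and memory cells hold natural numbers below `2 ^ w`, every
result is reduced modulo `2 ^ w`, and every instruction and every branching test costs one time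
unit.  Programs are structured (sequence, conditional, loop) and can flip fair coins. -/

namespace WordRAM

/-- Binary operations on words. -/
inductive Op
  | add | sub | mul | div | mod | and | xor | shl | shr | lt | eq

/-- Value of a binary operation before reduction modulo `2 ^ w`
(`sub` is cut off at `0`, division by `0` gives `0`, comparisons give `1` or `0`). -/
def Op.eval : Op → ℕ → ℕ → ℕ
  | .add, a, b => a + b
  | .sub, a, b => a - b
  | .mul, a, b => a * b
  | .div, a, b => a / b
  | .mod, a, b => a % b
  | .and, a, b => a &&& b
  | .xor, a, b => a ^^^ b
  | .shl, a, b => a <<< b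
  | .shr, a, b => a >>> b
  | .lt, a, b => if a < b then 1 else 0
  | .eq, a, b => if a = b then 1 else 0

/-- Elementary instructions; registers are named by natural numbers. -/
inductive Instr
  /-- `x := c` -/
  | const (x c : ℕ)
  /-- `x := y o z` -/
  | op (x : ℕ) (o : Op) (y z : ℕ)
  /-- `x := mem[a]`, the address being the content of register `a` -/
  | load (x a : ℕ)
  /-- `mem[a] := x`, the address being the content of register `a` -/
  | store (a x : ℕ)
  /-- `x :=` the next random bit -/
  | flip (x : ℕ)

/-- Programs.  A program is a finite object, so it uses finitely many registers. -/
inductive Prog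
  | instr (i : Instr)
  | seq (p q : Prog)
  /-- if register `x` is nonzero then `p` else `q` -/
  | ite (x : ℕ) (p q : Prog)
  /-- while register `x` is nonzero do `p` -/
  | loop (x : ℕ) (p : Prog)

/-- Machine states; `coins` is the sequence of random bits not used so far. -/
structure State where
  reg : ℕ → ℕ
  mem : ℕ → ℕ
  coins : ℕ → Bool

/-- Effect of one instruction at word length `w`. -/
def Instr.exec (w : ℕ) : Instr → State → State
  | .const x c, s => { s with reg := Function.update s.reg x (c % 2 ^ w) }
  | .op x o y z, s =>
      { s with reg := Function.update s.reg x (o.eval (s.reg y) (s.reg z) % 2 ^ w) }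
  | .load x a, s => { s with reg := Function.update s.reg x (s.mem (s.reg a)) }
  | .store a x, s => { s with mem := Function.update s.mem (s.reg a) (s.reg x) }
  | .flip x, s =>
      { s with
        reg := Function.update s.reg x ((s.coins 0).toNat % 2 ^ w)
        coins := fun i => s.coins (i + 1) }

/-- `Runs w p s T s'`: at word length `w`, program `p` started in `s` halts in `s'` after exactly
`T` time units. -/
inductive Runs (w : ℕ) : Prog → State → ℕ → State → Prop
  | instr (i : Instr) (s : State) : Runs w (.instr i) s 1 (i.exec w s)
  | seq {p q : Prog} {s s' s'' : State} {a b : ℕ} :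
      Runs w p s a s' → Runs w q s' b s'' → Runs w (.seq p q) s (a + b) s''
  | ite_true {x : ℕ} {p q : Prog} {s s' : State} {a : ℕ} :
      s.reg x ≠ 0 → Runs w p s a s' → Runs w (.ite x p q) s (1 + a) s'
  | ite_false {x : ℕ} {p q : Prog} {s s' : State} {a : ℕ} :
      s.reg x = 0 → Runs w q s a s' → Runs w (.ite x p q) s (1 + a) s'
  | loop_done {x : ℕ} {p : Prog} {s : State} :
      s.reg x = 0 → Runs w (.loop x p) s 1 s
  | loop_step {x : ℕ} {p : Prog} {s s' s'' : State} {a b : ℕ} :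
      s.reg x ≠ 0 → Runs w p s a s' → Runs w (.loop x p) s' b s'' →
      Runs w (.loop x p) s (1 + a + b) s''

/-- Initial state: the input words stand in the cells `0, 1, 2, …`, everything else is `0`, and
`ρ` is the sequence of random bits. -/
def init (input : List ℕ) (ρ : ℕ → Bool) : State where
  reg := fun _ => 0
  mem := fun a => input.getD a 0
  coins := ρ

/-- The law of an infinite sequence of independent fair coin flips. -/
noncomputable def coinMeasure : MeasureTheory.Measure (ℕ → Bool) :=
  MeasureTheory.Measure.infinitePi fun _ => (PMF.uniformOfFintype Bool).toMeasure

end WordRAM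

/-! ## The problem Conjoining Matching -/

/-- An instance of Conjoining Matching: a graph `G` with rational edge weights `γ ≥ 0` (the values
of `γ` outside the edge set play no role), a partition of its nodes into the `t` nonempty parts
`part ⁻¹' {i}`, a number `ℓ ≥ 0`, and a pattern graph on the parts, which may have self-loops and is
given by its edge set `H`. -/
structure CMInstance where
  n : ℕ
  t : ℕ
  G : SimpleGraph (Fin n)
  γ : Sym2 (Fin n) → ℚ≥0
  part : Fin n → Fin t
  part_surjective : Function.Surjective part
  ℓ : ℚ≥0
  H : Finset (Sym2 (Fin t))

namespace CMInstance

/-- The perfect matchings sought: the weight is at most `ℓ`, and every edge `{i, j}` of the pattern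
graph (possibly `i = j`) is hit by an edge of `M` between part `i` and part `j`. -/
def IsSolution (I : CMInstance) (M : I.G.Subgraph) : Prop :=
  M.IsPerfectMatching ∧
  ∑ e ∈ M.edgeSet.toFinite.toFinset, I.γ e ≤ I.ℓ ∧
  ∀ i j : Fin I.t, s(i, j) ∈ I.H → ∃ u v : Fin I.n, M.Adj u v ∧ I.part u = i ∧ I.part v = j

/-- `D` is a common denominator of the edge weights and of `ℓ`. -/
def IsCommonDenominator (I : CMInstance) (D : ℕ) : Prop :=
  0 < D ∧ (∀ e ∈ I.G.edgeSet, ∃ a : ℕ, (D : ℚ≥0) * I.γ e = a) ∧ ∃ a : ℕ, (D : ℚ≥0) * I.ℓ = a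

/-- The numerator of `ℓ` over the common denominator `D`, that is, the integer `D * ℓ`. -/
def bound (I : CMInstance) (D : ℕ) : ℕ := ⌊(D : ℚ≥0) * I.ℓ⌋₊

open Classical in
/-- The input words: `n`, `t`, `D`, `D * ℓ`, the part of every node, the weight matrix of `G` (row
by row; `0` for a non-edge and `D * γ e + 1` for an edge `e`), the adjacency matrix of the pattern
graph (row by row). -/
noncomputable def encode (I : CMInstance) (D : ℕ) : List ℕ :=
  [I.n, I.t, D, I.bound D] ++
  (List.finRange I.n).map (fun v => (I.part v : ℕ)) ++
  (List.finRange I.n).flatMap (fun u => (List.finRange I.n).map fun v =>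
    if I.G.Adj u v then ⌊(D : ℚ≥0) * I.γ s(u, v)⌋₊ + 1 else 0) ++
  (List.finRange I.t).flatMap (fun i => (List.finRange I.t).map fun j =>
    if s(i, j) ∈ I.H then 1 else 0)

/-- The word length `w` is large enough: every input word fits into a machine word, and `w` is at
least `κ` times the binary logarithm of `n + D * ℓ + 2`. -/
def WordLengthOK (I : CMInstance) (D κ w : ℕ) : Prop :=
  (∀ x ∈ I.encode D, x < 2 ^ w) ∧ (I.n + I.bound D + 2) ^ κ ≤ 2 ^ w

/-- The final state `s` holds the answer `M`: cell `v` contains the partner of node `v`. -/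
def Outputs (I : CMInstance) (s : WordRAM.State) (M : I.G.Subgraph) : Prop :=
  ∀ u v : Fin I.n, M.Adj u v ↔ s.mem u = v

end CMInstance

/-!
The algorithm counts solutions modulo two, graded by weight, with determinants over `F₂[y]`.

Put an edge `{u, v}` into a symmetric matrix as the monomial `y ^ E u v`, where `E u v` is a large
multiple of the weight of the edge plus a random number, and a non-edge as a power of `y` that is
too large to matter. In characteristic two a permutation and its inverse contribute the same to the
determinant of a symmetric matrix, so only involutions survive (`det_eq_sum_involutions`); since the
diagonal consists of non-edges, the relevant ones are the perfect matchings. The coefficient of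
`y ^ d` is thus the parity of the number of perfect matchings with exponent `d`. It is found without
divisions by Bird's recursion (`det_eq_sum_bird`), in which the minors over index sets that follow a
given row are summed up; the generating function of these sums satisfies a linear equation.

The pattern graph is handled by inclusion–exclusion: for every set `B` of pattern edges, kill the
matrix entries that hit a member of `B`, and add up the determinants. A matching survives for the
sets that consist of pattern edges it does not hit; their number is a power of two, and it is odd if
and only if every pattern edge is hit (`sum_mask_avoids`, `CMData.Valid.sum_masks`). The sets are run
through by a binary counter kept in memory, which costs the factor `2 ^ |E(H)|`.

By the isolation lemma (`isolation`) the random parts of the exponents make some solution the only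
one with its exponent, except with probability at most `n ^ 2 / 2 ^ K` for `K` random bits per pair
(`CMData.coinMeasure_even_le`). With `2 ^ K > n ^ 2 * (n + L) ^ c` this is the error bound. Hence the
algorithm takes the first exponent `d` with an odd number of solutions, and says "no" if there is
none. Otherwise it fixes the partners of the nodes one by one: the solutions extending a partial
matching are split according to the partner of a free node, so for some partner their number
remains odd (`Good.next`). In the end a partial matching without free nodes extends to an odd number
of solutions, so it is itself a solution, and the answer "yes" is always correct.

On the machine side, expressions with bounded sums are compiled to code whose effect is exact as
long as no intermediate value overflows (`Exp.comp_runs`). All values and running times of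
expressions are bounded by a fixed power of a bound `Z` for the words in use (`Exp.eval_le_pow`,
`Exp.time_le_pow`), and `Z` is itself a fixed power of `n + L + 2` (`bounds`). Weights above `L`,
which may be arbitrarily large words, are deleted before anything else happens.
-/

/-! ### Determinism and total correctness of programs -/

namespace WordRAM

theorem Runs.det {w : ℕ} {p : Prog} {s s' : State} {T : ℕ} (h : Runs w p s T s') :
    ∀ {T' : ℕ} {s'' : State}, Runs w p s T' s'' → s' = s'' := by
  induction h with
  | instr i s => intro T' s'' h; cases h; rfl
  | seq _ _ ih1 ih2 =>
    intro T' s'' h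
    cases h with
    | seq h1 h2 => cases ih1 h1; exact ih2 h2
  | ite_true hx _ ih =>
    intro T' s'' h
    cases h with
    | ite_true _ h => exact ih h
    | ite_false h0 _ => exact absurd h0 hx
  | ite_false hx _ ih =>
    intro T' s'' h
    cases h with
    | ite_true h0 _ => exact absurd hx h0
    | ite_false _ h => exact ih h
  | loop_done hx =>
    intro T' s'' h
    cases h with
    | loop_done _ => rfl
    | loop_step h0 _ _ => exact absurd hx h0
  | loop_step hx _ _ ih1 ih2 =>
    intro T' s'' h
    cases h with
    | loop_done h0 => exact absurd h0 hx
    | loop_step _ h1 h2 => cases ih1 h1; exact ih2 h2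

/-- Total correctness with a time bound: started in `s`, the program `p` halts after at most `t`
steps in a state satisfying `Q`. -/
def Tri (w : ℕ) (p : Prog) (t : ℕ) (s : State) (Q : State → Prop) : Prop :=
  ∃ T s', T ≤ t ∧ Runs w p s T s' ∧ Q s'

theorem Tri.of_runs {w : ℕ} {p : Prog} {t : ℕ} {s s' : State} {Q : State → Prop}
    (h : Runs w p s t s') (hQ : Q s') : Tri w p t s Q := ⟨t, s', le_rfl, h, hQ⟩

theorem Tri.seq {w : ℕ} {p q : Prog} {t u : ℕ} {s : State} {Q R : State → Prop}
    (h : Tri w p t s Q) (h' : ∀ s', Q s' → Tri w q u s' R) : Tri w (.seq p q) (t + u) s R := by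
  obtain ⟨T, s', hT, hr, hQ⟩ := h
  obtain ⟨U, s'', hU, hr', hR⟩ := h' s' hQ
  exact ⟨T + U, s'', by omega, .seq hr hr', hR⟩

theorem Tri.mono {w : ℕ} {p : Prog} {t u : ℕ} {s : State} {Q R : State → Prop}
    (h : Tri w p t s Q) (htu : t ≤ u) (hQR : ∀ s', Q s' → R s') : Tri w p u s R := by
  obtain ⟨T, s', hT, hr, hQ⟩ := h
  exact ⟨T, s', hT.trans htu, hr, hQR _ hQ⟩

theorem Tri.loop {w : ℕ} {x : ℕ} {p : Prog} {t : ℕ} (k : ℕ) (I : ℕ → State → Prop)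
    (hstep : ∀ j < k, ∀ s, I j s → s.reg x ≠ 0 ∧ Tri w p t s (I (j + 1)))
    (hend : ∀ s, I k s → s.reg x = 0) {s : State} (h0 : I 0 s) :
    Tri w (.loop x p) (k * (t + 1) + 1) s (I k) := by
  suffices ∀ m j s, j + m = k → I j s → Tri w (.loop x p) (m * (t + 1) + 1) s (I k) from
    this k 0 s (by omega) h0
  intro m
  induction m with
  | zero =>
    intro j s hj hI
    obtain rfl : j = k := by omega
    exact ⟨1, s, by omega, .loop_done (hend s hI), hI⟩
  | succ m ih =>
    intro j s hj hI
    obtain ⟨hx, T, s', hT, hr, hI'⟩ := hstep j (by omega) s hI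
    obtain ⟨U, s'', hU, hr', hI''⟩ := ih (j + 1) s' (by omega) hI'
    exact ⟨1 + T + U, s'', by rw [Nat.succ_mul]; omega, .loop_step hx hr hr', hI''⟩

/-! ### Expressions and their compilation -/

/-- Arithmetic expressions over named variables and memory; `bsum x y e` is the sum of `e` over all
values of `x` below the value of the variable `y`. -/
inductive Exp
  | const (c : ℕ)
  | var (x : ℕ)
  | op (o : Op) (a b : Exp)
  | load (a : Exp)
  | bsum (x y : ℕ) (e : Exp)

instance : Add Exp := ⟨Exp.op .add⟩
instance : Sub Exp := ⟨Exp.op .sub⟩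
instance : Mul Exp := ⟨Exp.op .mul⟩
instance : Div Exp := ⟨Exp.op .div⟩
instance : Mod Exp := ⟨Exp.op .mod⟩
instance (n : ℕ) : OfNat Exp n := ⟨Exp.const n⟩

namespace Exp

/-- The expression with value `1` if the first argument is smaller than the second, else `0`. -/
abbrev lt (a b : Exp) : Exp := .op .lt a b
/-- The expression with value `1` if the arguments are equal, else `0`. -/
abbrev eq (a b : Exp) : Exp := .op .eq a b

/-- The exact value of an expression in the memory `m` under the assignment `v`. -/
def eval (m : ℕ → ℕ) : Exp → (ℕ → ℕ) → ℕ
  | .const c, _ => c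
  | .var x, v => v x
  | .op o a b, v => o.eval (a.eval m v) (b.eval m v)
  | .load a, v => m (a.eval m v)
  | .bsum x y e, v => ∑ i ∈ Finset.range (v y), e.eval m (Function.update v x i)

/-- No overflow occurs when the expression is evaluated at word length `w`. -/
def Safe (w : ℕ) (m : ℕ → ℕ) : Exp → (ℕ → ℕ) → Prop
  | .const c, _ => c < 2 ^ w
  | .var x, v => v x < 2 ^ w
  | .op o a b, v => a.Safe w m v ∧ b.Safe w m v ∧ o.eval (a.eval m v) (b.eval m v) < 2 ^ w
  | .load a, v => a.Safe w m v
  | .bsum x y e, v => v y < 2 ^ w ∧ (∀ i < v y, e.Safe w m (Function.update v x i)) ∧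
      ∑ i ∈ Finset.range (v y), e.eval m (Function.update v x i) < 2 ^ w

/-- The number of steps of the compiled expression. -/
def time : Exp → (ℕ → ℕ) → ℕ
  | .const _, _ => 1
  | .var _, _ => 1
  | .op _ a b, v => a.time v + (b.time v + (1 + 1))
  | .load a, v => a.time v + 1
  | .bsum x y e, v => 1 + (1 + ∑ i ∈ Finset.range (v y), (e.time (Function.update v x i) + 6))

/-- Code that evaluates an expression into register `k`, with the registers above `k` as scratch
space; `ρ` tells which registers hold the variables. -/
def comp : Exp → (ℕ → ℕ) → ℕ → Prog
  | .const c, _, k => .instr (.const k c)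
  | .var x, ρ, k => .instr (.op k .add (ρ x) k)
  | .op o a b, ρ, k => .seq (a.comp ρ k) (.seq (b.comp ρ (k + 1))
      (.seq (.instr (.op k o k (k + 1))) (.instr (.const (k + 1) 0))))
  | .load a, ρ, k => .seq (a.comp ρ k) (.instr (.load k k))
  | .bsum x y e, ρ, k => .seq (.instr (.op (k + 1) .add (ρ y) (k + 1))) (.loop (k + 1)
      (.seq (.instr (.const (k + 2) 1)) (.seq (.instr (.op (k + 1) .sub (k + 1) (k + 2)))
      (.seq (.instr (.const (k + 2) 0)) (.seq (e.comp (Function.update ρ x (k + 1)) (k + 2))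
      (.seq (.instr (.op k .add k (k + 2))) (.instr (.const (k + 2) 0))))))))

end Exp

/-- The state with register `k` overwritten by `v`. -/
def State.setReg (s : State) (k v : ℕ) : State := { s with reg := Function.update s.reg k v }

@[simp] theorem State.setReg_mem (s : State) (k v : ℕ) : (s.setReg k v).mem = s.mem := rfl
@[simp] theorem State.setReg_reg (s : State) (k v : ℕ) :
    (s.setReg k v).reg = Function.update s.reg k v := rfl

theorem State.setReg_setReg (s : State) (k v v' : ℕ) :
    (s.setReg k v).setReg k v' = s.setReg k v' := by
  simp [State.setReg]

theorem State.setReg_comm (s : State) {k k' : ℕ} (h : k ≠ k') (v v' : ℕ) :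
    (s.setReg k v).setReg k' v' = (s.setReg k' v').setReg k v := by
  simp [State.setReg, Function.update_comm h]

theorem State.setReg_self (s : State) {k v : ℕ} (h : s.reg k = v) : s.setReg k v = s := by
  subst h; simp [State.setReg]

theorem runs_const {w : ℕ} (s : State) (k : ℕ) {c : ℕ} (hc : c < 2 ^ w) :
    Runs w (.instr (.const k c)) s 1 (s.setReg k c) := by
  have := Runs.instr (w := w) (.const k c) s
  rwa [Instr.exec, Nat.mod_eq_of_lt hc] at this

theorem runs_op {w : ℕ} (s : State) (k : ℕ) (o : Op) (y z : ℕ) {v : ℕ}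
    (hv : o.eval (s.reg y) (s.reg z) = v) (h : v < 2 ^ w) :
    Runs w (.instr (.op k o y z)) s 1 (s.setReg k v) := by
  have := Runs.instr (w := w) (.op k o y z) s
  rwa [Instr.exec, hv, Nat.mod_eq_of_lt h] at this

theorem Exp.comp_runs {w : ℕ} (hw : 1 < 2 ^ w) (e : Exp) : ∀ (ρ : ℕ → ℕ) (k : ℕ) (s : State),
    (∀ x, ρ x < k) → (∀ r, k ≤ r → s.reg r = 0) → e.Safe w s.mem (s.reg ∘ ρ) →
    Runs w (e.comp ρ k) s (e.time (s.reg ∘ ρ)) (s.setReg k (e.eval s.mem (s.reg ∘ ρ))) := by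
  induction e with
  | const c => intro ρ k s _ _ hs; exact runs_const s k hs
  | var x => intro ρ k s _ h0 hs; exact runs_op s k _ _ _ (by simp [Op.eval, h0, Exp.eval]) hs
  | op o a b iha ihb =>
    intro ρ k s hρ h0 ⟨ha, hb, hs⟩
    have h1 := iha ρ k s hρ h0 ha
    have henv : ∀ v, (s.setReg k v).reg ∘ ρ = s.reg ∘ ρ := fun v =>
      Function.update_comp_eq_of_forall_ne _ _ fun x => (hρ x).ne
    have h2 := ihb ρ (k + 1) (s.setReg k (a.eval s.mem (s.reg ∘ ρ)))
      (fun x => (hρ x).trans (Nat.lt_succ_self k))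
      (fun r hr => by
        rw [State.setReg_reg, Function.update_of_ne (by omega)]; exact h0 r (by omega))
      (by rw [henv]; exact hb)
    rw [henv] at h2
    refine .seq h1 (.seq h2 (.seq (runs_op _ k o k (k + 1) (v := o.eval (a.eval s.mem (s.reg ∘ ρ))
      (b.eval s.mem (s.reg ∘ ρ))) (by simp) hs) ?_))
    convert runs_const _ (k + 1) (c := 0) (Nat.two_pow_pos w) using 1
    rw [State.setReg_comm _ (by omega : k + 1 ≠ k), State.setReg_setReg, State.setReg_setReg]
    refine (State.setReg_self _ ?_).symm
    rw [State.setReg_reg, Function.update_of_ne (by omega)]; exact h0 _ (by omega)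
  | load a iha =>
    intro ρ k s hρ h0 ha
    refine .seq (iha ρ k s hρ h0 ha) ?_
    convert Runs.instr (w := w) (.load k k) _ using 1
    simp [Instr.exec, State.setReg, Exp.eval]
  | bsum x y e ih =>
    intro ρ k s hρ h0 ⟨hy, hS, hsum⟩
    have loop : ∀ c A, c ≤ s.reg (ρ y) →
        A + ∑ i ∈ Finset.range c, e.eval s.mem (Function.update (s.reg ∘ ρ) x i) < 2 ^ w →
        Runs w (.loop (k + 1)
          (.seq (.instr (.const (k + 2) 1)) (.seq (.instr (.op (k + 1) .sub (k + 1) (k + 2)))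
          (.seq (.instr (.const (k + 2) 0)) (.seq (e.comp (Function.update ρ x (k + 1)) (k + 2))
          (.seq (.instr (.op k .add k (k + 2))) (.instr (.const (k + 2) 0)))))))) 
          ((s.setReg k A).setReg (k + 1) c)
          (1 + ∑ i ∈ Finset.range c, (e.time (Function.update (s.reg ∘ ρ) x i) + 6))
          (s.setReg k (A + ∑ i ∈ Finset.range c,
            e.eval s.mem (Function.update (s.reg ∘ ρ) x i))) := by
      intro c
      induction c with
      | zero =>
        intro A _ _
        rw [State.setReg_self (s.setReg k A)]
        · exact .loop_done (by simp [h0])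
        · simp [h0]
      | succ c ihc =>
        intro A hc hA
        rw [Finset.sum_range_succ] at hA
        have henv : ((s.setReg k A).setReg (k + 1) c).reg ∘ Function.update ρ x (k + 1) =
            Function.update (s.reg ∘ ρ) x c := by
          funext z
          by_cases hz : z = x
          · subst hz; simp
          · have := hρ z
            simp only [State.setReg_reg, Function.comp, Function.update_of_ne hz]
            rw [Function.update_of_ne (by omega), Function.update_of_ne (by omega)]
        have hbody := ih (Function.update ρ x (k + 1)) (k + 2) ((s.setReg k A).setReg (k + 1) c)
          (fun z => by
            by_cases hz : z = x
            · subst hz; simp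
            · have := hρ z
              rw [Function.update_of_ne hz]; omega)
          (fun r hr => by
            simp only [State.setReg_reg]
            rw [Function.update_of_ne (by omega), Function.update_of_ne (by omega)]
            exact h0 r (by omega))
          (by rw [henv]; exact hS c (by simpa using hc))
        rw [henv] at hbody
        have h2 : (s.setReg k A).reg (k + 2) = 0 := by simp [h0]
        have hbody' : Runs w (e.comp (Function.update ρ x (k + 1)) (k + 2))
            (((((s.setReg k A).setReg (k + 1) (c + 1)).setReg (k + 2) 1).setReg (k + 1) c).setReg
              (k + 2) 0) (e.time (Function.update (s.reg ∘ ρ) x c))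
            (((s.setReg k A).setReg (k + 1) c).setReg (k + 2)
              (e.eval s.mem (Function.update (s.reg ∘ ρ) x c))) := by
          convert hbody using 1
          · rw [State.setReg_comm _ (by omega : k + 2 ≠ k + 1), State.setReg_setReg,
              State.setReg_setReg, State.setReg_self (k := k + 2)]
            simp [h0]
          · rfl
        have tail := ihc (A + e.eval s.mem (Function.update (s.reg ∘ ρ) x c)) (by omega) (by omega)
        have step := Runs.loop_step (w := w) (x := k + 1)
          (s := (s.setReg k A).setReg (k + 1) (c + 1)) (by simp)
          (.seq (runs_const _ (k + 2) hw) (.seq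
            (runs_op _ (k + 1) .sub (k + 1) (k + 2) (v := c) (by simp [Op.eval])
              (by simp only [Function.comp] at hy; omega))
            (.seq (runs_const _ (k + 2) (c := 0) (by omega)) (.seq hbody'
              (.seq (runs_op _ k .add k (k + 2)
                (v := A + e.eval s.mem (Function.update (s.reg ∘ ρ) x c))
                (by simp [Op.eval]) (by omega))
                (runs_const _ (k + 2) (c := 0) (by omega)))))))
          (by
            convert tail using 1
            rw [State.setReg_comm _ (by omega : k + 2 ≠ k), State.setReg_setReg,
              State.setReg_comm _ (by omega : k + 1 ≠ k), State.setReg_setReg,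
              State.setReg_self (k := k + 2)]
            simp [h0])
        convert step using 1
        · rw [Finset.sum_range_succ]; ring
        · rw [Finset.sum_range_succ]; congr 1; ring
    refine .seq (runs_op s (k + 1) .add (ρ y) (k + 1) (v := s.reg (ρ y)) (by simp [Op.eval, h0])
      hy) ?_
    have := loop (s.reg (ρ y)) 0 le_rfl (by simpa using hsum)
    rw [State.setReg_self s (k := k) (h0 k le_rfl)] at this
    simpa [Exp.eval] using this

end WordRAM

/-! ### Assignments, stores and counted loops -/

namespace WordRAM

/-- The assignment of variables to registers below `k`; all other names are sent to register `0`. -/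
def regMap (k x : ℕ) : ℕ := if x < k then x else 0

theorem regMap_lt {k : ℕ} (hk : 0 < k) (x : ℕ) : regMap k x < k := by
  unfold regMap; split <;> omega

/-- `x := e`, with the registers from `k` on as scratch space. -/
def assignP (k x : ℕ) (e : Exp) : Prog :=
  .seq (e.comp (regMap k) k) (.seq (.instr (.op x .add k (k + 1))) (.instr (.const k 0)))

/-- The state with memory cell `a` overwritten by `v`. -/
def State.setMem (s : State) (a v : ℕ) : State := { s with mem := Function.update s.mem a v }

/-- `mem[a] := e`; the expressions see the registers below `l`, and the registers from `k` on are
scratch space. -/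
def storeP (l k : ℕ) (a e : Exp) : Prog :=
  .seq (a.comp (regMap l) k) (.seq (e.comp (regMap l) (k + 1)) (.seq (.instr (.store k (k + 1)))
    (.seq (.instr (.const k 0)) (.instr (.const (k + 1) 0)))))

/-- `mem[a] :=` the next random bit. -/
def flipP (l k : ℕ) (a : Exp) : Prog :=
  .seq (.instr (.flip k)) (.seq (a.comp (regMap l) (k + 1)) (.seq (.instr (.store (k + 1) k))
    (.seq (.instr (.const k 0)) (.instr (.const (k + 1) 0)))))

/-- Run `p` with register `k` equal to `0, 1, 2, …` below the value of register `y`; registers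
`k + 1` and `k + 2` hold the number of rounds and the number of rounds left. -/
def forP (k y : ℕ) (p : Prog) : Prog :=
  .seq (.instr (.op (k + 1) .add y (k + 1))) (.seq (.instr (.op (k + 2) .add y (k + 2)))
  (.seq (.loop (k + 2) (.seq (.instr (.op k .sub (k + 1) (k + 2))) (.seq p
    (.seq (.instr (.const (k + 3) 1)) (.seq (.instr (.op (k + 2) .sub (k + 2) (k + 3)))
    (.instr (.const (k + 3) 0)))))))
  (.seq (.instr (.const k 0)) (.instr (.const (k + 1) 0)))))

/-- `mem[a] := e` for all values of the variable `k` below that of the variable `y`. -/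
def fillP (k y : ℕ) (a e : Exp) : Prog := forP k y (storeP (k + 1) (k + 3) a e)

section

variable {w : ℕ} (hw : 1 < 2 ^ w)

theorem comp_update_of_lt {ρ : ℕ → ℕ} {k : ℕ} (hρ : ∀ x, ρ x < k) (f : ℕ → ℕ) {r : ℕ}
    (hr : k ≤ r) (v : ℕ) : Function.update f r v ∘ ρ = f ∘ ρ :=
  Function.update_comp_eq_of_forall_ne _ _ fun x => by have := hρ x; omega

include hw in
theorem assignP_runs {k x : ℕ} (hx : x < k) {s : State} (h0 : ∀ r, k ≤ r → s.reg r = 0) {e : Exp}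
    (he : e.Safe w s.mem (s.reg ∘ regMap k)) (hv : e.eval s.mem (s.reg ∘ regMap k) < 2 ^ w) :
    Runs w (assignP k x e) s (e.time (s.reg ∘ regMap k) + (1 + 1))
      (s.setReg x (e.eval s.mem (s.reg ∘ regMap k))) := by
  refine .seq (e.comp_runs hw _ k s (regMap_lt (by omega)) h0 he) (.seq (runs_op _ x .add k (k + 1)
    (v := e.eval s.mem (s.reg ∘ regMap k)) (by simp [Op.eval, h0]) hv) ?_)
  convert runs_const _ k (c := 0) (Nat.two_pow_pos w) using 1
  rw [State.setReg_comm _ (by omega : x ≠ k), State.setReg_setReg, State.setReg_self s (h0 k le_rfl)]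

include hw in
theorem storeP_runs {l k : ℕ} (hl : 0 < l) (hlk : l ≤ k) {s : State}
    (h0 : ∀ r, k ≤ r → s.reg r = 0) {a e : Exp} (ha : a.Safe w s.mem (s.reg ∘ regMap l))
    (he : e.Safe w s.mem (s.reg ∘ regMap l)) :
    Runs w (storeP l k a e) s (a.time (s.reg ∘ regMap l) + (e.time (s.reg ∘ regMap l) + 3))
      (s.setMem (a.eval s.mem (s.reg ∘ regMap l)) (e.eval s.mem (s.reg ∘ regMap l))) := by
  have hρ : ∀ x, regMap l x < k := fun x => (regMap_lt hl x).trans_le hlk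
  refine .seq (a.comp_runs hw _ k s hρ h0 ha) (.seq (a := e.time (s.reg ∘ regMap l)) (b := 3)
    (s' := (s.setReg k (a.eval s.mem (s.reg ∘ regMap l))).setReg (k + 1)
      (e.eval s.mem (s.reg ∘ regMap l))) ?_ ?_)
  · have := e.comp_runs hw _ (k + 1) (s.setReg k (a.eval s.mem (s.reg ∘ regMap l)))
      (fun x => (hρ x).trans (Nat.lt_succ_self k))
      (fun r hr => by
        rw [State.setReg_reg, Function.update_of_ne (by omega)]; exact h0 r (by omega))
      (by rw [State.setReg_reg, comp_update_of_lt hρ _ le_rfl]; exact he)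
    rwa [State.setReg_reg, comp_update_of_lt hρ _ le_rfl] at this
  · refine .seq (a := 1) (b := 1 + 1) (.instr _ _) (.seq (runs_const _ k (Nat.two_pow_pos w)) ?_)
    convert runs_const _ (k + 1) (c := 0) (Nat.two_pow_pos w) using 1
    simp only [State.setMem, State.setReg, Instr.exec, State.mk.injEq, and_true]
    refine ⟨?_, by simp⟩
    funext r
    have h1 := h0 k le_rfl
    have h2 := h0 (k + 1) (by omega)
    by_cases hr : r = k
    · subst hr; simp [h1]
    · by_cases hr' : r = k + 1
      · subst hr'; simp [h2]
      · simp [Function.update_of_ne, hr, hr']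

include hw in
theorem flipP_runs {l k : ℕ} (hl : 0 < l) (hlk : l ≤ k) {s : State}
    (h0 : ∀ r, k ≤ r → s.reg r = 0) {a : Exp} (ha : a.Safe w s.mem (s.reg ∘ regMap l)) :
    Runs w (flipP l k a) s (1 + (a.time (s.reg ∘ regMap l) + 3))
      { s.setMem (a.eval s.mem (s.reg ∘ regMap l)) (s.coins 0).toNat with
        coins := fun i => s.coins (i + 1) } := by
  have hρ : ∀ x, regMap l x < k := fun x => (regMap_lt hl x).trans_le hlk
  have hb : (s.coins 0).toNat % 2 ^ w = (s.coins 0).toNat :=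
    Nat.mod_eq_of_lt ((Bool.toNat_le _).trans_lt hw)
  refine .seq (.instr _ _) (.seq (b := 3)
    (s' := ((Instr.flip k).exec w s).setReg (k + 1) (a.eval s.mem (s.reg ∘ regMap l))) ?_ ?_)
  · have := a.comp_runs hw _ (k + 1) ((Instr.flip k).exec w s)
      (fun x => (hρ x).trans (Nat.lt_succ_self k))
      (fun r hr => by
        simp only [Instr.exec]; rw [Function.update_of_ne (by omega)]; exact h0 r (by omega))
      (by simp only [Instr.exec]; rw [comp_update_of_lt hρ _ le_rfl]; exact ha)
    simp only [Instr.exec] at this ⊢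
    rwa [comp_update_of_lt hρ _ le_rfl] at this
  · refine .seq (a := 1) (b := 1 + 1) (.instr _ _) (.seq (runs_const _ k (Nat.two_pow_pos w)) ?_)
    convert runs_const _ (k + 1) (c := 0) (Nat.two_pow_pos w) using 1
    simp only [State.setMem, State.setReg, Instr.exec, State.mk.injEq, and_true]
    refine ⟨?_, by simp [hb]⟩
    funext r
    have h1 := h0 k le_rfl
    have h2 := h0 (k + 1) (by omega)
    by_cases hr : r = k
    · subst hr; simp [h1]
    · by_cases hr' : r = k + 1
      · subst hr'; simp [h2]
      · simp [Function.update_of_ne, hr, hr']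

include hw in
/-- The invariant of a counted loop must not depend on the scratch registers. -/
theorem Tri.forP {k y : ℕ} (hy : y < k) {p : Prog} {t b : ℕ} (I : ℕ → State → Prop)
    (hI : ∀ i s s', I i s → (∀ r < k, s'.reg r = s.reg r) → s'.mem = s.mem → s'.coins = s.coins →
      I i s')
    (hIy : ∀ i s, I i s → s.reg y = b)
    (hstep : ∀ i < b, ∀ s, I i s → s.reg k = i → s.reg (k + 1) ≤ b → s.reg (k + 2) ≤ b →
      (∀ r, k + 3 ≤ r → s.reg r = 0) →
      Tri w p t s (fun s' => I (i + 1) s' ∧ ∀ r, k ≤ r → s'.reg r = s.reg r))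
    {s : State} (hb : b < 2 ^ w) (h0 : ∀ r, k ≤ r → s.reg r = 0) (hI0 : I 0 s) :
    Tri w (forP k y p) (b * (t + 5) + 5) s (fun s' => I b s' ∧ ∀ r, k ≤ r → s'.reg r = 0) := by
  have hyb := hIy 0 s hI0
  have hz := Nat.two_pow_pos w
  let J : ℕ → State → Prop := fun i s => I i s ∧ s.reg (k + 1) = b ∧ s.reg (k + 2) = b - i ∧
    ∀ r, k + 3 ≤ r → s.reg r = 0
  refine (Tri.seq (t := 1) (u := 1 + ((b * (t + 4 + 1) + 1) + 2)) (Tri.of_runs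
    (runs_op s (k + 1) .add y (k + 1) (v := b) (by simp [Op.eval, h0, hyb]) hb) rfl) ?_).mono
    (by ring_nf; omega) (fun _ h => h)
  rintro _ rfl
  refine Tri.seq (Tri.of_runs (runs_op _ (k + 2) .add y (k + 2) (v := b)
    (by simp [Op.eval, h0, hyb, (show y ≠ k + 1 by omega)]) hb) rfl) ?_
  rintro _ rfl
  refine Tri.seq (Tri.loop b J ?_ ?_ ?_) ?_
  · rintro i hi s ⟨hIs, h1, h2, h3⟩
    refine ⟨by omega, ?_⟩
    refine (Tri.seq (t := 1) (u := t + 3) (Tri.of_runs (runs_op s k .sub (k + 1) (k + 2) (v := i)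
      (by simp [Op.eval, h1, h2]; omega) (by omega)) rfl) ?_).mono (by omega) (fun _ h => h)
    rintro _ rfl
    refine Tri.seq (hstep i hi _ (hI i _ _ hIs (fun r hr => ?_) rfl rfl) (by simp)
      (by simp [h1]) (by simp [h2]) ?_) ?_
    · rw [State.setReg_reg, Function.update_of_ne (by omega)]
    · intro r hr
      rw [State.setReg_reg, Function.update_of_ne (by omega)]; exact h3 r hr
    rintro s' ⟨hI', hr'⟩
    have e1 : s'.reg (k + 1) = b := by rw [hr' _ (by omega)]; simpa using h1
    have e2 : s'.reg (k + 2) = b - i := by rw [hr' _ (by omega)]; simpa using h2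
    have e3 : ∀ r, k + 3 ≤ r → s'.reg r = 0 := fun r hr => by
      rw [hr' _ (by omega), State.setReg_reg, Function.update_of_ne (by omega)]; exact h3 r hr
    refine (Tri.of_runs (.seq (runs_const s' (k + 3) hw) (.seq (runs_op _ (k + 2) .sub (k + 2) (k + 3)
      (v := b - (i + 1)) (by simp [Op.eval, e2]; omega) (by omega))
      (runs_const _ (k + 3) hz))) ?_)
    refine ⟨hI _ _ _ hI' (fun r hr => ?_) rfl rfl, ?_, ?_, fun r hr => ?_⟩
    · simp only [State.setReg_reg]
      rw [Function.update_of_ne (by omega), Function.update_of_ne (by omega),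
        Function.update_of_ne (by omega)]
    · simp [e1]
    · simp
    · simp only [State.setReg_reg]
      by_cases hrk : r = k + 3
      · subst hrk; simp
      · rw [Function.update_of_ne (by omega), Function.update_of_ne (by omega),
          Function.update_of_ne (by omega), e3 r hr]
  · rintro s ⟨_, _, h, _⟩
    omega
  · refine ⟨hI _ _ _ hI0 (fun r hr => ?_) rfl rfl, by simp, by simp, fun r hr => ?_⟩
    · simp only [State.setReg_reg]
      rw [Function.update_of_ne (by omega), Function.update_of_ne (by omega)]
    · simp only [State.setReg_reg]
      rw [Function.update_of_ne (by omega), Function.update_of_ne (by omega)]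
      exact h0 r (by omega)
  · rintro s' ⟨hI', h1, h2, h3⟩
    refine Tri.of_runs (.seq (runs_const _ k hz) (runs_const _ (k + 1) hz)) ⟨?_, ?_⟩
    · refine hI _ _ _ hI' (fun r hr => ?_) rfl rfl
      simp only [State.setReg_reg]
      rw [Function.update_of_ne (by omega), Function.update_of_ne (by omega)]
    · intro r hr
      simp only [State.setReg_reg]
      by_cases e1 : r = k + 1
      · subst e1; simp
      · rw [Function.update_of_ne e1]
        by_cases e2 : r = k
        · subst e2; simp
        · rw [Function.update_of_ne e2]
          by_cases e3 : r = k + 2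
          · subst e3; omega
          · exact h3 r (by omega)

include hw in
/-- A loop that fills the cells `A 0, A 1, …` in order; the value of a cell may depend on the cells
filled before. -/
theorem Tri.fillP {k y : ℕ} (hy : y < k) {a e : Exp} {t : ℕ} {A g : ℕ → ℕ} {s : State}
    (hA : ∀ i < s.reg y, ∀ j < i, A j ≠ A i) (hb : s.reg y < 2 ^ w)
    (h0 : ∀ r, k ≤ r → s.reg r = 0)
    (h : ∀ i < s.reg y, ∀ m : ℕ → ℕ, (∀ x < i, m (A x) = g x) →
      (∀ c, (∀ x < i, c ≠ A x) → m c = s.mem c) →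
      let v := Function.update s.reg k i ∘ regMap (k + 1)
      a.Safe w m v ∧ e.Safe w m v ∧ a.time v + e.time v ≤ t ∧ a.eval m v = A i ∧ e.eval m v = g i) :
    Tri w (fillP k y a e) (s.reg y * (t + 8) + 5) s (fun s' => ∃ m, s' = { s with mem := m } ∧
      (∀ x < s.reg y, m (A x) = g x) ∧ ∀ c, (∀ x < s.reg y, c ≠ A x) → m c = s.mem c) := by
  let I : ℕ → State → Prop := fun i s' => (∀ r < k, s'.reg r = s.reg r) ∧ s'.coins = s.coins ∧
      (∀ x < i, s'.mem (A x) = g x) ∧ ∀ c, (∀ x < i, c ≠ A x) → s'.mem c = s.mem c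
  refine (Tri.forP hw hy (b := s.reg y) (t := t + 3) I ?_ ?_ ?_ hb h0 ?_).mono (by rfl) ?_
  · rintro i s1 s2 ⟨h1, h2, h3, h4⟩ e1 e2 e3
    exact ⟨fun r hr => (e1 r hr).trans (h1 r hr), e3.trans h2, by rwa [e2], by rwa [e2]⟩
  · rintro i s1 ⟨h1, _⟩; exact h1 y hy
  · rintro i hi s1 ⟨h1, h2, h3, h4⟩ hk _ _ hr
    have hv : s1.reg ∘ regMap (k + 1) = Function.update s.reg k i ∘ regMap (k + 1) := by
      funext x
      have := regMap_lt (Nat.succ_pos k) x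
      simp only [Function.comp]
      generalize regMap (k + 1) x = z at *
      by_cases hz : z = k
      · subst hz; simpa using hk
      · rw [Function.update_of_ne hz, h1 z (by omega)]
    obtain ⟨ha, he, ht, ea, ee⟩ := h i hi s1.mem h3 h4
    have := storeP_runs hw (l := k + 1) (k := k + 3) (Nat.succ_pos k) (by omega) hr (a := a) (e := e)
      (by rwa [hv]) (by rwa [hv])
    rw [hv, ea, ee] at this
    refine (Tri.of_runs this ?_).mono (by omega) (fun _ h => h)
    refine ⟨⟨h1, h2, fun x hx => ?_, fun c hc => ?_⟩, fun r _ => rfl⟩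
    · by_cases hxi : x = i
      · subst hxi; simp [State.setMem]
      · have : A x ≠ A i := hA i hi x (by omega)
        simp only [State.setMem]
        rw [Function.update_of_ne this]; exact h3 x (by omega)
    · simp only [State.setMem]
      rw [Function.update_of_ne (hc i (by omega))]
      exact h4 c fun x hx => hc x (by omega)
  · exact ⟨fun _ _ => rfl, rfl, by simp, fun _ _ => rfl⟩
  · rintro s' ⟨⟨h1, h2, h3, h4⟩, h5⟩
    refine ⟨s'.mem, ?_, h3, h4⟩
    have : s'.reg = s.reg := by
      funext r
      rcases lt_or_ge r k with hr | hr
      · exact h1 r hr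
      · rw [h5 r hr, h0 r hr]
    cases s'; cases s; simp_all

end

/-! ### A uniform bound for the values and the cost of expressions -/

namespace Exp

/-- An exponent `F` such that `Z ^ F` bounds the value and the cost of the expression if `Z` bounds
all variables, memory cells and constants. -/
def deg : Exp → ℕ
  | .const _ => 1
  | .var _ => 1
  | .op _ a b => a.deg + b.deg + 1
  | .load a => a.deg + 1
  | .bsum _ _ e => e.deg + 3

/-- The constants of the expression are at most `Z`, and its operations are among those whose values
are bounded by the product or the sum of the arguments. -/
def Fits (Z : ℕ) : Exp → Prop
  | .const c => c ≤ Z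
  | .var _ => True
  | .op o a b => a.Fits Z ∧ b.Fits Z ∧
      (o = .add ∨ o = .sub ∨ o = .mul ∨ o = .div ∨ o = .mod ∨ o = .shr ∨ o = .lt ∨ o = .eq)
  | .load a => a.Fits Z
  | .bsum _ _ e => e.Fits Z

theorem one_le_deg (e : Exp) : 1 ≤ e.deg := by cases e <;> simp [deg]

theorem _root_.WordRAM.Op.eval_le {o : Op}
    (ho : o = .add ∨ o = .sub ∨ o = .mul ∨ o = .div ∨ o = .mod ∨ o = .shr ∨ o = .lt ∨ o = .eq)
    {a b A B : ℕ} (ha : a ≤ A) (hb : b ≤ B) (hA : 1 ≤ A) (hB : 1 ≤ B) :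
    o.eval a b ≤ 2 * (A * B) := by
  have h1 : A ≤ A * B := Nat.le_mul_of_pos_right A hB
  have h2 : B ≤ A * B := Nat.le_mul_of_pos_left B hA
  have h3 : a * b ≤ A * B := Nat.mul_le_mul ha hb
  have h4 := Nat.div_le_self a b
  have h5 := Nat.mod_le a b
  have h6 := Nat.shiftRight_le a b
  rcases ho with rfl | rfl | rfl | rfl | rfl | rfl | rfl | rfl <;> simp only [Op.eval] <;>
    first | omega | (split <;> omega)

theorem eval_le_pow {Z : ℕ} (hZ : 16 ≤ Z) {m : ℕ → ℕ} (hm : ∀ c, m c ≤ Z) (e : Exp)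
    (he : e.Fits Z) : ∀ v : ℕ → ℕ, (∀ x, v x ≤ Z) → e.eval m v ≤ Z ^ e.deg := by
  induction e with
  | const c => intro v _; simpa [eval, deg, Fits] using he
  | var x => intro v hv; simpa [eval, deg] using hv x
  | op o a b iha ihb =>
    intro v hv
    have ha := iha he.1 v hv
    have hb := ihb he.2.1 v hv
    refine (Op.eval_le he.2.2 ha hb (Nat.one_le_pow _ _ (by omega))
      (Nat.one_le_pow _ _ (by omega))).trans ?_
    rw [deg, pow_succ, pow_add, mul_comm]
    exact Nat.mul_le_mul le_rfl (by omega)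
  | load a => intro v _; exact (hm _).trans (Nat.le_self_pow (by simp [deg]) _)
  | bsum x y e ih =>
    intro v hv
    refine (Finset.sum_le_card_nsmul _ _ (Z ^ e.deg) fun i hi => ih he _ fun z => ?_).trans ?_
    · by_cases hz : z = x
      · subst hz; simp only [Function.update_self]
        exact (Finset.mem_range.1 hi).le.trans (hv y)
      · rw [Function.update_of_ne hz]; exact hv z
    · rw [Finset.card_range, smul_eq_mul, deg]
      calc v y * Z ^ e.deg ≤ Z * Z ^ e.deg := Nat.mul_le_mul_right _ (hv y)
        _ = Z ^ (e.deg + 1) := by ring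
        _ ≤ _ := Nat.pow_le_pow_right (by omega) (by omega)

theorem safe_of_fits {Z : ℕ} (hZ : 16 ≤ Z) {m : ℕ → ℕ} (hm : ∀ c, m c ≤ Z) {w : ℕ} (e : Exp)
    (he : e.Fits Z) (hw : Z ^ e.deg < 2 ^ w) :
    ∀ v : ℕ → ℕ, (∀ x, v x ≤ Z) → e.Safe w m v := by
  have hZ1 : ∀ d, 1 ≤ d → d ≤ e.deg → Z ^ d < 2 ^ w := fun d _ h =>
    (Nat.pow_le_pow_right (by omega) h).trans_lt hw
  have hself : Z < 2 ^ w := by simpa using hZ1 1 le_rfl e.one_le_deg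
  induction e with
  | const c => intro v _; exact lt_of_le_of_lt he hself
  | var x => intro v hv; exact (hv x).trans_lt hself
  | op o a b iha ihb =>
    intro v hv
    refine ⟨iha he.1 (hZ1 _ a.one_le_deg (by simp [deg]; omega))
      (fun d h h' => hZ1 d h (by simp [deg]; omega)) v hv,
      ihb he.2.1 (hZ1 _ b.one_le_deg (by simp [deg]; omega))
      (fun d h h' => hZ1 d h (by simp [deg]; omega)) v hv, ?_⟩
    exact ((Exp.op o a b).eval_le_pow hZ hm he v hv).trans_lt hw
  | load a ih =>
    intro v hv
    exact ih he (hZ1 _ a.one_le_deg (by simp [deg])) (fun d h h' => hZ1 d h (by simp [deg]; omega))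
      v hv
  | bsum x y e ih =>
    intro v hv
    refine ⟨(hv y).trans_lt hself, fun i hi => ih he (hZ1 _ e.one_le_deg (by simp [deg]))
      (fun d h h' => hZ1 d h (by simp [deg]; omega)) _ fun z => ?_,
      ((Exp.bsum x y e).eval_le_pow hZ hm he v hv).trans_lt hw⟩
    by_cases hz : z = x
    · subst hz; simp only [Function.update_self]
      exact hi.le.trans (hv y)
    · rw [Function.update_of_ne hz]; exact hv z

theorem time_le_pow {Z : ℕ} (hZ : 16 ≤ Z) (e : Exp) :
    ∀ v : ℕ → ℕ, (∀ x, v x ≤ Z) → e.time v ≤ Z ^ e.deg := by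
  have h1 : ∀ d, 1 ≤ Z ^ d := fun d => Nat.one_le_pow _ _ (by omega)
  induction e with
  | const c => intro v _; exact h1 _
  | var x => intro v _; exact h1 _
  | op o a b iha ihb =>
    intro v hv
    have ha := iha v hv
    have hb := ihb v hv
    have h2 : Z ^ a.deg ≤ Z ^ a.deg * Z ^ b.deg := Nat.le_mul_of_pos_right _ (h1 _)
    have h3 : Z ^ b.deg ≤ Z ^ a.deg * Z ^ b.deg := Nat.le_mul_of_pos_left _ (h1 _)
    have h4 := h1 a.deg
    simp only [time, deg, pow_succ, pow_add]
    nlinarith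
  | load a ih =>
    intro v hv
    have := ih v hv
    have h2 := h1 a.deg
    simp only [time, deg, pow_succ]
    nlinarith
  | bsum x y e ih =>
    intro v hv
    have h2 : ∑ i ∈ Finset.range (v y), (e.time (Function.update v x i) + 6) ≤
        Z * (Z ^ e.deg + 6) := by
      refine (Finset.sum_le_card_nsmul _ _ (Z ^ e.deg + 6) fun i hi =>
        Nat.add_le_add_right (ih _ fun z => ?_) 6).trans ?_
      · by_cases hz : z = x
        · subst hz; simp only [Function.update_self]
          exact (Finset.mem_range.1 hi).le.trans (hv y)
        · rw [Function.update_of_ne hz]; exact hv z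
      · rw [Finset.card_range, smul_eq_mul]; exact Nat.mul_le_mul_right _ (hv y)
    have h3 := h1 e.deg
    simp only [time, deg, pow_succ]
    have h4 : Z ≤ Z ^ e.deg * Z := Nat.le_mul_of_pos_left _ h3
    have h5 : 16 * (Z ^ e.deg * Z) ≤ Z ^ e.deg * Z * Z := by nlinarith
    have h6 : Z ^ e.deg * Z * Z ≤ Z ^ e.deg * Z * Z * Z := Nat.le_mul_of_pos_right _ (by omega)
    nlinarith

end Exp

end WordRAM

/-! ### Determinants in characteristic two -/

section Bird

open Polynomial Matrix

variable {R : Type*} [CommRing R] {n : ℕ}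

/-- Bird's division-free recursion, in the sign-free form valid in characteristic two: `bird A p i j`
is the sum over all `p`-element sets `S` of indices above `i` of the minor of `A` with rows `i, S`
and columns `j, S`. -/
def bird (A : Matrix (Fin n) (Fin n) R) : ℕ → Fin n → Fin n → R
  | 0, i, j => A i j
  | p + 1, i, j => ∑ s, if i < s then bird A p i s * A s j + bird A p s s * A i j else 0

/-- The matrix `A` over `R[X]` with the rows before the `i`-th replaced by zero. -/
noncomputable def rowsFrom (A : Matrix (Fin n) (Fin n) R) (i : ℕ) : Matrix (Fin n) (Fin n) R[X] :=
  .of fun r c => if i ≤ r then C (A r c) else 0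

/-- The generating function of `bird A p i j` over all `p`: the determinant of `1 + X * A`,
restricted to the indices from `i` on, with its first column replaced by the `j`-th column of `A`
(see `bird_eq_coeff`). -/
noncomputable def birdSeries (A : Matrix (Fin n) (Fin n) R) (i j : Fin n) : R[X] :=
  (adjugate (1 + (X : R[X]) • rowsFrom A i) * rowsFrom A i : Matrix (Fin n) (Fin n) R[X]) i j

theorem rowsFrom_apply (A : Matrix (Fin n) (Fin n) R) (i : ℕ) (r c : Fin n) :
    rowsFrom A i r c = if i ≤ r then C (A r c) else 0 := rfl

theorem adjugate_mul_one_add (A : Matrix (Fin n) (Fin n) R) (i s : Fin n) :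
    adjugate (1 + (X : R[X]) • rowsFrom A i) i s + X * birdSeries A i s =
      if i = s then det (1 + (X : R[X]) • rowsFrom A i) else 0 := by
  have := congrFun₂ (adjugate_mul (1 + (X : R[X]) • rowsFrom A i)) i s
  rw [mul_add, mul_one, Matrix.mul_smul] at this
  simpa [birdSeries, Matrix.one_apply] using this

theorem adjugate_diag (A : Matrix (Fin n) (Fin n) R) (i : Fin n) :
    adjugate (1 + (X : R[X]) • rowsFrom A i) i i =
      det (1 + (X : R[X]) • rowsFrom A (i + 1)) := by
  rw [adjugate_apply]
  congr 1
  ext1 r c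
  by_cases hr : r = i
  · subst hr
    simp [rowsFrom, Matrix.one_apply, Pi.single_apply, eq_comm]
  · have : (i : ℕ) + 1 ≤ r ↔ (i : ℕ) ≤ r := by
      have : (r : ℕ) ≠ i := fun h => hr (Fin.ext h)
      omega
    rw [updateRow_ne hr, Matrix.add_apply, Matrix.add_apply, Matrix.smul_apply, Matrix.smul_apply,
      rowsFrom_apply, rowsFrom_apply, if_congr this rfl rfl]

theorem det_rowsFrom (A : Matrix (Fin n) (Fin n) R) (i : ℕ) :
    det (1 + (X : R[X]) • rowsFrom A i) =
      1 + X * ∑ k : Fin n, if i ≤ k then birdSeries A k k else 0 := by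
  suffices ∀ m i, n ≤ i + m → det (1 + (X : R[X]) • rowsFrom A i) =
      1 + X * ∑ k : Fin n, if i ≤ k then birdSeries A k k else 0 from this n i (by omega)
  intro m
  induction m with
  | zero =>
    intro i hi
    have h1 : ∀ k : Fin n, ¬ i ≤ k := fun k => by have := k.2; omega
    have h2 : rowsFrom A i = 0 := by ext1 r c; simp [rowsFrom, h1]
    simp [h1, h2]
  | succ m ih =>
    intro i hi
    rcases Nat.lt_or_ge i n with hin | hin
    · have h1 := adjugate_mul_one_add A ⟨i, hin⟩ ⟨i, hin⟩
      rw [if_pos rfl, adjugate_diag, ih (i + 1) (by omega)] at h1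
      rw [← h1, add_assoc, ← mul_add]
      congr 2
      have h2 : ∀ k : Fin n, (if i ≤ k then birdSeries A k k else 0) =
          (if i + 1 ≤ k then birdSeries A k k else 0) +
            if (⟨i, hin⟩ : Fin n) = k then birdSeries A k k else 0 := by
        intro k
        rcases lt_trichotomy i (k : ℕ) with h | h | h
        · rw [if_pos h.le, if_pos (Nat.succ_le_of_lt h), if_neg (fun e => by rw [← e] at h; simp at h), add_zero]
        · rw [if_pos h.le, if_neg (by omega), if_pos (Fin.ext h), zero_add]
        · rw [if_neg (by omega), if_neg (by omega),
            if_neg (fun e => by rw [← e] at h; simp at h), add_zero]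
      rw [Finset.sum_congr rfl fun k _ => h2 k, Finset.sum_add_distrib]
      simp
    · exact ih i (by omega)

variable [CharP R 2]

theorem birdSeries_eq (A : Matrix (Fin n) (Fin n) R) (i j : Fin n) :
    birdSeries A i j = C (A i j) + X * ∑ s, if i < s then
      birdSeries A i s * C (A s j) + birdSeries A s s * C (A i j) else 0 := by
  have hX : ∀ x : R[X], -x = x := CharTwo.neg_eq
  have h1 : ∀ s, adjugate (1 + (X : R[X]) • rowsFrom A i) i s * rowsFrom A i s j =
      (if i = s then C (A i j) * (1 + X * ∑ k : Fin n, if i < k then birdSeries A k k else 0) else 0)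
        + X * if i < s then birdSeries A i s * C (A s j) else 0 := by
    intro s
    rcases lt_trichotomy i s with h | h | h
    · have := adjugate_mul_one_add A i s
      rw [if_neg h.ne, add_eq_zero_iff_eq_neg, hX] at this
      have h' : (i : ℕ) ≤ s := h.le
      rw [this, if_neg h.ne, if_pos h, rowsFrom_apply, if_pos h', zero_add, mul_assoc]
    · subst h
      rw [adjugate_diag, det_rowsFrom]
      simp [rowsFrom_apply, mul_comm]
    · have h' : ¬ (i : ℕ) ≤ s := not_le.2 h
      rw [if_neg h.ne', if_neg h.not_gt, rowsFrom_apply, if_neg h']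
      simp
  rw [birdSeries, mul_apply, Finset.sum_congr rfl fun s _ => h1 s, Finset.sum_add_distrib,
    ← Finset.mul_sum, Finset.sum_ite_eq, if_pos (Finset.mem_univ _), mul_add, mul_one, add_assoc,
    mul_left_comm, ← mul_add, Finset.mul_sum, ← Finset.sum_add_distrib]
  congr 2
  refine Finset.sum_congr rfl fun s _ => ?_
  split <;> ring

theorem bird_eq_coeff (A : Matrix (Fin n) (Fin n) R) (p : ℕ) :
    ∀ i j, bird A p i j = (birdSeries A i j).coeff p := by
  induction p with
  | zero => intro i j; rw [birdSeries_eq]; simp [bird]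
  | succ p ih =>
    intro i j
    rw [birdSeries_eq, coeff_add, coeff_C_succ, zero_add, coeff_X_mul, finsetSum_coeff, bird]
    refine Finset.sum_congr rfl fun s _ => ?_
    split
    · simp [ih]
    · simp

/-- Bird's division-free determinant algorithm in characteristic two. -/
theorem det_eq_sum_bird (A : Matrix (Fin n) (Fin n) R) (hn : 0 < n) :
    A.det = ∑ k, bird A (n - 1) k k := by
  have h := coeff_det_X_add_C_card A (1 : Matrix (Fin n) (Fin n) R)
  have h1 : (X : R[X]) • A.map C + (1 : Matrix (Fin n) (Fin n) R).map C =
      1 + (X : R[X]) • rowsFrom A 0 := by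
    rw [add_comm]
    congr 1
    simp
  rw [h1, det_rowsFrom, Fintype.card_fin] at h
  obtain ⟨m, rfl⟩ : ∃ m, n = m + 1 := ⟨n - 1, by omega⟩
  rw [coeff_add, coeff_one, if_neg (by omega), zero_add, coeff_X_mul, finsetSum_coeff] at h
  rw [← h]
  exact Finset.sum_congr rfl fun k _ => by simp [bird_eq_coeff]

/-- In characteristic two only the involutions contribute to the determinant of a symmetric
matrix. -/
theorem det_eq_sum_involutions (A : Matrix (Fin n) (Fin n) R) (hA : ∀ i j, A i j = A j i) :
    A.det = ∑ σ : Equiv.Perm (Fin n) with σ⁻¹ = σ, ∏ u, A u (σ u) := by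
  have h1 : A.det = ∑ σ : Equiv.Perm (Fin n), ∏ u, A u (σ u) := by
    rw [det_apply]
    refine Finset.sum_congr rfl fun σ _ => ?_
    have : ∀ x : R, Equiv.Perm.sign σ • x = x := fun x => by
      rcases Int.units_eq_one_or (Equiv.Perm.sign σ) with h | h <;> simp [h, CharTwo.neg_eq]
    rw [this]
    exact Finset.prod_congr rfl fun u _ => hA _ _
  rw [h1, ← Finset.sum_filter_add_sum_filter_not _ (fun σ : Equiv.Perm (Fin n) => σ⁻¹ = σ)]
  rw [add_eq_left]
  refine Finset.sum_involution (fun σ _ => σ⁻¹) ?_ ?_ ?_ ?_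
  · intro σ _
    have : ∏ u, A u (σ⁻¹ u) = ∏ u, A u (σ u) := by
      rw [← Equiv.prod_comp σ]
      exact Finset.prod_congr rfl fun u _ => by simp [hA]
    rw [this, CharTwo.add_self_eq_zero]
  · intro σ hσ _
    exact (Finset.mem_filter.1 hσ).2
  · intro σ hσ
    simpa [eq_comm] using hσ
  · intro σ _; exact inv_inv σ

end Bird

/-! ### Counting involutions modulo two -/

section

open Finset

/-- Coefficients modulo two of `bird` for the matrix of monomials `X ^ E i j`: the last argument is
the exponent. -/
def birdN (E : ℕ → ℕ → ℕ) (n : ℕ) : ℕ → ℕ → ℕ → ℕ → ℕ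
  | 0, i, j, d => if d = E i j then 1 else 0
  | p + 1, i, j, d => (∑ s ∈ range n, (if i < s then 1 else 0) *
      ((if E s j < d + 1 then 1 else 0) * birdN E n p i s (d - E s j) +
        (if E i j < d + 1 then 1 else 0) * birdN E n p s s (d - E i j))) % 2

theorem birdN_le_one (E : ℕ → ℕ → ℕ) (n p i j d : ℕ) : birdN E n p i j d ≤ 1 := by
  cases p with
  | zero => rw [birdN]; split <;> omega
  | succ p => rw [birdN]; omega

/-- The involutions `σ` with `∑ u : Fin n, E u (σ u) = d`. -/
def involSet (n : ℕ) (E : ℕ → ℕ → ℕ) (d : ℕ) : Finset (Equiv.Perm (Fin n)) :=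
  univ.filter fun σ => σ⁻¹ = σ ∧ ∑ u : Fin n, E u (σ u) = d

open Polynomial in
theorem birdN_eq_coeff (E : ℕ → ℕ → ℕ) (n p : ℕ) : ∀ (i j : Fin n) (d : ℕ),
    ((birdN E n p i j d : ℕ) : ZMod 2) =
      (bird (.of fun a b : Fin n => (X : (ZMod 2)[X]) ^ E a b) p i j).coeff d := by
  induction p with
  | zero => intro i j d; simp [birdN, bird, coeff_X_pow]
  | succ p ih =>
    intro i j d
    rw [birdN, bird, ZMod.natCast_mod, finsetSum_coeff, Nat.cast_sum, Finset.sum_range]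
    refine sum_congr rfl fun s _ => ?_
    by_cases h : i < s
    · have h' : (i : ℕ) < s := h
      simp only [h, h', if_true, coeff_add, Matrix.of_apply, coeff_mul_X_pow', one_mul,
        Nat.cast_add, Nat.cast_mul, Nat.lt_succ_iff, ih]
      congr 1 <;> split <;> simp
    · have h' : ¬ (i : ℕ) < s := h
      simp [h, h']

open Polynomial in
theorem sum_birdN {E : ℕ → ℕ → ℕ} {n : ℕ} (hn : 0 < n) (hE : ∀ a < n, ∀ b < n, E a b = E b a)
    (d : ℕ) : ((∑ k ∈ range n, birdN E n (n - 1) k k d : ℕ) : ZMod 2) = #(involSet n E d) := by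
  have h := det_eq_sum_bird (.of fun a b : Fin n => (X : (ZMod 2)[X]) ^ E a b) hn
  rw [det_eq_sum_involutions _ fun i j => by simp [hE i i.2 j j.2]] at h
  have h := congrArg (fun f => f.coeff d) h
  simp only [finsetSum_coeff, ← birdN_eq_coeff, Matrix.of_apply, prod_pow_eq_pow_sum, coeff_X_pow]
    at h
  rw [Finset.sum_range, Nat.cast_sum, ← h, sum_boole, involSet, filter_filter]
  simp [eq_comm]

/-- Raising the exponents of some pairs beyond `d` amounts to forbidding these pairs. -/
theorem involSet_add_mul {n N d : ℕ} (E kill : ℕ → ℕ → ℕ) (hd : d < N) :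
    involSet n (fun a b => E a b + N * kill a b) d =
      (involSet n E d).filter fun σ => ∀ u : Fin n, kill u (σ u) = 0 := by
  ext σ
  simp only [involSet, mem_filter, mem_univ, true_and, and_assoc, sum_add_distrib, ← mul_sum]
  refine and_congr_right fun _ => ?_
  rcases Nat.eq_zero_or_pos (∑ u : Fin n, kill u (σ u)) with h | h
  · have h' : ∀ u : Fin n, kill u (σ u) = 0 := fun u => (sum_eq_zero_iff.1 h) u (mem_univ u)
    simp [h']
  · have h1 : N ≤ N * ∑ u : Fin n, kill u (σ u) := Nat.le_mul_of_pos_right _ h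
    have h2 : ¬ ∀ u : Fin n, kill u (σ u) = 0 := fun h' => by simp [h'] at h
    simp only [h2, and_false, iff_false]
    omega

/-! ### Binary counters and inclusion–exclusion modulo two -/

/-- The number of positions below `p` that are marked by `act`. -/
def rank (act : ℕ → ℕ) (p : ℕ) : ℕ := ∑ q ∈ range p, act q

/-- The `m`-th subset of the marked positions: the digits of `m` are spread over these positions. -/
def mask (act : ℕ → ℕ) (m p : ℕ) : ℕ := act p * (m.testBit (rank act p)).toNat

theorem mask_le_one {act : ℕ → ℕ} (hact : ∀ p, act p ≤ 1) (m p : ℕ) : mask act m p ≤ 1 := by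
  have := hact p
  have := (m.testBit (rank act p)).toNat_le
  simp only [mask]; nlinarith

theorem testBit_succ_eq (r : ℕ) : ∀ m : ℕ, (m + 1).testBit r =
    (m.testBit r ^^ decide (∀ i < r, m.testBit i = true)) := by
  induction r with
  | zero =>
    intro m
    simp only [Nat.testBit_zero]
    rcases Nat.mod_two_eq_zero_or_one m with h | h <;> simp [h] <;> omega
  | succ r ih =>
    intro m
    have h : (∀ i < r + 1, m.testBit i = true) ↔
        m.testBit 0 = true ∧ ∀ i < r, (m / 2).testBit i = true := by
      constructor
      · exact fun h => ⟨h 0 (by omega), fun i hi => by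
          rw [Nat.testBit_div_two]; exact h (i + 1) (by omega)⟩
      · rintro ⟨h0, h⟩ (_ | i) hi
        · exact h0
        · rw [← Nat.testBit_div_two]; exact h i (by omega)
    simp only [Nat.testBit_succ, h]
    rcases Nat.mod_two_eq_zero_or_one m with h2 | h2
    · have : (m + 1) / 2 = m / 2 := by omega
      simp [this, Nat.testBit_zero, h2]
    · have : (m + 1) / 2 = m / 2 + 1 := by omega
      rw [this, ih]; simp [Nat.testBit_zero, h2]

theorem sum_zeros_eq_zero_iff {act : ℕ → ℕ} (hact : ∀ p, act p ≤ 1) (m p : ℕ) :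
    ∑ q ∈ range p, act q * (1 - mask act m q) = 0 ↔ ∀ i < rank act p, m.testBit i = true := by
  induction p with
  | zero => simp [rank]
  | succ p ih =>
    have hr : rank act (p + 1) = rank act p + act p := by rw [rank, sum_range_succ, rank]
    rw [sum_range_succ, Nat.add_eq_zero_iff, ih, hr]
    rcases Nat.le_one_iff_eq_zero_or_eq_one.1 (hact p) with h | h
    · simp [h]
    · simp only [h, mask, one_mul, Nat.lt_succ_iff, le_iff_lt_or_eq]
      cases hb : m.testBit (rank act p) <;> simp [hb, or_imp, forall_and]

theorem mask_succ {act : ℕ → ℕ} (hact : ∀ p, act p ≤ 1) (m p : ℕ) :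
    mask act (m + 1) p = act p * ((mask act m p +
      if ∑ q ∈ range p, act q * (1 - mask act m q) = 0 then 1 else 0) % 2) := by
  simp only [sum_zeros_eq_zero_iff hact]
  rw [mask, mask, testBit_succ_eq]
  rcases Nat.le_one_iff_eq_zero_or_eq_one.1 (hact p) with h | h
  · simp [h]
  · cases hb : m.testBit (rank act p) <;>
      by_cases hc : ∀ i < rank act p, m.testBit i = true <;>
      first
      | rw [decide_eq_true hc, if_pos hc, h]; rfl
      | rw [decide_eq_false hc, if_neg hc, h]; rfl

theorem forall_testBit_iff {k m : ℕ} (hm : m < 2 ^ k) :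
    (∀ i < k, m.testBit i = true) ↔ m + 1 = 2 ^ k := by
  constructor
  · intro h
    have : m = 2 ^ k - 1 := Nat.eq_of_testBit_eq fun i => by
      rw [Nat.testBit_two_pow_sub_one]
      by_cases hi : i < k
      · simp [hi, h i hi]
      · simp only [hi, decide_false]
        exact Nat.testBit_lt_two_pow (hm.trans_le (Nat.pow_le_pow_right (by omega) (by omega)))
    have := Nat.two_pow_pos k
    omega
  · intro h i hi
    have : m = 2 ^ k - 1 := by omega
    rw [this, Nat.testBit_two_pow_sub_one]; simpa using hi

theorem rank_lt_rank {act : ℕ → ℕ} {p T : ℕ} (h : act p = 1) (hp : p < T) :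
    rank act p < rank act T := by
  have h1 : rank act (p + 1) = rank act p + 1 := by rw [rank, sum_range_succ, h, rank]
  have h2 : rank act (p + 1) ≤ rank act T :=
    sum_le_sum_of_subset (fun x hx => by simp only [mem_range] at *; omega)
  omega

/-- The number of sets of marked positions that avoid `P` is odd if and only if all marked positions
belong to `P`. -/
theorem sum_mask_avoids {act : ℕ → ℕ} (hact : ∀ p, act p ≤ 1) (P : ℕ → Prop) [DecidablePred P]
    (T : ℕ) : ∑ m ∈ range (2 ^ rank act T),
        (if ∀ p < T, P p → mask act m p = 0 then (1 : ZMod 2) else 0) =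
      if ∀ p < T, act p = 1 → P p then 1 else 0 := by
  induction T with
  | zero => simp [rank]
  | succ T ih =>
    rcases Nat.le_one_iff_eq_zero_or_eq_one.1 (hact T) with h | h
    · have h1 : rank act (T + 1) = rank act T := by rw [rank, sum_range_succ, h, add_zero, rank]
      have h2 : ∀ m, mask act m T = 0 := fun m => by simp [mask, h]
      have h3 : ∀ m, (∀ p < T + 1, P p → mask act m p = 0) ↔ ∀ p < T, P p → mask act m p = 0 :=
        fun m => ⟨fun H p hp => H p (by omega), fun H p hp hP => by
          rcases Nat.lt_succ_iff_lt_or_eq.1 hp with h | rfl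
          · exact H p h hP
          · exact h2 m⟩
      have h4 : (∀ p < T + 1, act p = 1 → P p) ↔ ∀ p < T, act p = 1 → P p :=
        ⟨fun H p hp => H p (by omega), fun H p hp hP => by
          rcases Nat.lt_succ_iff_lt_or_eq.1 hp with h | rfl
          · exact H p h hP
          · omega⟩
      simp only [h1, h3, h4, ih]
    · have h1 : rank act (T + 1) = rank act T + 1 := by rw [rank, sum_range_succ, h, rank]
      have hm : ∀ m < 2 ^ rank act T, ((∀ p < T + 1, P p → mask act m p = 0) ↔
          ∀ p < T, P p → mask act m p = 0) := fun m hm =>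
        ⟨fun H p hp => H p (by omega), fun H p hp hP => by
          rcases Nat.lt_succ_iff_lt_or_eq.1 hp with h | rfl
          · exact H p h hP
          · simp [mask, Nat.testBit_lt_two_pow hm]⟩
      have hm' : ∀ m < 2 ^ rank act T,
          ((∀ p < T + 1, P p → mask act (2 ^ rank act T + m) p = 0) ↔
          ¬ P T ∧ ∀ p < T, P p → mask act m p = 0) := by
        intro m hm
        have e1 : mask act (2 ^ rank act T + m) T = 1 := by
          simp [mask, h, Nat.testBit_two_pow_add_eq, Nat.testBit_lt_two_pow hm]
        have e2 : ∀ p < T, mask act (2 ^ rank act T + m) p = mask act m p := fun p hp => by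
          rcases Nat.le_one_iff_eq_zero_or_eq_one.1 (hact p) with h' | h'
          · simp [mask, h']
          · simp [mask, Nat.testBit_two_pow_add_gt (rank_lt_rank h' hp)]
        constructor
        · exact fun H => ⟨fun hP => by simpa [e1] using H T (by omega) hP, fun p hp hP => by
            rw [← e2 p hp]; exact H p (by omega) hP⟩
        · rintro ⟨H1, H2⟩ p hp hP
          rcases Nat.lt_succ_iff_lt_or_eq.1 hp with h | rfl
          · rw [e2 p h]; exact H2 p h hP
          · exact absurd hP H1
      have h4 : (∀ p < T + 1, act p = 1 → P p) ↔ P T ∧ ∀ p < T, act p = 1 → P p :=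
        ⟨fun H => ⟨H T (by omega) h, fun p hp => H p (by omega)⟩, fun H p hp hP => by
          rcases Nat.lt_succ_iff_lt_or_eq.1 hp with h | rfl
          · exact H.2 p h hP
          · exact H.1⟩
      rw [h1, pow_succ, mul_two, sum_range_add,
        sum_congr rfl fun m h => if_congr (hm m (mem_range.1 h)) rfl rfl,
        sum_congr rfl fun m h => if_congr (hm' m (mem_range.1 h)) rfl rfl, ih, if_congr h4 rfl rfl]
      by_cases hP : P T
      · simp [hP]
      · simp only [hP, not_false_eq_true, true_and, ih, false_and, if_false]
        exact CharTwo.add_self_eq_zero _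

/-! ### The isolation lemma -/

/-- The isolation lemma: if the elements of `ι` get independent uniform weights, then with high
probability some member of the family is determined by its weight. -/
theorem isolation {ι V S : Type*} [Fintype ι] [DecidableEq ι] [Fintype V] [DecidableEq V]
    (r : V → ℕ) (hr : Function.Injective r) (𝒮 : Finset S) (h𝒮 : 𝒮.Nonempty) (e : S → Finset ι)
    (he : Set.InjOn e 𝒮) (g : S → ℕ) {c : ℕ} (hc : 0 < c) (B : Finset (ι → V))
    (hB : ∀ x ∈ B, ¬ ∃ σ ∈ 𝒮, ∀ τ ∈ 𝒮,
      g τ + c * ∑ q ∈ e τ, r (x q) = g σ + c * ∑ q ∈ e σ, r (x q) → τ = σ) :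
    #B * Fintype.card V ≤ Fintype.card ι * Fintype.card V ^ Fintype.card ι := by
  classical
  set f : (ι → V) → S → ℕ := fun x σ => g σ + c * ∑ q ∈ e σ, r (x q) with hf
  -- `q` separates two members of minimum weight
  let A : ι → Finset (ι → V) := fun q => univ.filter fun x => ∃ σ ∈ 𝒮, ∃ τ ∈ 𝒮, q ∈ e σ ∧ q ∉ e τ ∧
    (∀ υ ∈ 𝒮, f x σ ≤ f x υ) ∧ ∀ υ ∈ 𝒮, f x τ ≤ f x υ
  have hsub : B ⊆ univ.biUnion A := by
    intro x hx
    obtain ⟨σ, hσ, hmin⟩ := exists_min_image 𝒮 (f x) h𝒮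
    have := hB x hx
    push Not at this
    obtain ⟨τ, hτ, hw, hne⟩ := this σ hσ
    have hw : f x τ = f x σ := hw
    have hmin' : ∀ υ ∈ 𝒮, f x τ ≤ f x υ := fun υ hυ => hw ▸ hmin υ hυ
    have hne' : e τ ≠ e σ := fun h => hne (he hτ hσ h)
    obtain ⟨q, hq⟩ : ∃ q, ¬ (q ∈ e τ ↔ q ∈ e σ) := by
      by_contra! h; exact hne' (Finset.ext h)
    simp only [mem_biUnion, mem_univ, true_and, A, mem_filter]
    by_cases hqσ : q ∈ e σ
    · exact ⟨q, σ, hσ, τ, hτ, hqσ, fun h => hq ⟨fun _ => hqσ, fun _ => h⟩, hmin, hmin'⟩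
    · refine ⟨q, τ, hτ, σ, hσ, ?_, hqσ, hmin', hmin⟩
      by_contra h; exact hq ⟨fun h' => absurd h' h, fun h' => absurd h' hqσ⟩
  -- the weight of `q` is determined by the other weights
  have hdet : ∀ q, ∀ x ∈ A q, ∀ x' ∈ A q, (∀ q' ≠ q, x q' = x' q') → ¬ r (x q) < r (x' q) := by
    intro q x hx x' hx' hxx hlt
    simp only [A, mem_filter, mem_univ, true_and] at hx hx'
    obtain ⟨σ, hσ, τ, hτ, hqσ, hqτ, hminσ, hminτ⟩ := hx
    obtain ⟨σ', hσ', τ', hτ', hqσ', hqτ', hminσ', hminτ'⟩ := hx'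
    have hout : ∀ υ, q ∉ e υ → f x υ = f x' υ := fun υ hυ => by
      simp only [hf]
      rw [sum_congr rfl fun q' hq' => by rw [hxx q' (fun h => hυ (h ▸ hq'))]]
    have hin : ∀ υ, q ∈ e υ → f x υ < f x' υ := fun υ hυ => by
      simp only [hf]
      refine Nat.add_lt_add_left (Nat.mul_lt_mul_of_pos_left ?_ hc) _
      refine sum_lt_sum (fun q' _ => ?_) ⟨q, hυ, hlt⟩
      by_cases h : q' = q
      · subst h; exact hlt.le
      · rw [hxx q' h]
    have h1 := hminσ' τ hτ
    have h2 := hout τ hqτ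
    have h3 := hminτ σ' hσ'
    have h4 := hin σ' hqσ'
    omega
  have hA : ∀ q, #(A q) * Fintype.card V ≤ Fintype.card V ^ Fintype.card ι := by
    intro q
    have : #(A q ×ˢ (univ : Finset V)) ≤ #(univ : Finset (ι → V)) := by
      refine card_le_card_of_injOn (fun p => Function.update p.1 q p.2) (fun _ _ => mem_univ _) ?_
      rintro ⟨x, y⟩ h ⟨x', y'⟩ h' heq
      simp only [coe_product, coe_univ, Set.mem_prod, mem_coe, Set.mem_univ, and_true] at h h'
      have hy : y = y' := by simpa using congrFun heq q
      have hxx : ∀ q' ≠ q, x q' = x' q' := fun q' hq' => by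
        simpa [Function.update_of_ne hq'] using congrFun heq q'
      have hq : x q = x' q := hr (le_antisymm
        (not_lt.1 (hdet q x' h' x h fun q' hq' => (hxx q' hq').symm))
        (not_lt.1 (hdet q x h x' h' hxx)))
      refine Prod.ext (funext fun q' => ?_) hy
      by_cases h : q' = q
      · subst h; exact hq
      · exact hxx q' h
    rw [card_product] at this
    simpa using this
  calc #B * Fintype.card V ≤ (∑ q, #(A q)) * Fintype.card V :=
        Nat.mul_le_mul_right _ ((card_le_card hsub).trans card_biUnion_le)
    _ = ∑ q, #(A q) * Fintype.card V := by rw [sum_mul]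
    _ ≤ ∑ _q : ι, Fintype.card V ^ Fintype.card ι := sum_le_sum fun q _ => hA q
    _ = _ := by simp

/-- The number with the given binary digits. -/
def bitsValue (K : ℕ) (y : ℕ → Bool) : ℕ := ∑ b ∈ range K, (y b).toNat * 2 ^ b

theorem bitsValue_lt (K : ℕ) (y : ℕ → Bool) : bitsValue K y < 2 ^ K := by
  induction K with
  | zero => simp [bitsValue]
  | succ K ih =>
    rw [bitsValue, sum_range_succ, ← bitsValue, pow_succ]
    have := (y K).toNat_le
    nlinarith

theorem bitsValue_inj {K : ℕ} : ∀ {y y' : ℕ → Bool}, bitsValue K y = bitsValue K y' →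
    ∀ b < K, y b = y' b := by
  induction K with
  | zero => intro y y' _ b hb; omega
  | succ K ih =>
    intro y y' h b hb
    have hs : ∀ z : ℕ → Bool, bitsValue (K + 1) z =
        2 * bitsValue K (fun b => z (b + 1)) + (z 0).toNat := fun z => by
      rw [bitsValue, sum_range_succ', bitsValue, mul_sum]
      simp only [pow_zero, mul_one]
      congr 1
      exact sum_congr rfl fun b _ => by ring
    rw [hs, hs] at h
    have h0 := (y 0).toNat_le
    have h0' := (y' 0).toNat_le
    rcases b with _ | b
    · have h1 : (y 0).toNat = (y' 0).toNat := by omega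
      revert h1
      cases y 0 <;> cases y' 0 <;> simp
    · exact ih (y := fun b => y (b + 1)) (y' := fun b => y' (b + 1)) (by omega) b (by omega)

open MeasureTheory in
theorem coinMeasure_cylinder (m : ℕ) (x : ℕ → Bool) :
    WordRAM.coinMeasure {ρ | ∀ i < m, ρ i = x i} = ((2 : ENNReal) ^ m)⁻¹ := by
  have h : {ρ : ℕ → Bool | ∀ i < m, ρ i = x i} = Set.pi (range m) fun i => {x i} := by
    ext ρ; simp
  rw [h, WordRAM.coinMeasure, Measure.infinitePi_pi _ fun i _ => measurableSet_singleton _]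
  simp [ENNReal.inv_pow]

/-- Blocks of `K` coin flips that belong to a small set of patterns are unlikely. -/
theorem coinMeasure_le {Q K a : ℕ} (B : Finset (Fin Q → Fin K → Bool))
    (hB : #B * 2 ^ K ≤ a * (2 ^ K) ^ Q) :
    WordRAM.coinMeasure {ρ | (fun (q : Fin Q) (b : Fin K) => ρ (q * K + b)) ∈ B} ≤
      (a : ENNReal) * ((2 : ENNReal) ^ K)⁻¹ := by
  classical
  let ext : (Fin Q → Fin K → Bool) → ℕ → Bool := fun x i =>
    if h : i / K < Q ∧ i % K < K then x ⟨i / K, h.1⟩ ⟨i % K, h.2⟩ else false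
  have hsub : {ρ : ℕ → Bool | (fun (q : Fin Q) (b : Fin K) => ρ (q * K + b)) ∈ B} ⊆
      ⋃ x ∈ B, {ρ : ℕ → Bool | ∀ i < Q * K, ρ i = ext x i} := by
    intro ρ hρ
    simp only [Set.mem_iUnion, Set.mem_ofPred_eq] at hρ ⊢
    refine ⟨_, hρ, fun i hi => ?_⟩
    have hK : 0 < K := Nat.pos_of_ne_zero fun h => by simp [h] at hi
    have h1 : i / K < Q := Nat.div_lt_of_lt_mul (by rwa [mul_comm])
    have h2 : i % K < K := Nat.mod_lt _ hK
    simp only [ext, h1, h2, and_self, dif_pos]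
    congr 1
    rw [mul_comm, Nat.div_add_mod]
  refine (MeasureTheory.measure_mono hsub).trans ((MeasureTheory.measure_biUnion_finset_le _ _).trans
    ?_)
  simp only [coinMeasure_cylinder, sum_const, nsmul_eq_mul]
  have h2 : (2 : ENNReal) ^ (Q * K) ≠ 0 := by simp
  have h2' : (2 : ENNReal) ^ (Q * K) ≠ ⊤ := by simp
  have hK : (2 : ENNReal) ^ K ≠ 0 := by simp
  have hK' : (2 : ENNReal) ^ K ≠ ⊤ := by simp
  have hB' : (#B : ENNReal) * 2 ^ K ≤ a * 2 ^ (Q * K) := by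
    rw [mul_comm Q K, pow_mul]; exact_mod_cast hB
  rw [← div_eq_mul_inv, ← div_eq_mul_inv, ENNReal.div_le_iff h2 h2', mul_comm (_ / _),
    ← mul_div_assoc, ENNReal.le_div_iff_mul_le (Or.inl hK) (Or.inl hK')]
  rwa [mul_comm (2 ^ (Q * K))]

/-! ### Instances as tables of natural numbers -/

/-- The data of an instance, in units in which all weights are integral, as the algorithm sees it:
`pf v` is the part of node `v`; `wt (u * n + v)` is `0` if there is no edge of weight at most `L`
between `u` and `v`, and otherwise this weight plus `1`; `hm (i * t + j)` is `1` if the pattern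
contains the edge `{i, j}`, and `0` otherwise. -/
structure CMData (n t : ℕ) where
  L : ℕ
  pf : ℕ → ℕ
  wt : ℕ → ℕ
  hm : ℕ → ℕ

namespace CMData

variable {n t : ℕ}

/-- The marked positions of the pattern matrix, one for each pattern edge. -/
def act (J : CMData n t) (p : ℕ) : ℕ := J.hm p * (1 - if p % t < p / t then 1 else 0)

/-- Some edge `{u, σ u}` hits the pattern edge at position `p`. -/
def Hits (J : CMData n t) (σ : Equiv.Perm (Fin n)) (p : ℕ) : Prop :=
  ∃ u : Fin n, p = J.pf u * t + J.pf (σ u) ∨ p = J.pf (σ u) * t + J.pf u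

/-- The solutions of the instance, as involutions mapping every node to its partner; the edge
weights are counted twice in the sum. -/
def IsSol (J : CMData n t) (σ : Equiv.Perm (Fin n)) : Prop :=
  σ⁻¹ = σ ∧ (∀ u : Fin n, J.wt (u * n + σ u) ≠ 0) ∧
    ∑ u : Fin n, (J.wt (u * n + σ u) - 1) ≤ 2 * J.L ∧
    ∀ p < t * t, J.act p = 1 → J.Hits σ p

/-- The consistency properties of the data of an instance. -/
structure Valid (J : CMData n t) : Prop where
  t_le : t ≤ n
  pf_lt : ∀ v < n, J.pf v < t
  wt_le : ∀ q, J.wt q ≤ J.L + 1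
  wt_symm : ∀ a < n, ∀ b < n, J.wt (a * n + b) = J.wt (b * n + a)
  wt_diag : ∀ a < n, J.wt (a * n + a) = 0
  hm_le : ∀ p, J.hm p ≤ 1

theorem Valid.act_le_one {J : CMData n t} (hJ : J.Valid) (p : ℕ) : J.act p ≤ 1 := by
  rw [act]
  calc _ ≤ 1 * 1 := Nat.mul_le_mul (hJ.hm_le p) (by omega)
    _ = 1 := rfl

end CMData

theorem List.getD_flatMap_map {α : Type*} {m : ℕ} (f : α → Fin m → ℕ) (l : List α) :
    (l.flatMap fun u => (List.finRange m).map (f u)).length = l.length * m ∧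
    ∀ (i : ℕ) (hi : i < l.length) (j : ℕ) (hj : j < m),
      (l.flatMap fun u => (List.finRange m).map (f u)).getD (i * m + j) 0 = f l[i] ⟨j, hj⟩ := by
  induction l with
  | nil => simp
  | cons a l ih =>
    refine ⟨by rw [List.flatMap_cons, List.length_append, ih.1]; simp [Nat.succ_mul, add_comm], ?_⟩
    rintro (_ | i) hi j hj
    · rw [List.flatMap_cons, List.getD_append _ _ _ _ (by simpa using hj)]
      simp [hj]
    · rw [List.flatMap_cons, List.getD_append_right _ _ _ _ (by simp [Nat.succ_mul]; omega)]
      have : (i + 1) * m + j - (List.map (f a) (List.finRange m)).length = i * m + j := by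
        simp [Nat.succ_mul]; omega
      rw [this, ih.2 i (by simpa using hi) j hj]
      simp

namespace CMInstance

variable (I : CMInstance) (D : ℕ)

theorem encode_length : (I.encode D).length = 4 + I.n + I.n * I.n + I.t * I.t := by
  rw [encode, List.length_append, List.length_append, List.length_append,
    (List.getD_flatMap_map _ _).1, (List.getD_flatMap_map _ _).1]
  simp

theorem encode_head : (I.encode D).getD 0 0 = I.n ∧ (I.encode D).getD 1 0 = I.t ∧
    (I.encode D).getD 3 0 = I.bound D := by
  simp [encode]

theorem encode_part (v : Fin I.n) : (I.encode D).getD (4 + v) 0 = I.part v := by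
  have hv := v.2
  rw [encode, List.append_assoc, List.append_assoc, List.getD_append_right _ _ _ _ (by simp),
    List.getD_append _ _ _ _ (by simp)]
  simp

open Classical in
theorem encode_weight (u v : Fin I.n) : (I.encode D).getD (4 + I.n + (u * I.n + v)) 0 =
    if I.G.Adj u v then ⌊(D : ℚ≥0) * I.γ s(u, v)⌋₊ + 1 else 0 := by
  have h := List.getD_flatMap_map (fun u v => if I.G.Adj u v then
    ⌊(D : ℚ≥0) * I.γ s(u, v)⌋₊ + 1 else 0) (List.finRange I.n)
  have hlt : (u : ℕ) * I.n + v < I.n * I.n := by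
    calc (u : ℕ) * I.n + v < u * I.n + I.n := by omega
      _ = (u + 1) * I.n := by ring
      _ ≤ _ := Nat.mul_le_mul_right _ u.2
  rw [encode, List.getD_append _ _ _ _ (by
      rw [List.length_append, List.length_append, h.1]; simp; omega),
    List.getD_append_right _ _ _ _ (by simp; omega)]
  have e : 4 + I.n + ((u : ℕ) * I.n + v) - ([I.n, I.t, D, I.bound D] ++
      (List.finRange I.n).map (fun v => (I.part v : ℕ))).length = u * I.n + v := by
    simp; omega
  rw [e, h.2 u (by simp) v v.2]
  simp

open Classical in
theorem encode_pattern (i j : Fin I.t) :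
    (I.encode D).getD (4 + I.n + I.n * I.n + (i * I.t + j)) 0 = if s(i, j) ∈ I.H then 1 else 0 := by
  have h := List.getD_flatMap_map (fun i j => if s(i, j) ∈ I.H then 1 else 0) (List.finRange I.t)
  have h' := List.getD_flatMap_map (fun u v => if I.G.Adj u v then
    ⌊(D : ℚ≥0) * I.γ s(u, v)⌋₊ + 1 else 0) (List.finRange I.n)
  rw [encode, List.getD_append_right _ _ _ _ (by
    rw [List.length_append, List.length_append, h'.1]; simp)]
  have e : 4 + I.n + I.n * I.n + ((i : ℕ) * I.t + j) - ([I.n, I.t, D, I.bound D] ++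
      (List.finRange I.n).map (fun v => (I.part v : ℕ)) ++
      (List.finRange I.n).flatMap (fun u => (List.finRange I.n).map fun v =>
        if I.G.Adj u v then ⌊(D : ℚ≥0) * I.γ s(u, v)⌋₊ + 1 else 0)).length = i * I.t + j := by
    rw [List.length_append, List.length_append, h'.1]; simp
  rw [e, h.2 i (by simp) j j.2]
  simp

/-- The data that the algorithm reads from the input words. -/
noncomputable def data : CMData I.n I.t where
  L := I.bound D
  pf v := (I.encode D).getD (4 + v) 0
  wt q := if (I.encode D).getD (4 + I.n + q) 0 < I.bound D + 2 then
    (I.encode D).getD (4 + I.n + q) 0 else 0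
  hm p := if p < I.t * I.t then (I.encode D).getD (4 + I.n + I.n * I.n + p) 0 else 0

theorem data_pf (v : Fin I.n) : (I.data D).pf v = I.part v := I.encode_part D v

open Classical in
theorem data_wt (u v : Fin I.n) : (I.data D).wt (u * I.n + v) =
    if I.G.Adj u v ∧ ⌊(D : ℚ≥0) * I.γ s(u, v)⌋₊ ≤ I.bound D then
      ⌊(D : ℚ≥0) * I.γ s(u, v)⌋₊ + 1 else 0 := by
  simp only [data, encode_weight]
  by_cases h : I.G.Adj u v
  · simp [h]
  · simp [h]

theorem data_hm (i j : Fin I.t) : (I.data D).hm (i * I.t + j) = if s(i, j) ∈ I.H then 1 else 0 := by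
  classical
  have hlt : (i : ℕ) * I.t + j < I.t * I.t := by
    calc (i : ℕ) * I.t + j < i * I.t + I.t := by omega
      _ = (i + 1) * I.t := by ring
      _ ≤ _ := Nat.mul_le_mul_right _ i.2
  exact (if_pos hlt).trans (I.encode_pattern D i j)

theorem data_valid : (I.data D).Valid where
  t_le := by
    have := Fintype.card_le_of_surjective _ I.part_surjective
    simpa using this
  pf_lt v hv := by
    have := I.data_pf D ⟨v, hv⟩
    simp only at this
    rw [this]; exact (I.part _).2
  wt_le q := by simp only [data]; split <;> omega
  wt_symm a ha b hb := by
    have h1 := I.data_wt D ⟨a, ha⟩ ⟨b, hb⟩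
    have h2 := I.data_wt D ⟨b, hb⟩ ⟨a, ha⟩
    rw [I.G.adj_comm, Sym2.eq_swap] at h2
    exact h1.trans h2.symm
  wt_diag a ha := by
    have h1 := I.data_wt D ⟨a, ha⟩ ⟨a, ha⟩
    simpa using h1
  hm_le p := by
    by_cases hp : p < I.t * I.t
    swap
    · simp [data, hp]
    have ht : 0 < I.t := Nat.pos_of_ne_zero fun h => by simp [h] at hp
    have h1 : p / I.t < I.t := Nat.div_lt_of_lt_mul hp
    have := I.data_hm D ⟨p / I.t, h1⟩ ⟨p % I.t, Nat.mod_lt _ ht⟩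
    simp only at this
    rw [mul_comm, Nat.div_add_mod] at this
    rw [this]; split <;> omega

/-- The pattern has at least as many edges as there are marked positions. -/
theorem rank_act_le : rank (I.data D).act (I.t * I.t) ≤ I.H.card := by
  classical
  have hle := (I.data_valid D).act_le_one
  have h1 : rank (I.data D).act (I.t * I.t) = #{p ∈ range (I.t * I.t) | (I.data D).act p = 1} := by
    rw [rank, card_filter]
    refine sum_congr rfl fun p _ => ?_
    have := hle p
    split <;> omega
  rw [h1]
  have key : ∀ p ∈ ({p ∈ range (I.t * I.t) | (I.data D).act p = 1} : Finset ℕ),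
      ∃ i j : Fin I.t, p = i * I.t + j ∧ i ≤ j ∧ s(i, j) ∈ I.H := by
    intro p hp
    obtain ⟨hp, ha⟩ := mem_filter.1 hp
    have hp := mem_range.1 hp
    have ht : 0 < I.t := Nat.pos_of_ne_zero fun h => by simp [h] at hp
    have h1 : p / I.t < I.t := Nat.div_lt_of_lt_mul hp
    have := I.data_hm D ⟨p / I.t, h1⟩ ⟨p % I.t, Nat.mod_lt _ ht⟩
    have hpe : p / I.t * I.t + p % I.t = p := by rw [mul_comm, Nat.div_add_mod]
    simp only [hpe] at this
    refine ⟨⟨p / I.t, h1⟩, ⟨p % I.t, Nat.mod_lt _ ht⟩, hpe.symm, ?_, ?_⟩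
    · by_contra h
      have h' : p % I.t < p / I.t := by simpa using h
      rw [CMData.act, if_pos h'] at ha
      simp at ha
    · by_contra h
      rw [if_neg h] at this
      rw [CMData.act, this] at ha
      simp at ha
  rcases ({p ∈ range (I.t * I.t) | (I.data D).act p = 1} : Finset ℕ).eq_empty_or_nonempty with
    h0 | ⟨p0, hp0⟩
  · rw [h0]; simp
  have : Nonempty (Fin I.t) := ⟨(key p0 hp0).choose⟩
  choose! i j hpe hij hH using key
  refine card_le_card_of_injOn (fun p => s(i p, j p)) (fun p hp => hH p hp) ?_
  intro p hp q hq h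
  rw [hpe p hp, hpe q hq]
  rcases Sym2.eq_iff.1 h with ⟨h1, h2⟩ | ⟨h1, h2⟩
  · rw [h1, h2]
  · have a1 := hij p hp
    have a2 := hij q hq
    rw [h1, h2] at a1
    have : i q = j q := le_antisymm a2 a1
    rw [h1, h2, this]

/-! ### Solutions as involutions -/

variable {I D}

/-- Summing over the nodes counts every matching edge twice. -/
theorem sum_nodes_eq {M : I.G.Subgraph} {σ : Equiv.Perm (Fin I.n)}
    (hM : ∀ u v, M.Adj u v ↔ σ u = v) (f : Sym2 (Fin I.n) → ℚ≥0) :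
    ∑ u, f s(u, σ u) = 2 * ∑ e ∈ M.edgeSet.toFinite.toFinset, f e := by
  classical
  have hadj : ∀ u, M.Adj u (σ u) := fun u => (hM _ _).2 rfl
  have hσ : ∀ u, σ (σ u) = u := fun u => (hM _ _).1 (hadj u).symm
  rw [← sum_fiberwise_of_maps_to (g := fun u => s(u, σ u)) (t := M.edgeSet.toFinite.toFinset)
    (fun u _ => by simpa using hadj u), mul_sum]
  refine sum_congr rfl fun e he => ?_
  induction e with | _ a b
  have hab : M.Adj a b := by simpa using he
  have hb : σ a = b := (hM _ _).1 hab
  have hset : ({u | s(u, σ u) = s(a, b)} : Finset (Fin I.n)) = {a, b} := by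
    ext u
    simp only [mem_filter, mem_univ, true_and, mem_insert, mem_singleton, Sym2.eq_iff]
    constructor
    · rintro (⟨h, _⟩ | ⟨h, _⟩) <;> simp [h]
    · rintro (rfl | rfl)
      · simp [hb]
      · right; rw [← hb, hσ]; simp
  rw [sum_congr rfl (g := fun _ => f s(a, b)) fun u hu => by rw [(mem_filter.1 hu).2], hset,
    sum_const, card_pair hab.ne]
  simp

theorem bound_eq (hD : I.IsCommonDenominator D) : (I.bound D : ℚ≥0) = D * I.ℓ := by
  obtain ⟨a, ha⟩ := hD.2.2
  rw [bound, ha, Nat.floor_natCast]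

theorem floor_weight (hD : I.IsCommonDenominator D) {u v : Fin I.n} (h : I.G.Adj u v) :
    ((⌊(D : ℚ≥0) * I.γ s(u, v)⌋₊ : ℕ) : ℚ≥0) = D * I.γ s(u, v) := by
  obtain ⟨a, ha⟩ := hD.2.1 s(u, v) h
  rw [ha, Nat.floor_natCast]

theorem adj_of_wt_ne_zero {u v : Fin I.n} (h : (I.data D).wt (u * I.n + v) ≠ 0) :
    I.G.Adj u v ∧ (I.data D).wt (u * I.n + v) - 1 = ⌊(D : ℚ≥0) * I.γ s(u, v)⌋₊ := by
  classical
  rw [data_wt] at h ⊢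
  split at h
  · rename_i h'
    rw [if_pos h']
    exact ⟨h'.1, by simp⟩
  · exact absurd rfl h

/-- The involutions found by the algorithm are solutions of the instance. -/
theorem exists_isSolution_of_isSol (hD : I.IsCommonDenominator D) {σ : Equiv.Perm (Fin I.n)}
    (hσ : (I.data D).IsSol σ) {s : WordRAM.State} (hs : ∀ u : Fin I.n, s.mem u = σ u) :
    ∃ M : I.G.Subgraph, I.IsSolution M ∧ I.Outputs s M := by
  obtain ⟨hinv, hwt, hsum, hhit⟩ := hσ
  have hσσ : ∀ u, σ (σ u) = u := fun u => by
    simpa using (Equiv.congr_fun hinv (σ u)).symm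
  have hadj : ∀ u, I.G.Adj u (σ u) := fun u => (adj_of_wt_ne_zero (hwt u)).1
  let M : I.G.Subgraph :=
    { verts := Set.univ
      Adj := fun u v => σ u = v
      adj_sub := by rintro u v rfl; exact hadj u
      edge_vert := fun _ => Set.mem_univ _
      symm := ⟨by rintro u v rfl; exact hσσ u⟩ }
  have hM : ∀ u v, M.Adj u v ↔ σ u = v := fun _ _ => Iff.rfl
  refine ⟨M, ⟨⟨fun u _ => ⟨σ u, rfl, fun v hv => (show σ u = v from hv).symm⟩,
    fun u => Set.mem_univ u⟩, ?_, ?_⟩, ?_⟩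
  · have h1 := sum_nodes_eq hM I.γ
    have h2 : ((∑ u : Fin I.n, ((I.data D).wt (u * I.n + σ u) - 1) : ℕ) : ℚ≥0) =
        D * ∑ u, I.γ s(u, σ u) := by
      rw [mul_sum, Nat.cast_sum]
      exact sum_congr rfl fun u _ => by
        rw [(adj_of_wt_ne_zero (hwt u)).2, floor_weight hD (hadj u)]
    have h3 : ((∑ u : Fin I.n, ((I.data D).wt (u * I.n + σ u) - 1) : ℕ) : ℚ≥0) ≤
        2 * (D * I.ℓ) := by
      rw [← bound_eq hD]; exact_mod_cast hsum
    rw [h2, h1, mul_left_comm] at h3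
    have hD0 : (0 : ℚ≥0) < D := by exact_mod_cast hD.1
    exact le_of_mul_le_mul_left (le_of_mul_le_mul_left h3 (by norm_num)) hD0
  · have main : ∀ i j : Fin I.t, i ≤ j → s(i, j) ∈ I.H →
        ∃ u, (I.part u = i ∧ I.part (σ u) = j) := by
      intro i j hij hH
      have hlt : (i : ℕ) * I.t + j < I.t * I.t := by
        calc (i : ℕ) * I.t + j < i * I.t + I.t := by omega
          _ = (i + 1) * I.t := by ring
          _ ≤ _ := Nat.mul_le_mul_right _ i.2
      have ht : 0 < I.t := i.pos
      have e1 : ((i : ℕ) * I.t + j) / I.t = i := by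
        rw [mul_comm, Nat.mul_add_div ht, Nat.div_eq_of_lt j.2, add_zero]
      have e2 : ((i : ℕ) * I.t + j) % I.t = j := by
        rw [Nat.mul_add_mod', Nat.mod_eq_of_lt j.2]
      have hact : (I.data D).act (i * I.t + j) = 1 := by
        rw [CMData.act, data_hm, if_pos hH, e1, e2, if_neg (by simpa using hij)]
      have huniq : ∀ a b : Fin I.t, (i : ℕ) * I.t + j = a * I.t + b → a = i ∧ b = j := by
        intro a b hab
        have f1 : ((a : ℕ) * I.t + b) / I.t = a := by
          rw [mul_comm, Nat.mul_add_div ht, Nat.div_eq_of_lt b.2, add_zero]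
        have f2 : ((a : ℕ) * I.t + b) % I.t = b := by
          rw [Nat.mul_add_mod', Nat.mod_eq_of_lt b.2]
        rw [hab] at e1 e2
        exact ⟨Fin.ext (f1.symm.trans e1), Fin.ext (f2.symm.trans e2)⟩
      obtain ⟨u, hu | hu⟩ := hhit _ hlt hact
      · rw [data_pf, data_pf] at hu
        exact ⟨u, huniq _ _ hu⟩
      · rw [data_pf, data_pf] at hu
        refine ⟨σ u, (huniq _ _ hu).1, ?_⟩
        rw [hσσ]; exact (huniq _ _ hu).2
    intro i j hH
    rcases le_total i j with hij | hij
    · obtain ⟨u, h1, h2⟩ := main i j hij hH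
      exact ⟨u, σ u, rfl, h1, h2⟩
    · obtain ⟨u, h1, h2⟩ := main j i hij (by rwa [Sym2.eq_swap])
      exact ⟨σ u, u, hσσ u, h2, h1⟩
  · intro u v
    rw [hM, hs u]
    exact ⟨fun h => by rw [h], fun h => Fin.ext h⟩

/-- Solutions of the instance give solutions for the algorithm. -/
theorem exists_isSol_of_isSolution (hD : I.IsCommonDenominator D) {M : I.G.Subgraph}
    (hM : I.IsSolution M) : ∃ σ, (I.data D).IsSol σ := by
  classical
  obtain ⟨⟨hmatch, hspan⟩, hwt, hhit⟩ := hM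
  choose f hf hf' using fun u => hmatch (hspan u)
  have hff : ∀ u, f (f u) = u := fun u => (hf' (f u) u (hf u).symm).symm
  let σ : Equiv.Perm (Fin I.n) := ⟨f, f, hff, hff⟩
  have hMσ : ∀ u v, M.Adj u v ↔ σ u = v := fun u v =>
    ⟨fun h => (hf' u v h).symm, by rintro rfl; exact hf u⟩
  have hadj : ∀ u, I.G.Adj u (σ u) := fun u => M.adj_sub (hf u)
  have hle : ∀ u, ⌊(D : ℚ≥0) * I.γ s(u, σ u)⌋₊ ≤ I.bound D := by
    intro u
    refine Nat.floor_mono (mul_le_mul_right ?_ _)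
    refine le_trans ?_ hwt
    exact single_le_sum (f := I.γ) (fun _ _ => by simp)
      (by rw [Set.Finite.mem_toFinset]; exact hf u)
  have hval : ∀ u : Fin I.n, (I.data D).wt (u * I.n + σ u) = ⌊(D : ℚ≥0) * I.γ s(u, σ u)⌋₊ + 1 :=
    fun u => by rw [data_wt, if_pos ⟨hadj u, hle u⟩]
  refine ⟨σ, Equiv.ext fun u => rfl, fun u => ?_, ?_, ?_⟩
  · have := hval u
    exact fun h => by rw [h] at this; omega
  · have h1 : ((∑ u : Fin I.n, ((I.data D).wt (u * I.n + σ u) - 1) : ℕ) : ℚ≥0) ≤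
        ((2 * I.bound D : ℕ) : ℚ≥0) := by
      have : ((∑ u : Fin I.n, ((I.data D).wt (u * I.n + σ u) - 1) : ℕ) : ℚ≥0) =
          D * ∑ u, I.γ s(u, σ u) := by
        rw [mul_sum, Nat.cast_sum]
        exact sum_congr rfl fun u _ => by
          rw [hval, Nat.add_sub_cancel, floor_weight hD (hadj u)]
      rw [this, sum_nodes_eq hMσ, Nat.cast_mul, bound_eq hD, mul_left_comm]
      exact mul_le_mul_right (mul_le_mul_right hwt _) _
    exact_mod_cast h1
  · intro p hp ha
    have hp' : p < I.t * I.t := hp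
    have ht : 0 < I.t := Nat.pos_of_ne_zero fun h => by simp [h] at hp'
    have h1 : p / I.t < I.t := Nat.div_lt_of_lt_mul hp'
    have hpe : p / I.t * I.t + p % I.t = p := by rw [mul_comm, Nat.div_add_mod]
    have hH : s((⟨p / I.t, h1⟩ : Fin I.t), ⟨p % I.t, Nat.mod_lt _ ht⟩) ∈ I.H := by
      by_contra h
      have := I.data_hm D ⟨p / I.t, h1⟩ ⟨p % I.t, Nat.mod_lt _ ht⟩
      simp only [hpe] at this
      rw [if_neg h] at this
      rw [CMData.act, this] at ha
      simp at ha
    obtain ⟨u, v, huv, hu, hv⟩ := hhit _ _ hH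
    refine ⟨u, Or.inl ?_⟩
    have hv' : I.part (σ u) = ⟨p % I.t, Nat.mod_lt _ ht⟩ := by rw [(hMσ u v).1 huv]; exact hv
    rw [data_pf, data_pf, hu, hv']
    exact hpe.symm

end CMInstance

/-! ### Counting solutions of given weight -/

namespace CMData

variable {n t : ℕ} (J : CMData n t) (K : ℕ) (β : ℕ → Bool)

/-- The random weight of an ordered pair, read off `K` coin flips. -/
def rnd (K : ℕ) (β : ℕ → Bool) (q : ℕ) : ℕ := bitsValue K fun b => β (q * K + b)

/-- The scale of the edge weights; it exceeds every sum of random weights that can occur. -/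
def scale (n K : ℕ) : ℕ := 2 * n * 2 ^ K

/-- Exponents from here on belong to pairs and involutions that are excluded. -/
def cutoff : ℕ := scale n K * (2 * J.L + 1)

/-- The exponent of a pair of nodes: the scaled weight of the edge plus its random weight. -/
def expo (a b : ℕ) : ℕ :=
  if J.wt (a * n + b) = 0 then J.cutoff K
  else scale n K * (J.wt (a * n + b) - 1) + (rnd K β (a * n + b) + rnd K β (b * n + a))

/-- A number that is nonzero if the partial matching `mate` gives `a` a partner other than `b`; the
value `n` stands for a free node. -/
def clash (n : ℕ) (mate : ℕ → ℕ) (a b : ℕ) : ℕ :=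
  (1 - if mate a = n then 1 else 0) * (1 - if mate a = b then 1 else 0)

/-- A number that is nonzero if the pair `a, b` contradicts the partial matching `mate` or hits a
pattern edge in the set `B`. -/
def kill (mate B : ℕ → ℕ) (a b : ℕ) : ℕ :=
  clash n mate a b + clash n mate b a + (B (J.pf a * t + J.pf b) + B (J.pf b * t + J.pf a))

open Classical in
/-- The solutions with exponent `d` that extend the partial matching `mate`. -/
noncomputable def solSet (mate : ℕ → ℕ) (d : ℕ) : Finset (Equiv.Perm (Fin n)) :=
  univ.filter fun σ => J.IsSol σ ∧ ∑ u : Fin n, J.expo K β u (σ u) = d ∧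
    ∀ u : Fin n, mate u = n ∨ mate u = σ u

variable {J K β}

theorem rnd_lt (K : ℕ) (β : ℕ → Bool) (q : ℕ) : rnd K β q < 2 ^ K := bitsValue_lt K _

theorem Valid.expo_symm (hJ : J.Valid) {a b : ℕ} (ha : a < n) (hb : b < n) :
    J.expo K β a b = J.expo K β b a := by
  simp only [expo, hJ.wt_symm a ha b hb, add_comm (rnd K β (a * n + b))]

theorem kill_symm {mate B : ℕ → ℕ} (a b : ℕ) : J.kill mate B a b = J.kill mate B b a := by
  simp only [kill]; ring

theorem sum_expo {σ : Equiv.Perm (Fin n)} (hσ : σ⁻¹ = σ)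
    (hwt : ∀ u : Fin n, J.wt (u * n + σ u) ≠ 0) :
    ∑ u : Fin n, J.expo K β u (σ u) = scale n K * ∑ u : Fin n, (J.wt (u * n + σ u) - 1) +
      2 * ∑ u : Fin n, rnd K β (u * n + σ u) := by
  have h1 : ∑ u : Fin n, rnd K β (σ u * n + u) = ∑ u : Fin n, rnd K β (u * n + σ u) := by
    rw [← Equiv.sum_comp σ]
    refine sum_congr rfl fun u _ => ?_
    have : σ (σ u) = u := by simpa using (Equiv.congr_fun hσ (σ u)).symm
    rw [this]
  simp only [expo, hwt, if_false, sum_add_distrib, h1]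
  rw [← mul_sum]
  ring

theorem IsSol.sum_expo_lt (hn : 0 < n) {σ : Equiv.Perm (Fin n)} (hσ : J.IsSol σ) :
    ∑ u : Fin n, J.expo K β u (σ u) < J.cutoff K := by
  rw [sum_expo hσ.1 hσ.2.1]
  have h1 : ∑ u : Fin n, rnd K β (u * n + σ u) < n * 2 ^ K := by
    have : Nonempty (Fin n) := ⟨⟨0, hn⟩⟩
    calc _ < ∑ _u : Fin n, 2 ^ K := sum_lt_sum_of_nonempty univ_nonempty fun u _ => rnd_lt _ _ _
      _ = n * 2 ^ K := by simp
  have h2 := Nat.mul_le_mul_left (scale n K) hσ.2.2.1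
  rw [cutoff, mul_add, mul_one]
  have h3 : scale n K = 2 * (n * 2 ^ K) := by rw [scale]; ring
  omega

theorem isSol_iff {σ : Equiv.Perm (Fin n)} {d : ℕ} (hd : d < J.cutoff K)
    (hσ : σ⁻¹ = σ) (hsum : ∑ u : Fin n, J.expo K β u (σ u) = d) :
    J.IsSol σ ↔ ∀ p < t * t, J.act p = 1 → J.Hits σ p := by
  refine ⟨fun h => h.2.2.2, fun h => ?_⟩
  have hwt : ∀ u : Fin n, J.wt (u * n + σ u) ≠ 0 := by
    intro u h0
    have h1 : J.expo K β u (σ u) ≤ ∑ u : Fin n, J.expo K β u (σ u) :=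
      single_le_sum (f := fun u : Fin n => J.expo K β u (σ u)) (fun _ _ => Nat.zero_le _)
        (mem_univ u)
    rw [expo, if_pos h0] at h1
    omega
  refine ⟨hσ, hwt, ?_, h⟩
  rw [sum_expo hσ hwt] at hsum
  have h1 : scale n K * ∑ u : Fin n, (J.wt (u * n + σ u) - 1) < scale n K * (2 * J.L + 1) := by
    rw [cutoff] at hd; omega
  exact Nat.lt_succ_iff.1 (Nat.lt_of_mul_lt_mul_left h1)

/-- Inclusion–exclusion over the sets of pattern edges, modulo two: the determinants computed by the
algorithm count the solutions that extend a partial matching. -/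
theorem Valid.sum_masks (hJ : J.Valid) (hn : 0 < n) (mate : ℕ → ℕ) {d : ℕ} (hd : d < J.cutoff K) :
    ((∑ m ∈ range (2 ^ rank J.act (t * t)), ∑ k ∈ range n,
      birdN (fun a b => J.expo K β a b + J.cutoff K * J.kill mate (mask J.act m) a b)
        n (n - 1) k k d : ℕ) : ZMod 2) = #(J.solSet K β mate d) := by
  classical
  have h1 : ∀ m, ((∑ k ∈ range n,
      birdN (fun a b => J.expo K β a b + J.cutoff K * J.kill mate (mask J.act m) a b)
        n (n - 1) k k d : ℕ) : ZMod 2) = ∑ σ ∈ involSet n (J.expo K β) d,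
          if ∀ u : Fin n, J.kill mate (mask J.act m) u (σ u) = 0 then 1 else 0 := by
    intro m
    rw [sum_birdN hn, involSet_add_mul _ _ hd, sum_boole]
    intro a ha b hb
    rw [hJ.expo_symm ha hb, kill_symm]
  rw [Nat.cast_sum, sum_congr rfl fun m _ => h1 m, sum_comm]
  have h2 : ∀ σ ∈ involSet n (J.expo K β) d, ∑ m ∈ range (2 ^ rank J.act (t * t)),
      (if ∀ u : Fin n, J.kill mate (mask J.act m) u (σ u) = 0 then (1 : ZMod 2) else 0) =
      if σ ∈ J.solSet K β mate d then 1 else 0 := by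
    intro σ hσ
    obtain ⟨hinv, hsum⟩ : σ⁻¹ = σ ∧ ∑ u : Fin n, J.expo K β u (σ u) = d := by
      simpa [involSet] using hσ
    have hσσ : ∀ u, σ (σ u) = u := fun u => by simpa using (Equiv.congr_fun hinv (σ u)).symm
    have hmate : (∀ u : Fin n, clash n mate u (σ u) = 0 ∧ clash n mate (σ u) u = 0) ↔
        ∀ u : Fin n, mate u = n ∨ mate u = σ u := by
      have : ∀ a b, clash n mate a b = 0 ↔ mate a = n ∨ mate a = b := fun a b => by
        by_cases h1 : mate a = n <;> by_cases h2 : mate a = b <;> simp [clash, h1, h2]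
      simp only [this]
      exact ⟨fun h u => (h u).1, fun h u => ⟨h u, by simpa [hσσ] using h (σ u)⟩⟩
    have hmask : ∀ m, (∀ u : Fin n, mask J.act m (J.pf u * t + J.pf (σ u)) = 0 ∧
        mask J.act m (J.pf (σ u) * t + J.pf u) = 0) ↔
          ∀ p < t * t, J.Hits σ p → mask J.act m p = 0 := by
      intro m
      constructor
      · rintro h p _ ⟨u, rfl | rfl⟩
        · exact (h u).1
        · exact (h u).2
      · intro h u
        have hlt : ∀ a b : Fin n, J.pf a * t + J.pf b < t * t := fun a b => by
          have h1 := hJ.pf_lt a a.2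
          have h2 := hJ.pf_lt b b.2
          calc J.pf a * t + J.pf b < J.pf a * t + t := by omega
            _ = (J.pf a + 1) * t := by ring
            _ ≤ _ := Nat.mul_le_mul_right _ h1
        exact ⟨h _ (hlt _ _) ⟨u, Or.inl rfl⟩, h _ (hlt _ _) ⟨u, Or.inr rfl⟩⟩
    have hkill : ∀ m, (∀ u : Fin n, J.kill mate (mask J.act m) u (σ u) = 0) ↔
        (∀ u : Fin n, mate u = n ∨ mate u = σ u) ∧
          ∀ p < t * t, J.Hits σ p → mask J.act m p = 0 := by
      intro m
      rw [← hmate, ← hmask, ← forall_and]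
      exact forall_congr' fun u => by simp only [kill, Nat.add_eq_zero_iff]
    have hmem : σ ∈ J.solSet K β mate d ↔ (∀ u : Fin n, mate u = n ∨ mate u = σ u) ∧
        ∀ p < t * t, J.act p = 1 → J.Hits σ p := by
      simp only [solSet, mem_filter, mem_univ, true_and, hsum, isSol_iff hd hinv hsum]
      exact and_comm
    simp only [hkill, hmem]
    by_cases hm : ∀ u : Fin n, mate u = n ∨ mate u = σ u
    · simp only [hm, implies_true, true_and]
      exact sum_mask_avoids hJ.act_le_one (J.Hits σ) (t * t)
    · simp [hm]
  rw [sum_congr rfl h2, sum_boole]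
  congr 2
  ext σ
  simp only [mem_filter, and_iff_right_iff_imp]
  intro hσ
  simp only [solSet, mem_filter, mem_univ, true_and] at hσ
  simpa [involSet] using ⟨hσ.1.1, hσ.2.1⟩

/-- If a node is free, then every solution gives it exactly one partner. -/
theorem card_solSet_eq_sum (mate : ℕ → ℕ) (d : ℕ) {u : ℕ} (hu : u < n) (hfree : mate u = n) :
    #(J.solSet K β mate d) = ∑ v ∈ range n, #(J.solSet K β (Function.update mate u v) d) := by
  classical
  rw [card_eq_sum_card_fiberwise (f := fun σ => ((σ ⟨u, hu⟩ : Fin n) : ℕ)) (t := range n)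
    (fun σ _ => by simp)]
  refine sum_congr rfl fun v hv => ?_
  have hv := mem_range.1 hv
  congr 1
  ext σ
  simp only [solSet, mem_filter, mem_univ, true_and, and_assoc]
  refine and_congr_right fun _ => and_congr_right fun _ => ?_
  constructor
  · rintro ⟨h, hσ⟩ a
    by_cases ha : (a : ℕ) = u
    · right
      have : a = ⟨u, hu⟩ := Fin.ext ha
      rw [ha, Function.update_self, this, hσ]
    · rw [Function.update_of_ne ha]; exact h a
  · intro h
    refine ⟨fun a => ?_, ?_⟩
    · by_cases ha : (a : ℕ) = u
      · left; rw [ha, hfree]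
      · have := h a
        rwa [Function.update_of_ne ha] at this
    · have := h ⟨u, hu⟩
      simp only [Function.update_self] at this
      omega

open Classical in
/-- By the isolation lemma the number of solutions of some exponent is odd with high
probability. -/
theorem coinMeasure_even_le (hn : 0 < n) (hsol : ∃ σ, J.IsSol σ) :
    WordRAM.coinMeasure {β | ∀ d < J.cutoff K, Even #(J.solSet K β (fun _ => n) d)} ≤
      ((n * n : ℕ) : ENNReal) * ((2 : ENNReal) ^ K)⁻¹ := by
  let r : (Fin K → Bool) → ℕ := fun y => bitsValue K fun b => if h : b < K then y ⟨b, h⟩ else false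
  have hr : Function.Injective r := by
    intro y y' h
    funext b
    simpa using bitsValue_inj h b b.2
  let 𝒮 : Finset (Equiv.Perm (Fin n)) := univ.filter J.IsSol
  let e : Equiv.Perm (Fin n) → Finset (Fin (n * n)) := fun σ =>
    univ.image fun u => finProdFinEquiv (u, σ u)
  have hinj : ∀ σ : Equiv.Perm (Fin n), Function.Injective fun u => finProdFinEquiv (u, σ u) :=
    fun σ u v h => (Prod.ext_iff.1 (finProdFinEquiv.injective h)).1
  have he : Set.InjOn e 𝒮 := by
    intro σ _ τ _ h
    ext1 u
    have : finProdFinEquiv (u, σ u) ∈ e τ := h ▸ mem_image_of_mem _ (mem_univ u)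
    obtain ⟨v, _, hv⟩ := mem_image.1 this
    have := Prod.ext_iff.1 (finProdFinEquiv.injective hv)
    simp only at this
    rw [← this.2, this.1]
  let g : Equiv.Perm (Fin n) → ℕ := fun σ =>
    scale n K * ∑ u : Fin n, (J.wt (u * n + σ u) - 1)
  let B : Finset (Fin (n * n) → Fin K → Bool) := univ.filter fun x => ¬ ∃ σ ∈ 𝒮, ∀ τ ∈ 𝒮,
      g τ + 2 * ∑ q ∈ e τ, r (x q) = g σ + 2 * ∑ q ∈ e σ, r (x q) → τ = σ
  have hB := isolation r hr 𝒮 (by obtain ⟨σ, h⟩ := hsol; exact ⟨σ, by simpa [𝒮] using h⟩) e he g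
    two_pos B (fun x hx => (mem_filter.1 hx).2)
  simp only [Fintype.card_pi, Fintype.card_bool, prod_const, card_univ, Fintype.card_fin] at hB
  refine (MeasureTheory.measure_mono ?_).trans (coinMeasure_le B hB)
  intro β hβ
  simp only [Set.mem_ofPred_eq] at hβ ⊢
  simp only [B, mem_filter, mem_univ, true_and]
  rintro ⟨σ, hσ, huniq⟩
  have hw : ∀ τ, J.IsSol τ → g τ + 2 * ∑ q ∈ e τ, r (fun b : Fin K => β (q * K + b)) =
      ∑ u : Fin n, J.expo K β u (τ u) := by
    intro τ hτ
    rw [sum_expo hτ.1 hτ.2.1, sum_image fun u _ v _ h => hinj τ h]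
    congr 2
    refine sum_congr rfl fun u _ => ?_
    simp only [r, rnd, bitsValue]
    refine sum_congr rfl fun b hb => ?_
    rw [dif_pos (mem_range.1 hb)]
    simp [mul_comm n, add_comm]
  have hσ' : J.IsSol σ := by simpa [𝒮] using hσ
  have hone : J.solSet K β (fun _ => n) (∑ u : Fin n, J.expo K β u (σ u)) = {σ} := by
    ext τ
    simp only [solSet, mem_filter, mem_univ, true_and, true_or, implies_true, and_true,
      mem_singleton]
    constructor
    · rintro ⟨hτ, h⟩
      exact huniq τ (by simpa [𝒮] using hτ) (by rw [hw τ hτ, hw σ hσ', h])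
    · rintro rfl; exact ⟨hσ', rfl⟩
  have := hβ _ (hσ'.sum_expo_lt (β := β) hn)
  rw [hone] at this
  simp at this

end CMData

/-! ### Programs with bounded contents -/

namespace WordRAM

namespace Exp

section eval

variable (m v : ℕ → ℕ) (a b : Exp)

@[simp] theorem eval_add : (a + b).eval m v = a.eval m v + b.eval m v := rfl
@[simp] theorem eval_sub : (a - b).eval m v = a.eval m v - b.eval m v := rfl
@[simp] theorem eval_mul : (a * b).eval m v = a.eval m v * b.eval m v := rfl
@[simp] theorem eval_div : (a / b).eval m v = a.eval m v / b.eval m v := rfl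
@[simp] theorem eval_mod : (a % b).eval m v = a.eval m v % b.eval m v := rfl
@[simp] theorem eval_lt : (lt a b).eval m v = if a.eval m v < b.eval m v then 1 else 0 := rfl
@[simp] theorem eval_eq : (eq a b).eval m v = if a.eval m v = b.eval m v then 1 else 0 := rfl
@[simp] theorem eval_shr : (op .shr a b).eval m v = a.eval m v >>> b.eval m v := rfl
@[simp] theorem eval_const (c : ℕ) : (const c).eval m v = c := rfl
@[simp] theorem eval_ofNat (c : ℕ) : (no_index (OfNat.ofNat c) : Exp).eval m v = OfNat.ofNat c :=
  rfl
@[simp] theorem eval_var (x : ℕ) : (var x).eval m v = v x := rfl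
@[simp] theorem eval_load : (load a).eval m v = m (a.eval m v) := rfl
@[simp] theorem eval_bsum (x y : ℕ) : (bsum x y a).eval m v =
    ∑ i ∈ range (v y), a.eval m (Function.update v x i) := rfl

end eval

/-- A decidable form of `Exp.Fits`. -/
def ok : Exp → Bool
  | .const c => c ≤ 16
  | .var _ => true
  | .op o a b => a.ok && b.ok && match o with
      | .and | .xor | .shl => false
      | _ => true
  | .load a => a.ok
  | .bsum _ _ e => e.ok

theorem fits_of_ok {Z : ℕ} (hZ : 16 ≤ Z) : ∀ {e : Exp}, e.ok = true → e.Fits Z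
  | .const c, h => by simp only [ok, decide_eq_true_eq] at h; exact h.trans hZ
  | .var _, _ => trivial
  | .op o a b, h => by
      simp only [ok, Bool.and_eq_true] at h
      refine ⟨fits_of_ok hZ h.1.1, fits_of_ok hZ h.1.2, ?_⟩
      cases o <;> simp at h ⊢
  | .load a, h => fits_of_ok (e := a) hZ h
  | .bsum _ _ e, h => fits_of_ok (e := e) hZ h

/-- The expressions of the algorithm: their values and costs are at most `Z ^ 240` if `16 ≤ Z` bounds
the contents of the machine. The number `240` only has to exceed the degrees of all expressions that
occur. -/
def Small (e : Exp) : Prop := e.ok = true ∧ e.deg ≤ 240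

instance (e : Exp) : Decidable e.Small := inferInstanceAs (Decidable (_ ∧ _))

end Exp

/-- All registers and memory cells are at most `Z`, and the scratch registers are zero. -/
structure Bdd (Z : ℕ) (s : State) : Prop where
  reg_le : ∀ r, s.reg r ≤ Z
  mem_le : ∀ a, s.mem a ≤ Z
  high : ∀ r, 40 ≤ r → s.reg r = 0

/-- `m` is the memory `m₀` with the first `b` entries of the `i`-th table replaced by those of `g`.
The sixteen tables are interleaved behind the first `M` cells. -/
structure Upd (M i b : ℕ) (g m₀ m : ℕ → ℕ) : Prop where
  new : ∀ x < b, m (M + 16 * x + i) = g x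
  old : ∀ x, b ≤ x → m (M + 16 * x + i) = m₀ (M + 16 * x + i)
  other : ∀ x j, j < 16 → j ≠ i → m (M + 16 * x + j) = m₀ (M + 16 * x + j)
  low : ∀ c < M, m c = m₀ c

/-- The address of entry `x` of table `i`; register 9 holds the end of the input. The tables are:
0 the coins, 1 the powers of two, 2 the exponents of the pairs of nodes, 3 the same with the killed
pairs raised, 4 the values of `birdN`, 5 the parities, 6 the current set of pattern edges, 7 the next
set, 8 the partial matching. -/
def tabA (i : ℕ) (x : Exp) : Exp := .var 9 + 16 * x + .const i

/-- Entry `x` of table `i`. -/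
def tab (i : ℕ) (x : Exp) : Exp := .load (tabA i x)

@[simp] theorem eval_tab (m v : ℕ → ℕ) (i : ℕ) (x : Exp) :
    (tab i x).eval m v = m (v 9 + 16 * x.eval m v + i) := rfl

@[simp] theorem eval_tabA (m v : ℕ → ℕ) (i : ℕ) (x : Exp) :
    (tabA i x).eval m v = v 9 + 16 * x.eval m v + i := rfl

/-- Fill table `i` up to the value of register `y`. -/
def fillT (i y : ℕ) (e : Exp) : Prog := fillP 40 y (tabA i (.var 40)) e

section

variable {w Z : ℕ} (hZ : 16 ≤ Z) (hw : Z ^ 240 < 2 ^ w) {s : State}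

include hZ hw in
theorem one_lt_two_pow_of : 1 < 2 ^ w := by
  have : Z ≤ Z ^ 240 := Nat.le_self_pow (by norm_num) Z
  omega

include hw in
theorem lt_two_pow_of {v : ℕ} (hv : v ≤ Z) : v < 2 ^ w :=
  (hv.trans (Nat.le_self_pow (by norm_num) Z)).trans_lt hw

include hZ in
theorem pow_add_le (d : ℕ) {x : ℕ} (hx : x ≤ 2 * Z ^ d + 5) : x ≤ Z ^ (d + 1) := by
  have : 1 ≤ Z ^ d := Nat.one_le_pow _ _ (by omega)
  rw [pow_succ]; nlinarith

include hZ hw in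
theorem small_spec {e : Exp} (he : e.Small) {m v : ℕ → ℕ} (hm : ∀ a, m a ≤ Z)
    (hv : ∀ x, v x ≤ Z) : e.Safe w m v ∧ e.time v ≤ Z ^ 240 := by
  have h1 : Z ^ e.deg ≤ Z ^ 240 := Nat.pow_le_pow_right (by omega) he.2
  exact ⟨e.safe_of_fits hZ hm (Exp.fits_of_ok hZ he.1) (h1.trans_lt hw) v hv,
    (e.time_le_pow hZ v hv).trans h1⟩

include hZ hw in
theorem tri_assign (hs : Bdd Z s) {x : ℕ} (hx : x < 40) {e : Exp} (he : e.Small) {v : ℕ}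
    (hv : e.eval s.mem (s.reg ∘ regMap 40) = v) (hvZ : v ≤ Z) :
    Tri w (assignP 40 x e) (Z ^ 243) s (fun s' => s' = s.setReg x v ∧ Bdd Z s') := by
  obtain ⟨h1, h2⟩ := small_spec hZ hw he (m := s.mem) (v := s.reg ∘ regMap 40) hs.mem_le
    fun x => hs.reg_le _
  refine (Tri.of_runs (assignP_runs (one_lt_two_pow_of hZ hw) hx hs.high h1
    (by rw [hv]; exact lt_two_pow_of hw hvZ)) ?_).mono ?_ fun _ h => h
  · rw [hv]
    refine ⟨rfl, fun r => ?_, hs.mem_le, fun r hr => ?_⟩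
    · rw [State.setReg_reg, Function.update_apply]; split
      · exact hvZ
      · exact hs.reg_le r
    · rw [State.setReg_reg, Function.update_of_ne (by omega)]; exact hs.high r hr
  · exact (pow_add_le hZ 240 (by omega)).trans (Nat.pow_le_pow_right (by omega) (by norm_num))

include hZ hw in
theorem tri_store (hs : Bdd Z s) {a e : Exp} (ha : a.Small) (he : e.Small) {A v : ℕ}
    (hA : a.eval s.mem (s.reg ∘ regMap 40) = A)
    (hv : e.eval s.mem (s.reg ∘ regMap 40) = v) (hvZ : v ≤ Z) :
    Tri w (storeP 40 40 a e) (Z ^ 243) s (fun s' => s' = s.setMem A v ∧ Bdd Z s') := by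
  obtain ⟨h1, h2⟩ := small_spec hZ hw he (m := s.mem) (v := s.reg ∘ regMap 40) hs.mem_le
    fun x => hs.reg_le _
  obtain ⟨h1', h2'⟩ := small_spec hZ hw ha (m := s.mem) (v := s.reg ∘ regMap 40) hs.mem_le
    fun x => hs.reg_le _
  refine (Tri.of_runs (storeP_runs (one_lt_two_pow_of hZ hw) (by norm_num) le_rfl hs.high h1' h1)
    ?_).mono ?_ fun _ h => h
  · rw [hv, hA]
    refine ⟨rfl, hs.reg_le, fun c => ?_, hs.high⟩
    simp only [State.setMem, Function.update_apply]; split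
    · exact hvZ
    · exact hs.mem_le c
  · exact (pow_add_le hZ 240 (by omega)).trans (Nat.pow_le_pow_right (by omega) (by norm_num))

include hZ hw in
/-- A loop that fills the cells `A x` with the values `g x`, which may depend on the cells filled
before. -/
theorem tri_fill (hs : Bdd Z s) {y : ℕ} (hy : y < 40) {a e : Exp} (ha : a.Small) (he : e.Small)
    {A g : ℕ → ℕ} (hA : ∀ i < s.reg y, ∀ j < i, A j ≠ A i) (hg : ∀ x < s.reg y, g x ≤ Z)
    (h : ∀ i < s.reg y, ∀ m : ℕ → ℕ, (∀ x < i, m (A x) = g x) →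
      (∀ c, (∀ x < i, c ≠ A x) → m c = s.mem c) →
      a.eval m (Function.update s.reg 40 i ∘ regMap 41) = A i ∧
      e.eval m (Function.update s.reg 40 i ∘ regMap 41) = g i) :
    Tri w (fillP 40 y a e) (Z ^ 243) s (fun s' => ∃ m, s' = { s with mem := m } ∧
      (∀ x < s.reg y, m (A x) = g x) ∧ (∀ c, (∀ x < s.reg y, c ≠ A x) → m c = s.mem c) ∧
      Bdd Z s') := by
  have hmem : ∀ i ≤ s.reg y, ∀ m : ℕ → ℕ, (∀ x < i, m (A x) = g x) →
      (∀ c, (∀ x < i, c ≠ A x) → m c = s.mem c) → ∀ c, m c ≤ Z := by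
    intro i hi m h1 h2 c
    by_cases hc : ∃ x < i, c = A x
    · obtain ⟨x, hx, rfl⟩ := hc
      rw [h1 x hx]; exact hg x (by omega)
    · rw [h2 c fun x hx hcx => hc ⟨x, hx, hcx⟩]; exact hs.mem_le c
  refine (Tri.fillP (one_lt_two_pow_of hZ hw) hy (t := 2 * Z ^ 240) (g := g) hA
    (lt_two_pow_of hw (hs.reg_le y)) hs.high ?_).mono ?_ ?_
  · intro i hi m h1 h2
    have hv : ∀ x, (Function.update s.reg 40 i ∘ regMap 41) x ≤ Z := by
      intro x
      simp only [Function.comp, Function.update_apply]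
      split
      · exact hi.le.trans (hs.reg_le y)
      · exact hs.reg_le _
    obtain ⟨s1, t1⟩ := small_spec hZ hw ha (hmem i hi.le m h1 h2) hv
    obtain ⟨s2, t2⟩ := small_spec hZ hw he (hmem i hi.le m h1 h2) hv
    exact ⟨s1, s2, (Nat.add_le_add t1 t2).trans (by omega), (h i hi m h1 h2).1, (h i hi m h1 h2).2⟩
  · have h1 := hs.reg_le y
    have h2 : 1 ≤ Z ^ 240 := Nat.one_le_pow _ _ (by omega)
    have h3 : 2 * Z ^ 240 + 8 ≤ Z ^ 241 := by rw [pow_succ]; nlinarith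
    have h4 : s.reg y * (2 * Z ^ 240 + 8) ≤ Z * Z ^ 241 := Nat.mul_le_mul h1 h3
    refine (pow_add_le hZ 242 ?_)
    have : Z ^ 242 = Z * Z ^ 241 := by rw [pow_succ, mul_comm]
    omega
  · rintro s' ⟨m, rfl, h1, h2⟩
    exact ⟨m, rfl, h1, h2, hs.reg_le, hmem _ le_rfl m h1 h2, hs.high⟩

theorem upd_of {M i b : ℕ} (hi : i < 16) {g m₀ m : ℕ → ℕ} (h1 : ∀ x < b, m (M + 16 * x + i) = g x)
    (h2 : ∀ c, (∀ x < b, c ≠ M + 16 * x + i) → m c = m₀ c) : Upd M i b g m₀ m where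
  new := h1
  old x hx := h2 _ fun y hy => by omega
  other x j hj hji := h2 _ fun y hy => by omega
  low c hc := h2 _ fun y hy => by omega

include hZ hw in
theorem tri_table (hs : Bdd Z s) {M : ℕ} (hM : s.reg 9 = M) (i : ℕ) {y : ℕ} (hi : i < 16)
    (hy : y < 40) {e : Exp} (he : e.Small) (g : ℕ → ℕ) (hg : ∀ x < s.reg y, g x ≤ Z)
    (h : ∀ x < s.reg y, ∀ m : ℕ → ℕ, Upd M i x g s.mem m →
      e.eval m (Function.update s.reg 40 x ∘ regMap 41) = g x) :
    Tri w (fillT i y e) (Z ^ 243) s (fun s' => s'.reg = s.reg ∧ s'.coins = s.coins ∧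
      Upd M i (s.reg y) g s.mem s'.mem ∧ Bdd Z s') := by
  have hsm : (tabA i (.var 40)).Small := by
    interval_cases i <;> decide
  refine (tri_fill hZ hw hs hy hsm he (A := fun x => M + 16 * x + i) (g := g)
    (fun x _ z _ => by omega) hg fun x hx m h1 h2 =>
      ⟨by simp [regMap, hM], h x hx m (upd_of hi h1 h2)⟩).mono le_rfl ?_
  rintro s' ⟨m, rfl, h1, h2, h3⟩
  exact ⟨rfl, rfl, upd_of hi h1 h2, h3⟩

end

end WordRAM

/-! ### Computing the parities of the numbers of solutions -/

namespace WordRAM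

namespace Code

/-- The indicator of the marked positions of the pattern matrix. -/
def act (x : Exp) : Exp := .load (.var 19 + x) * (1 - .lt (x % .var 2) (x / .var 2))

/-- The part of a node. -/
def pf (x : Exp) : Exp := .load (4 + x)

/-- See `CMData.clash`. -/
def clash (a b : Exp) : Exp := (1 - .eq (tab 8 a) (.var 1)) * (1 - .eq (tab 8 a) b)

/-- See `CMData.kill`. -/
def kill (a b : Exp) : Exp := clash a b + clash b a +
  (tab 6 (pf a * .var 2 + pf b) + tab 6 (pf b * .var 2 + pf a))

/-- The exponents of the matrix belonging to the current set of pattern edges. -/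
def ent : Exp := tab 2 (.var 40) + .var 8 * kill (.var 40 / .var 1) (.var 40 % .var 1)

/-- The recursion of `birdN`; round, row, column and exponent are packed into one index. -/
def bird : Exp :=
  let p : Exp := .var 40 / .var 8 / .var 1 / .var 1
  let i : Exp := .var 40 / .var 8 / .var 1 % .var 1
  let j : Exp := .var 40 / .var 8 % .var 1
  let d : Exp := .var 40 % .var 8
  let E : Exp → Exp → Exp := fun a b => tab 3 (a * .var 1 + b)
  let X : Exp → Exp → Exp → Exp := fun i j d =>
    tab 4 ((((p - 1) * .var 1 + i) * .var 1 + j) * .var 8 + d)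
  .eq p 0 * .eq d (E i j) + .lt 0 p * (.bsum 50 1 (.lt i (.var 50) *
    (.lt (E (.var 50) j) (d + 1) * X i (.var 50) (d - E (.var 50) j) +
      .lt (E i j) (d + 1) * X (.var 50) (.var 50) (d - E i j))) % 2)

/-- Add the coefficients of the current determinant to table 5. -/
def addDet : Exp := (tab 5 (.var 40) + .bsum 50 1 (tab 4
  ((((.var 1 - 1) * .var 1 + .var 50) * .var 1 + .var 50) * .var 8 + .var 40))) % 2

/-- The number of marked positions missing in the current set. -/
def missing (y : ℕ) : Exp := .bsum 50 y (act (.var 50) * (1 - tab 6 (.var 50)))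

/-- The next set, in the order of binary counting. -/
def next : Exp := act (.var 40) * ((tab 6 (.var 40) + .eq (missing 40) 0) % 2)

/-- One round of `parity`. -/
def parityStep : Prog :=
  .seq (fillT 3 4 ent) (.seq (fillT 4 10 bird) (.seq (fillT 5 8 addDet)
    (.seq (assignP 40 13 (.lt 0 (missing 11))) (.seq (fillT 7 11 next)
      (fillT 6 11 (tab 7 (.var 40)))))))

/-- Compute in table 5, for all exponents, the parity of the number of solutions that extend the
partial matching in table 8; all sets of pattern edges are run through in table 6. -/
def parity : Prog :=
  .seq (fillT 5 8 0) (.seq (fillT 6 11 0) (.seq (assignP 40 13 1) (.loop 13 parityStep)))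

end Code

theorem Code.small : Code.ent.Small ∧ Code.bird.Small ∧ Code.addDet.Small ∧ Code.next.Small ∧
    (Exp.lt 0 (Code.missing 11)).Small ∧ (tab 7 (.var 40)).Small := by
  decide

/-- Decoding of the packed indices of `Code.bird`. -/
theorem decode {n N p i j d : ℕ} (hi : i < n) (hj : j < n) (hd : d < N) :
    (((p * n + i) * n + j) * N + d) % N = d ∧ (((p * n + i) * n + j) * N + d) / N % n = j ∧
    (((p * n + i) * n + j) * N + d) / N / n % n = i ∧
    (((p * n + i) * n + j) * N + d) / N / n / n = p := by
  have h : ∀ {a b m : ℕ}, b < m → (a * m + b) / m = a ∧ (a * m + b) % m = b := fun {a b m} hb =>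
    (Nat.div_mod_unique (by omega)).2 ⟨by ring, hb⟩
  simp only [h hd, h hi, h hj, true_and]

/-- The end of the input, where the tables begin. -/
def tableBase (n t : ℕ) : ℕ := 4 + n + n * n + t * t

/-- The state holds the data `J` together with the exponents obtained from the coin flips `β`. -/
structure Ctx {n t : ℕ} (Z : ℕ) (J : CMData n t) (K : ℕ) (β : ℕ → Bool) (s : State) : Prop
    extends Bdd Z s where
  reg1 : s.reg 1 = n
  reg2 : s.reg 2 = t
  reg4 : s.reg 4 = n * n
  reg8 : s.reg 8 = J.cutoff K
  reg9 : s.reg 9 = tableBase n t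
  reg10 : s.reg 10 = n * n * n * J.cutoff K
  reg11 : s.reg 11 = t * t
  reg19 : s.reg 19 = 4 + n + n * n
  part : ∀ v < n, s.mem (4 + v) = J.pf v
  pattern : ∀ p < t * t, s.mem (4 + n + n * n + p) = J.hm p
  expo : ∀ x < n * n, s.mem (tableBase n t + 16 * x + 2) = J.expo K β (x / n) (x % n)

theorem Ctx.congr {n t Z K : ℕ} {J : CMData n t} {β : ℕ → Bool} {s s' : State}
    (h : Ctx Z J K β s) (hs : Bdd Z s')
    (hr : ∀ r ∈ [1, 2, 4, 8, 9, 10, 11, 19], s'.reg r = s.reg r)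
    (hlow : ∀ c < tableBase n t, s'.mem c = s.mem c)
    (htab : ∀ x, s'.mem (tableBase n t + 16 * x + 2) = s.mem (tableBase n t + 16 * x + 2)) :
    Ctx Z J K β s' := by
  simp only [List.mem_cons, List.not_mem_nil, or_false, forall_eq_or_imp, forall_eq] at hr
  obtain ⟨r1, r2, r4, r8, r9, r10, r11, r19⟩ := hr
  refine ⟨hs, r1.trans h.reg1, r2.trans h.reg2, r4.trans h.reg4, r8.trans h.reg8, r9.trans h.reg9,
    r10.trans h.reg10, r11.trans h.reg11, r19.trans h.reg19, fun v hv => ?_, fun p hp => ?_,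
    fun x hx => ?_⟩
  · rw [hlow _ (by rw [tableBase]; omega)]; exact h.part v hv
  · rw [hlow _ (by rw [tableBase]; omega)]; exact h.pattern p hp
  · rw [htab]; exact h.expo x hx

theorem Ctx.upd {n t Z K i b : ℕ} {J : CMData n t} {β : ℕ → Bool} {s s' : State} {g : ℕ → ℕ}
    (h : Ctx Z J K β s) (hs : Bdd Z s') (hr : s'.reg = s.reg)
    (hu : Upd (tableBase n t) i b g s.mem s'.mem) (hi : i ≠ 2) : Ctx Z J K β s' :=
  h.congr hs (fun r _ => by rw [hr]) hu.low fun x => hu.other x 2 (by norm_num) hi.symm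

section

variable {w Z n t K : ℕ} {J : CMData n t} {β : ℕ → Bool} {s : State}

local notation "M" => tableBase n t

theorem Ctx.eval_act (hc : Ctx Z J K β s) {m v : ℕ → ℕ} (hm : ∀ c < M, m c = s.mem c)
    (h2 : v 2 = t) (h19 : v 19 = 4 + n + n * n) {x : Exp} (hx : x.eval m v < t * t) :
    (Code.act x).eval m v = J.act (x.eval m v) := by
  have : m (4 + n + n * n + x.eval m v) = J.hm (x.eval m v) := by
    rw [hm _ (by rw [tableBase]; omega)]; exact hc.pattern _ hx
  simp [Code.act, CMData.act, h2, h19, this]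

theorem Ctx.eval_kill (hc : Ctx Z J K β s) (hJ : J.Valid) {mate B : ℕ → ℕ} {m v : ℕ → ℕ}
    (hm : ∀ c < M, m c = s.mem c) (hmate : ∀ u < n, m (M + 16 * u + 8) = mate u)
    (hB : ∀ p < t * t, m (M + 16 * p + 6) = B p)
    (h1 : v 1 = n) (h2 : v 2 = t) (h9 : v 9 = M) {a b : Exp} (ha : a.eval m v < n)
    (hb : b.eval m v < n) :
    (Code.kill a b).eval m v = J.kill mate B (a.eval m v) (b.eval m v) := by
  generalize ea : a.eval m v = a' at *
  generalize eb : b.eval m v = b' at *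
  have hpf : ∀ u < n, m (4 + u) = J.pf u := fun u hu => by
    rw [hm _ (by rw [tableBase]; omega)]; exact hc.part _ hu
  have hlt : ∀ x < n, ∀ y < n, J.pf x * t + J.pf y < t * t := fun x hx y hy => by
    have h1 := hJ.pf_lt x hx
    have h2 := hJ.pf_lt y hy
    nlinarith
  simp [Code.kill, Code.clash, Code.pf, CMData.kill, CMData.clash, h1, h2, h9, ea, eb, hmate _ ha,
    hmate _ hb, hpf _ ha, hpf _ hb, hB _ (hlt _ ha _ hb), hB _ (hlt _ hb _ ha)]

theorem eval_regs {x r : ℕ} (hr : r < 40) :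
    (Function.update s.reg 40 x ∘ regMap 41) r = s.reg r := by
  have : regMap 41 r = r := if_pos (by omega)
  rw [Function.comp, this, Function.update_of_ne (by omega)]

theorem div_mod_lt {x : ℕ} (hx : x < n * n) : x / n < n ∧ x % n < n := by
  rcases Nat.eq_zero_or_pos n with rfl | hn
  · omega
  · exact ⟨Nat.div_lt_of_lt_mul hx, Nat.mod_lt _ hn⟩

theorem kill_le {mate B : ℕ → ℕ} (hB : ∀ p, B p ≤ 1) (a b : ℕ) : J.kill mate B a b ≤ 4 := by
  have h : ∀ a b, CMData.clash n mate a b ≤ 1 := fun a b => by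
    rw [CMData.clash]; split <;> split <;> simp
  have := h a b
  have := h b a
  have := hB (J.pf a * t + J.pf b)
  have := hB (J.pf b * t + J.pf a)
  rw [CMData.kill]; omega

variable (hZ : 16 ≤ Z) (hw : Z ^ 240 < 2 ^ w)

include hZ hw in
theorem tri_ent (hc : Ctx Z J K β s) (hJ : J.Valid) {mate B : ℕ → ℕ}
    (hmate : ∀ u < n, s.mem (M + 16 * u + 8) = mate u)
    (hB : ∀ p < t * t, s.mem (M + 16 * p + 6) = B p) (hB1 : ∀ p, B p ≤ 1)
    (hZN : ∀ x < n * n, J.expo K β (x / n) (x % n) + 4 * J.cutoff K ≤ Z) :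
    Tri w (fillT 3 4 Code.ent) (Z ^ 243) s (fun s' => s'.reg = s.reg ∧ s'.coins = s.coins ∧
      Upd M 3 (n * n) (fun x => J.expo K β (x / n) (x % n) +
        J.cutoff K * J.kill mate B (x / n) (x % n)) s.mem s'.mem ∧ Bdd Z s') := by
  rw [← hc.reg4]
  refine tri_table hZ hw hc.toBdd hc.reg9 3 (by norm_num) (by norm_num) Code.small.1 _ ?_ ?_
  · intro x hx
    rw [hc.reg4] at hx
    have := hZN x hx
    have := Nat.mul_le_mul_left (J.cutoff K) (kill_le (J := J) (mate := mate) hB1 (x / n) (x % n))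
    omega
  · intro x hx m hm
    rw [hc.reg4] at hx
    obtain ⟨h1, h2⟩ := div_mod_lt hx
    have e1 := (eval_regs (s := s) (x := x) (r := 1) (by norm_num)).trans hc.reg1
    have e2 := (eval_regs (s := s) (x := x) (r := 2) (by norm_num)).trans hc.reg2
    have e8 := (eval_regs (s := s) (x := x) (r := 8) (by norm_num)).trans hc.reg8
    have e9 := (eval_regs (s := s) (x := x) (r := 9) (by norm_num)).trans hc.reg9
    have e40 : (Function.update s.reg 40 x ∘ regMap 41) 40 = x := by simp [regMap]
    have hk := hc.eval_kill hJ (mate := mate) (B := B) hm.low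
      (fun u hu => (hm.other u 8 (by norm_num) (by norm_num)).trans (hmate u hu))
      (fun p hp => (hm.other p 6 (by norm_num) (by norm_num)).trans (hB p hp))
      e1 e2 e9 (a := .var 40 / .var 1) (b := .var 40 % .var 1)
      (by simpa only [Exp.eval_div, Exp.eval_var, e1, e40] using h1)
      (by simpa only [Exp.eval_mod, Exp.eval_var, e1, e40] using h2)
    rw [Code.ent, Exp.eval_add, Exp.eval_mul, hk, eval_tab]
    simp only [Exp.eval_div, Exp.eval_mod, Exp.eval_var, e1, e8, e9, e40]
    rw [hm.other x 2 (by norm_num) (by norm_num), hc.expo x hx]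

theorem update_fifty (v : ℕ → ℕ) (x : ℕ) : Function.update v 50 x 1 = v 1 ∧
    Function.update v 50 x 8 = v 8 ∧ Function.update v 50 x 9 = v 9 ∧
    Function.update v 50 x 40 = v 40 := by
  simp

theorem bird_index_lt {N p i j d i' j' d' : ℕ} (hi : i' < n) (hj : j' < n) (hd : d' < N) :
    ((p * n + i') * n + j') * N + d' < (((p + 1) * n + i) * n + j) * N + d := by
  have h1 : (p * n + i') * n + j' + 1 ≤ ((p + 1) * n + i) * n + j := by
    have := Nat.mul_le_mul_right n (show p * n + i' + 1 ≤ (p + 1) * n + i by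
      rw [Nat.succ_mul]; omega)
    rw [Nat.succ_mul] at this
    omega
  have := Nat.mul_le_mul_right N h1
  rw [Nat.succ_mul] at this
  omega

include hZ hw in
/-- The packed indices are ordered by rounds, so the recursion only refers to earlier entries. -/
theorem tri_bird (hc : Ctx Z J K β s) {E : ℕ → ℕ → ℕ}
    (hE : ∀ a < n, ∀ b < n, s.mem (M + 16 * (a * n + b) + 3) = E a b) :
    let N := J.cutoff K
    Tri w (fillT 4 10 Code.bird) (Z ^ 243) s (fun s' => s'.reg = s.reg ∧ s'.coins = s.coins ∧
      Upd M 4 (n * n * n * N) (fun x => birdN E n (x / N / n / n) (x / N / n % n) (x / N % n) (x % N))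
        s.mem s'.mem ∧ Bdd Z s') := by
  intro N
  rw [← hc.reg10]
  refine tri_table hZ hw hc.toBdd hc.reg9 4 (by norm_num) (by norm_num) Code.small.2.1 _ ?_ ?_
  · intro x _
    exact (birdN_le_one _ _ _ _ _ _).trans (by omega)
  · intro x hx m hm
    rw [hc.reg10] at hx
    have hN : 0 < N := Nat.pos_of_ne_zero fun h => by simp [show J.cutoff K = 0 from h] at hx
    have hn : 0 < n := Nat.pos_of_ne_zero fun h => by simp [h] at hx
    have e1 := (eval_regs (s := s) (x := x) (r := 1) (by norm_num)).trans hc.reg1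
    have e8 := (eval_regs (s := s) (x := x) (r := 8) (by norm_num)).trans hc.reg8
    have e9 := (eval_regs (s := s) (x := x) (r := 9) (by norm_num)).trans hc.reg9
    have e40 : (Function.update s.reg 40 x ∘ regMap 41) 40 = x := by simp [regMap]
    generalize Function.update s.reg 40 x ∘ regMap 41 = v at *
    have hE' : ∀ a < n, ∀ b < n, m (M + 16 * (a * n + b) + 3) = E a b := fun a ha b hb =>
      (hm.other _ 3 (by norm_num) (by norm_num)).trans (hE a ha b hb)
    have hnew := hm.new
    have hi : x / N / n % n < n := Nat.mod_lt _ hn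
    have hj : x / N % n < n := Nat.mod_lt _ hn
    have hd : x % N < N := Nat.mod_lt _ hN
    have hxe : x = ((x / N / n / n * n + x / N / n % n) * n + x / N % n) * N + x % N := by
      rw [Nat.div_add_mod', Nat.div_add_mod', Nat.div_add_mod']
    simp only [Code.bird, Exp.eval_add, Exp.eval_mul, Exp.eval_eq, Exp.eval_lt, Exp.eval_mod,
      Exp.eval_div, Exp.eval_sub, Exp.eval_bsum, Exp.eval_var, eval_tab, Exp.eval_ofNat, e1, e8, e9,
      e40, Function.update_self, update_fifty]
    rw [show J.cutoff K = N from rfl]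
    generalize x / N / n / n = p at *
    generalize x / N / n % n = i at *
    generalize x / N % n = j at *
    generalize x % N = d at *
    cases p with
    | zero => simp [birdN, hE' i hi j hj]
    | succ p =>
      have hX : ∀ i' < n, ∀ j' < n, ∀ d' < N,
          m (M + 16 * (((p * n + i') * n + j') * N + d') + 4) = birdN E n p i' j' d' := by
        intro i' hi' j' hj' d' hd'
        rw [hnew _ (hxe ▸ bird_index_lt hi' hj' hd')]
        obtain ⟨h1, h2, h3, h4⟩ := decode (p := p) hi' hj' hd'
        rw [h1, h2, h3, h4]
      rw [birdN, if_neg (Nat.succ_ne_zero p), if_pos (Nat.succ_pos p), zero_mul, zero_add, one_mul]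
      congr 1
      refine sum_congr rfl fun s hs => ?_
      have hs := mem_range.1 hs
      rw [hE' _ hs _ hj, hE' _ hi _ hj, Nat.add_sub_cancel, hX _ hi _ hs _ (by omega),
        hX _ hs _ hs _ (by omega)]

include hZ hw in
theorem tri_addDet (hc : Ctx Z J K β s) {E : ℕ → ℕ → ℕ} {q : ℕ → ℕ}
    (hX : ∀ k < n, ∀ d < J.cutoff K,
      s.mem (M + 16 * ((((n - 1) * n + k) * n + k) * J.cutoff K + d) + 4) = birdN E n (n - 1) k k d)
    (hq : ∀ d < J.cutoff K, s.mem (M + 16 * d + 5) = q d) :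
    Tri w (fillT 5 8 Code.addDet) (Z ^ 243) s (fun s' => s'.reg = s.reg ∧ s'.coins = s.coins ∧
      Upd M 5 (J.cutoff K) (fun d => (q d + ∑ k ∈ range n, birdN E n (n - 1) k k d) % 2)
        s.mem s'.mem ∧ Bdd Z s') := by
  rw [← hc.reg8]
  refine tri_table hZ hw hc.toBdd hc.reg9 5 (by norm_num) (by norm_num) Code.small.2.2.1 _
    (fun x _ => by omega) fun x hx m hm => ?_
  have e1 := (eval_regs (s := s) (x := x) (r := 1) (by norm_num)).trans hc.reg1
  have e8 := (eval_regs (s := s) (x := x) (r := 8) (by norm_num)).trans hc.reg8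
  have e9 := (eval_regs (s := s) (x := x) (r := 9) (by norm_num)).trans hc.reg9
  have e40 : (Function.update s.reg 40 x ∘ regMap 41) 40 = x := by simp [regMap]
  generalize Function.update s.reg 40 x ∘ regMap 41 = v at *
  simp only [Code.addDet, Exp.eval_add, Exp.eval_mul, Exp.eval_mod, Exp.eval_sub, Exp.eval_bsum,
    Exp.eval_var, eval_tab, Exp.eval_ofNat, e1, e8, e9, e40, Function.update_self,
    update_fifty]
  rw [hc.reg8] at hx
  rw [hm.old x le_rfl, hq x hx]
  congr 2
  refine sum_congr rfl fun k hk => ?_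
  rw [hm.other _ 4 (by norm_num) (by norm_num), hX k (mem_range.1 hk) x hx]

theorem Ctx.eval_missing (hc : Ctx Z J K β s) {B : ℕ → ℕ} {m v : ℕ → ℕ}
    (hm : ∀ c < M, m c = s.mem c) (hB : ∀ p < t * t, m (M + 16 * p + 6) = B p)
    (h2 : v 2 = t) (h9 : v 9 = M) (h19 : v 19 = 4 + n + n * n) {y : ℕ} (hy : v y ≤ t * t) :
    (Code.missing y).eval m v = ∑ q ∈ range (v y), J.act q * (1 - B q) := by
  rw [Code.missing, Exp.eval_bsum]
  refine sum_congr rfl fun q hq => ?_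
  have hq : q < t * t := (mem_range.1 hq).trans_le hy
  rw [Exp.eval_mul, hc.eval_act hm (by simpa using h2) (by simpa using h19) (by simpa using hq)]
  simp [h9, hB q hq]

include hZ hw in
/-- Table 7 gets the successor of the set in table 6, or the empty set if all pattern edges were
in it. -/
theorem tri_next (hc : Ctx Z J K β s) (hJ : J.Valid) {k : ℕ}
    (hB : ∀ p < t * t, s.mem (M + 16 * p + 6) = mask J.act k p) :
    Tri w (fillT 7 11 Code.next) (Z ^ 243) s (fun s' => s'.reg = s.reg ∧ s'.coins = s.coins ∧
      Upd M 7 (t * t) (mask J.act (k + 1)) s.mem s'.mem ∧ Bdd Z s') := by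
  rw [← hc.reg11]
  refine tri_table hZ hw hc.toBdd hc.reg9 7 (by norm_num) (by norm_num) Code.small.2.2.2.1 _
    (fun x _ => (mask_le_one hJ.act_le_one _ _).trans (by omega)) fun x hx m hm => ?_
  rw [hc.reg11] at hx
  have e2 := (eval_regs (s := s) (x := x) (r := 2) (by norm_num)).trans hc.reg2
  have e9 := (eval_regs (s := s) (x := x) (r := 9) (by norm_num)).trans hc.reg9
  have e19 := (eval_regs (s := s) (x := x) (r := 19) (by norm_num)).trans hc.reg19
  have e40 : (Function.update s.reg 40 x ∘ regMap 41) 40 = x := by simp [regMap]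
  generalize Function.update s.reg 40 x ∘ regMap 41 = v at *
  have hB' : ∀ p < t * t, m (M + 16 * p + 6) = mask J.act k p := fun p hp =>
    (hm.other p 6 (by norm_num) (by norm_num)).trans (hB p hp)
  rw [Code.next, Exp.eval_mul, Exp.eval_mod, Exp.eval_add, Exp.eval_eq,
    hc.eval_act hm.low e2 e19 (by simpa [e40] using hx),
    hc.eval_missing hm.low hB' e2 e9 e19 (by rw [e40]; exact hx.le)]
  simp only [Exp.eval_var, eval_tab, e40, e9, hB' x hx, Exp.eval_ofNat]
  exact (mask_succ hJ.act_le_one k x).symm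

/-- The parity of the sum of the determinants for the first `k` sets of pattern edges. -/
def partialParity (J : CMData n t) (K : ℕ) (β : ℕ → Bool) (mate : ℕ → ℕ) (k d : ℕ) : ℕ :=
  (∑ m ∈ range k, ∑ i ∈ range n,
    birdN (fun a b => J.expo K β a b + J.cutoff K * J.kill mate (mask J.act m) a b)
      n (n - 1) i i d) % 2

/-- The part of the state that a run of `Code.parity` started in `s₀` does not change. -/
structure Frame (n t Z : ℕ) (s₀ s : State) : Prop extends Bdd Z s where
  reg_eq : ∀ r, r ≠ 13 → s.reg r = s₀.reg r
  coins_eq : s.coins = s₀.coins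
  low : ∀ c < tableBase n t, s.mem c = s₀.mem c
  tab_eq : ∀ i ∈ [0, 1, 2, 8], ∀ x, s.mem (tableBase n t + 16 * x + i) = s₀.mem (tableBase n t + 16 * x + i)

theorem Frame.ctx {s₀ : State} (h : Frame n t Z s₀ s) (hc : Ctx Z J K β s₀) : Ctx Z J K β s :=
  hc.congr h.toBdd (fun r hr => h.reg_eq r (by rintro rfl; simp at hr)) h.low (h.tab_eq 2 (by simp))

theorem Frame.upd {s₀ s' : State} (h : Frame n t Z s₀ s) {i b : ℕ} {g : ℕ → ℕ}
    (hi : i ∉ [0, 1, 2, 8]) (hr : s'.reg = s.reg) (hco : s'.coins = s.coins)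
    (hu : Upd M i b g s.mem s'.mem) (hb : Bdd Z s') : Frame n t Z s₀ s' where
  toBdd := hb
  reg_eq r hr' := by rw [hr]; exact h.reg_eq r hr'
  coins_eq := hco.trans h.coins_eq
  low c hc := (hu.low c hc).trans (h.low c hc)
  tab_eq j hj x := (hu.other x j (by simp at hj; omega) (by rintro rfl; exact hi hj)).trans
    (h.tab_eq j hj x)

theorem Frame.refl (h : Bdd Z s) : Frame n t Z s s :=
  ⟨h, fun _ _ => rfl, rfl, fun _ _ => rfl, fun _ _ _ => rfl⟩

/-- The invariant of `Code.parity`: the first `k` sets have been dealt with. -/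
structure ParityInv (J : CMData n t) (Z K : ℕ) (β : ℕ → Bool) (mate : ℕ → ℕ) (s₀ : State)
    (k : ℕ) (s : State) : Prop extends Frame n t Z s₀ s where
  set_eq : ∀ p < t * t, s.mem (M + 16 * p + 6) = mask J.act k p
  parity_eq : ∀ d < J.cutoff K, s.mem (M + 16 * d + 5) = partialParity J K β mate k d
  cont_eq : s.reg 13 = if k < 2 ^ rank J.act (t * t) then 1 else 0

include hZ hw in
theorem tri_parityStep {s₀ : State} (hc₀ : Ctx Z J K β s₀) (hJ : J.Valid) {mate : ℕ → ℕ}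
    (hmate : ∀ u < n, s₀.mem (M + 16 * u + 8) = mate u)
    (hZN : ∀ x < n * n, J.expo K β (x / n) (x % n) + 4 * J.cutoff K ≤ Z) {k : ℕ}
    (hk : k < 2 ^ rank J.act (t * t)) (h : ParityInv J Z K β mate s₀ k s) :
    Tri w Code.parityStep (6 * Z ^ 243) s (ParityInv J Z K β mate s₀ (k + 1)) := by
  have hact := hJ.act_le_one
  refine (Tri.seq (t := Z ^ 243) (u := 5 * Z ^ 243) (tri_ent hZ hw (h.ctx hc₀) hJ (mate := mate)
    (fun u hu => (h.tab_eq 8 (by simp) u).trans (hmate u hu)) h.set_eq (mask_le_one hact k) hZN)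
    ?_).mono (by omega) fun _ h => h
  rintro s1 ⟨r1, c1, u1, b1⟩
  have f1 := h.toFrame.upd (by simp) r1 c1 u1 b1
  refine (Tri.seq (t := Z ^ 243) (u := 4 * Z ^ 243) (tri_bird hZ hw (f1.ctx hc₀)
    (E := fun a b => J.expo K β a b + J.cutoff K * J.kill mate (mask J.act k) a b)
    fun a ha b hb => ?_) ?_).mono (by omega) fun _ h => h
  · have hx : a * n + b < n * n := by nlinarith
    have : (a * n + b) / n = a ∧ (a * n + b) % n = b :=
      (Nat.div_mod_unique (by omega)).2 ⟨by ring, hb⟩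
    rw [u1.new _ hx, this.1, this.2]
  rintro s2 ⟨r2, c2, u2, b2⟩
  have f2 := f1.upd (by simp) r2 c2 u2 b2
  refine (Tri.seq (t := Z ^ 243) (u := 3 * Z ^ 243) (tri_addDet hZ hw (f2.ctx hc₀)
    (E := fun a b => J.expo K β a b + J.cutoff K * J.kill mate (mask J.act k) a b)
    (q := partialParity J K β mate k) ?_ ?_) ?_).mono (by omega) fun _ h => h
  · intro i hi d hd
    have hx : (((n - 1) * n + i) * n + i) * J.cutoff K + d < n * n * n * J.cutoff K := by
      have := bird_index_lt (n := n) (N := J.cutoff K) (p := n - 1) (i := 0) (j := 0) (d := 0)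
        hi hi hd
      rw [Nat.sub_add_cancel (by omega)] at this
      simpa using this
    obtain ⟨h1, h2, h3, h4⟩ := decode (p := n - 1) hi hi hd
    rw [u2.new _ hx, h1, h2, h3, h4]
  · intro d hd
    rw [u2.other d 5 (by norm_num) (by norm_num), u1.other d 5 (by norm_num) (by norm_num)]
    exact h.parity_eq d hd
  rintro s3 ⟨r3, c3, u3, b3⟩
  have f3 := f2.upd (by simp) r3 c3 u3 b3
  have B3 : ∀ p < t * t, s3.mem (M + 16 * p + 6) = mask J.act k p := fun p hp => by
    rw [u3.other p 6 (by norm_num) (by norm_num), u2.other p 6 (by norm_num) (by norm_num),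
      u1.other p 6 (by norm_num) (by norm_num)]
    exact h.set_eq p hp
  have hc3 := f3.ctx hc₀
  have e : ∀ r < 40, (s3.reg ∘ regMap 40) r = s3.reg r := fun r hr => by simp [regMap, hr]
  refine (Tri.seq (t := Z ^ 243) (u := 2 * Z ^ 243) (tri_assign hZ hw b3 (by norm_num)
    Code.small.2.2.2.2.1 (v := if k + 1 < 2 ^ rank J.act (t * t) then 1 else 0) ?_
    (by split <;> omega)) ?_).mono (by omega) fun _ h => h
  · rw [Exp.eval_lt, Exp.eval_ofNat, hc3.eval_missing (fun _ _ => rfl) B3 ((e _ (by norm_num)).trans hc3.reg2)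
      ((e _ (by norm_num)).trans hc3.reg9) ((e _ (by norm_num)).trans hc3.reg19)
      ((e _ (by norm_num)).trans hc3.reg11).le, (e _ (by norm_num)).trans hc3.reg11]
    have h1 := sum_zeros_eq_zero_iff hact k (t * t)
    rw [forall_testBit_iff hk] at h1
    by_cases h2 : k + 1 = 2 ^ rank J.act (t * t)
    -- the loop ends when no pattern edge is missing in the current set
    · rw [h1.2 h2, if_neg (by omega), if_neg (by omega)]
    · rw [if_pos (Nat.pos_of_ne_zero fun h3 => h2 (h1.1 h3)), if_pos (by omega)]
  rintro s4 ⟨rfl, b4⟩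
  have f4 : Frame n t Z s₀ (s3.setReg 13 (if k + 1 < 2 ^ rank J.act (t * t) then 1 else 0)) :=
    ⟨b4, fun r hr => by rw [State.setReg_reg, Function.update_of_ne hr]; exact f3.reg_eq r hr,
      f3.coins_eq, f3.low, f3.tab_eq⟩
  refine (Tri.seq (t := Z ^ 243) (u := Z ^ 243) (tri_next hZ hw (f4.ctx hc₀) hJ B3) ?_).mono
    (by omega) fun _ h => h
  rintro s5 ⟨r5, c5, u5, b5⟩
  have f5 := f4.upd (by simp) r5 c5 u5 b5
  have hc5 := f5.ctx hc₀
  refine (tri_table hZ hw b5 hc5.reg9 6 (by norm_num) (by norm_num) Code.small.2.2.2.2.2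
    (mask J.act (k + 1)) (fun x _ => (mask_le_one hact _ _).trans (by omega)) ?_).mono le_rfl ?_
  · intro x hx m hm
    have e9 := (eval_regs (s := s5) (x := x) (r := 9) (by norm_num)).trans hc5.reg9
    have e40 : (Function.update s5.reg 40 x ∘ regMap 41) 40 = x := by simp [regMap]
    rw [eval_tab, e9, Exp.eval_var, e40, hm.other x 7 (by norm_num) (by norm_num)]
    rw [hc5.reg11] at hx
    exact u5.new x hx
  · rintro s6 ⟨r6, c6, u6, b6⟩
    refine ⟨f5.upd (by simp) r6 c6 u6 b6, fun p hp => u6.new p (by rwa [hc5.reg11]), fun d hd => ?_,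
      by rw [r6, r5]; simp⟩
    rw [u6.other d 5 (by norm_num) (by norm_num), u5.other d 5 (by norm_num) (by norm_num)]
    rw [State.setReg_mem, u3.new d hd, partialParity, partialParity, sum_range_succ, Nat.mod_add_mod]

include hZ hw in
/-- The parities of `partialParity` for all sets of pattern edges; by `CMData.Valid.sum_masks` they
are those of the numbers of solutions. -/
theorem tri_parity (hc : Ctx Z J K β s) (hJ : J.Valid) {mate : ℕ → ℕ}
    (hmate : ∀ u < n, s.mem (M + 16 * u + 8) = mate u)
    (hZN : ∀ x < n * n, J.expo K β (x / n) (x % n) + 4 * J.cutoff K ≤ Z) :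
    Tri w Code.parity (2 ^ rank J.act (t * t) * Z ^ 244) s (fun s' => Frame n t Z s s' ∧
      ∀ d < J.cutoff K, s'.mem (M + 16 * d + 5) =
        partialParity J K β mate (2 ^ rank J.act (t * t)) d) := by
  have hr := Nat.one_le_two_pow (n := rank J.act (t * t))
  have hz1 : 1 ≤ Z ^ 243 := Nat.one_le_pow _ _ (by omega)
  refine (Tri.seq (t := Z ^ 243) (u := 2 * Z ^ 243 +
    (2 ^ rank J.act (t * t) * (6 * Z ^ 243 + 1) + 1)) (tri_table hZ hw hc.toBdd hc.reg9 5
      (by norm_num) (by norm_num) (e := 0) (by decide) (fun _ => 0) (fun _ _ => by omega)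
      fun _ _ _ _ => rfl) ?_).mono ?_ fun _ h => h
  · rintro s1 ⟨r1, c1, u1, b1⟩
    have f1 := (Frame.refl (n := n) (t := t) hc.toBdd).upd (by simp) r1 c1 u1 b1
    have hc1 := f1.ctx hc
    refine (Tri.seq (t := Z ^ 243) (u := Z ^ 243 +
      (2 ^ rank J.act (t * t) * (6 * Z ^ 243 + 1) + 1)) (tri_table hZ hw b1 hc1.reg9 6
        (by norm_num) (by norm_num) (e := 0) (by decide) (fun _ => 0) (fun _ _ => by omega)
        fun _ _ _ _ => rfl) ?_).mono (by omega) fun _ h => h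
    rintro s2 ⟨r2, c2, u2, b2⟩
    have f2 := f1.upd (by simp) r2 c2 u2 b2
    refine Tri.seq (tri_assign hZ hw b2 (x := 13) (by norm_num) (e := 1) (by decide) (v := 1) rfl
      (by omega)) ?_
    rintro s3 ⟨rfl, b3⟩
    refine (Tri.loop (2 ^ rank J.act (t * t)) (ParityInv J Z K β mate s)
      (fun k hk s' h => ⟨?_, tri_parityStep hZ hw hc hJ hmate hZN hk h⟩)
      (fun s' h => by rw [h.cont_eq]; simp) ?_).mono le_rfl fun s' h => ⟨h.toFrame, h.parity_eq⟩
    · rw [h.cont_eq, if_pos hk]; norm_num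
    · refine ⟨⟨b3, fun r hr => ?_, f2.coins_eq, f2.low, f2.tab_eq⟩, fun p hp => ?_, fun d hd => ?_, ?_⟩
      · rw [State.setReg_reg, Function.update_of_ne hr]; exact f2.reg_eq r hr
      · rw [State.setReg_mem, u2.new p (by rwa [hc1.reg11])]; simp [mask]
      · rw [State.setReg_mem, u2.other d 5 (by norm_num) (by norm_num),
          u1.new d (by rwa [hc.reg8])]
        simp [partialParity]
      · simp
  · have h3 : Z ^ 243 * 16 ≤ Z ^ 244 := by rw [pow_succ]; exact Nat.mul_le_mul_left _ hZ
    have h4 : 2 ^ rank J.act (t * t) * (Z ^ 243 * 16) ≤ 2 ^ rank J.act (t * t) * Z ^ 244 :=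
      Nat.mul_le_mul_left _ h3
    refine le_trans ?_ h4
    generalize 2 ^ rank J.act (t * t) = R at *
    generalize Z ^ 243 = Y at *
    nlinarith

end

end WordRAM

/-! ### Extracting a solution -/

namespace WordRAM

namespace Code

/-- Match node `u` (register 32) with node `v` (register 36) if `u` is free and the number of
solutions extending the result is odd. -/
def tryMate : Prog :=
  .seq (assignP 40 16 (tab 8 (.var 32)))
  (.seq (storeP 40 40 (tabA 8 (.var 32))
    (.eq (.var 16) (.var 1) * .var 36 + (1 - .eq (.var 16) (.var 1)) * .var 16))
  (.seq parity
  (.seq (assignP 40 21 (tab 5 (.var 14)))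
  (storeP 40 40 (tabA 8 (.var 32))
    (.eq (.var 16) (.var 1) * (.var 21 * .var 36 + (1 - .var 21) * .var 1) +
      (1 - .eq (.var 16) (.var 1)) * .var 16)))))

/-- The first exponent with an odd number of solutions. -/
def firstOdd : Exp :=
  .bsum 50 8 (.var 50 * (tab 5 (.var 50) * .eq (.bsum 51 50 (tab 5 (.var 51))) 0))

/-- Find an exponent with an odd number of solutions and match the nodes one after the other,
keeping this number odd. -/
def extract : Prog :=
  .seq parity
  (.seq (assignP 40 14 firstOdd)
  (.seq (assignP 40 15 (.lt 0 (.bsum 50 8 (tab 5 (.var 50)))))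
  (.seq (forP 32 1 (forP 36 1 tryMate))
  (.seq (fillP 40 1 (.var 40) (tab 8 (.var 40)))
  (assignP 40 0 (.var 15 + .eq (.var 1) 0))))))

end Code

section

variable {w Z n t K : ℕ} {J : CMData n t} {β : ℕ → Bool} {s : State}

theorem partialParity_eq (hJ : J.Valid) (hn : 0 < n) (mate : ℕ → ℕ) {d : ℕ} (hd : d < J.cutoff K) :
    partialParity J K β mate (2 ^ rank J.act (t * t)) d = #(J.solSet K β mate d) % 2 :=
  (ZMod.natCast_eq_natCast_iff' _ _ _).1 (hJ.sum_masks hn mate hd)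

/-- The state holds the partial matching `mate`, the exponent `d` and the flag `f`. -/
structure Ext (Z : ℕ) (J : CMData n t) (K : ℕ) (β : ℕ → Bool) (d f : ℕ) (mate : ℕ → ℕ) (s : State) :
    Prop extends Ctx Z J K β s where
  mate_eq : ∀ u < n, s.mem (tableBase n t + 16 * u + 8) = mate u
  mate_le : ∀ u < n, mate u ≤ n
  reg14 : s.reg 14 = d
  reg15 : s.reg 15 = f

theorem Ctx.setReg (h : Ctx Z J K β s) {x v : ℕ} (hx : x ∉ [1, 2, 4, 8, 9, 10, 11, 19])
    (hb : Bdd Z (s.setReg x v)) : Ctx Z J K β (s.setReg x v) :=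
  h.congr hb (fun r hr => by
    rw [State.setReg_reg, Function.update_of_ne (by rintro rfl; exact hx hr)]) (fun _ _ => rfl)
    fun _ => rfl

theorem Ctx.setMem (h : Ctx Z J K β s) {u v : ℕ}
    (hb : Bdd Z (s.setMem (tableBase n t + 16 * u + 8) v)) :
    Ctx Z J K β (s.setMem (tableBase n t + 16 * u + 8) v) :=
  h.congr hb (fun _ _ => rfl)
    (fun c hc => by simp only [State.setMem]; rw [Function.update_of_ne (by omega)])
    (fun x => by simp only [State.setMem]; rw [Function.update_of_ne (by omega)])

theorem regMap_eval {r : ℕ} (hr : r < 40) : (s.reg ∘ regMap 40) r = s.reg r := by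
  simp [regMap, hr]

open Classical in
/-- The partial matching after an attempt to match `u` with `v`. -/
noncomputable def stepMate (J : CMData n t) (K : ℕ) (β : ℕ → Bool) (d : ℕ) (mate : ℕ → ℕ)
    (u v : ℕ) : ℕ → ℕ :=
  if mate u = n ∧ Odd #(J.solSet K β (Function.update mate u v) d) then Function.update mate u v
  else mate

theorem stepMate_le {d u v : ℕ} {mate : ℕ → ℕ} (hv : v < n) (h : ∀ u < n, mate u ≤ n) :
    ∀ x < n, stepMate J K β d mate u v x ≤ n := by
  intro x hx
  rw [stepMate]
  split
  · rw [Function.update_apply]; split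
    · exact hv.le
    · exact h x hx
  · exact h x hx

theorem Ext.bdd_of {d f : ℕ} {mate : ℕ → ℕ} (h : Ext Z J K β d f mate s) : n ≤ Z := by
  rw [← h.reg1]; exact h.reg_le 1

variable (hZ : 16 ≤ Z) (hw : Z ^ 240 < 2 ^ w)

local notation "M" => tableBase n t

include hZ hw in
theorem tri_tryMate (hJ : J.Valid) {d f u v : ℕ} {mate : ℕ → ℕ} (h : Ext Z J K β d f mate s)
    (hZN : ∀ x < n * n, J.expo K β (x / n) (x % n) + 4 * J.cutoff K ≤ Z)
    (hd : d < J.cutoff K) (hu : u < n) (hv : v < n) (h32 : s.reg 32 = u) (h36 : s.reg 36 = v) :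
    Tri w Code.tryMate (2 ^ rank J.act (t * t) * Z ^ 245) s (fun s' =>
      Ext Z J K β d f (stepMate J K β d mate u v) s' ∧ ∀ r, 32 ≤ r → s'.reg r = s.reg r) := by
  have hnZ := h.bdd_of
  have hn : 0 < n := by omega
  have hmu := h.mate_le u hu
  set R := 2 ^ rank J.act (t * t) with hR
  refine (Tri.seq (t := Z ^ 243) (u := R * Z ^ 244 + 3 * Z ^ 243) (tri_assign hZ hw h.toBdd
    (by norm_num) (e := tab 8 (.var 32)) (by decide) (v := mate u) ?_ (by omega)) ?_).mono ?_
    fun _ h => h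
  · rw [eval_tab, regMap_eval (by norm_num), Exp.eval_var, regMap_eval (by norm_num), h32, h.reg9,
      h.mate_eq u hu]
  swap
  · have h1 : 1 ≤ R := Nat.one_le_two_pow
    have h2 : Z ^ 244 = Z ^ 243 * Z := pow_succ _ _
    have h3 : Z ^ 245 = Z ^ 244 * Z := pow_succ _ _
    have h4 : Z ^ 243 * 16 ≤ Z ^ 244 := by rw [h2]; exact Nat.mul_le_mul_left _ hZ
    have h5 : R * Z ^ 244 * 16 ≤ R * Z ^ 245 := by
      rw [h3, mul_assoc]; exact Nat.mul_le_mul_left _ (Nat.mul_le_mul_left _ hZ)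
    have h6 : Z ^ 244 ≤ R * Z ^ 244 := Nat.le_mul_of_pos_left _ h1
    omega
  rintro s1 ⟨rfl, b1⟩
  have c1 := h.toCtx.setReg (by simp) b1
  have e : ∀ {s : State} {r : ℕ}, r < 40 → (s.reg ∘ regMap 40) r = s.reg r := regMap_eval
  refine (Tri.seq (t := Z ^ 243) (u := R * Z ^ 244 + 2 * Z ^ 243) (tri_store hZ hw b1
    (a := tabA 8 (.var 32))
    (e := .eq (.var 16) (.var 1) * .var 36 + (1 - .eq (.var 16) (.var 1)) * .var 16)
    (by decide) (by decide) (A := M + 16 * u + 8) (v := if mate u = n then v else mate u)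
    ?_ ?_ (by split <;> omega)) ?_).mono (by omega) fun _ h => h
  · rw [eval_tabA, e (by norm_num), Exp.eval_var, e (by norm_num), c1.reg9]; simp [h32]
  · simp only [Exp.eval_add, Exp.eval_mul, Exp.eval_eq, Exp.eval_var, Exp.eval_sub,
      e (show 16 < 40 by norm_num), e (show 1 < 40 by norm_num), e (show 36 < 40 by norm_num),
      c1.reg1]
    simp [h36]
    split <;> simp
  rintro s2 ⟨rfl, b2⟩
  have c2 := c1.setMem b2
  refine (Tri.seq (t := R * Z ^ 244) (u := 2 * Z ^ 243) (tri_parity hZ hw c2 hJ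
    (mate := Function.update mate u (if mate u = n then v else mate u)) (fun x hx => ?_) hZN)
    ?_).mono (by omega) fun _ h => h
  · simp only [State.setMem, State.setReg_mem, Function.update_apply]
    by_cases hxu : x = u
    · subst hxu; simp
    · rw [if_neg (by omega), if_neg hxu]; exact h.mate_eq x hx
  rintro s3 ⟨f3, p3⟩
  have c3 := f3.ctx c2
  have hp := p3 d hd
  rw [partialParity_eq hJ hn _ hd] at hp
  have r14 : s3.reg 14 = d := (f3.reg_eq 14 (by norm_num)).trans (by
    simpa [State.setMem] using h.reg14)
  have r15 : s3.reg 15 = f := (f3.reg_eq 15 (by norm_num)).trans (by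
    simpa [State.setMem] using h.reg15)
  have r16 : s3.reg 16 = mate u := (f3.reg_eq 16 (by norm_num)).trans (by simp [State.setMem])
  have r32 : ∀ r, 32 ≤ r → s3.reg r = s.reg r := fun r hr => (f3.reg_eq r (by omega)).trans (by
    simp only [State.setMem, State.setReg_reg]; rw [Function.update_of_ne (by omega)])
  generalize hg : #(J.solSet K β (Function.update mate u (if mate u = n then v else mate u)) d) % 2
    = g at hp
  have hg1 : g ≤ 1 := by omega
  refine (Tri.seq (t := Z ^ 243) (u := Z ^ 243) (tri_assign hZ hw f3.toBdd
    (by norm_num) (e := tab 5 (.var 14)) (by decide) (v := g) ?_ (by omega)) ?_).mono (by omega)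
    fun _ h => h
  · rw [eval_tab, e (by norm_num), Exp.eval_var, e (by norm_num), c3.reg9, r14]; exact hp
  rintro s4 ⟨rfl, b4⟩
  have c4 := c3.setReg (by simp) b4
  -- the old value is restored unless the new one keeps the number of solutions odd
  have hfin : (if mate u = n then g * v + (1 - g) * n else mate u) =
      stepMate J K β d mate u v u := by
    rw [stepMate]
    by_cases h1 : mate u = n
    · simp only [h1, if_true, true_and] at hg ⊢
      by_cases h2 : Odd #(J.solSet K β (Function.update mate u v) d)
      · rw [Nat.odd_iff.1 h2] at hg; simp [← hg, if_pos h2]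
      · rw [Nat.not_odd_iff.1 h2] at hg; simp [← hg, if_neg h2, h1]
    · simp [h1]
  refine (tri_store hZ hw b4 (a := tabA 8 (.var 32))
    (e := .eq (.var 16) (.var 1) * (.var 21 * .var 36 + (1 - .var 21) * .var 1) +
      (1 - .eq (.var 16) (.var 1)) * .var 16)
    (by decide) (by decide) (A := M + 16 * u + 8) (v := stepMate J K β d mate u v u)
    ?_ ?_ ((stepMate_le hv h.mate_le u hu).trans hnZ)).mono le_rfl ?_
  · rw [eval_tabA, e (by norm_num), Exp.eval_var, e (by norm_num), c4.reg9]; simp [r32, h32]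
  · rw [← hfin]
    simp only [Exp.eval_add, Exp.eval_mul, Exp.eval_eq, Exp.eval_var, Exp.eval_sub, Exp.eval_ofNat,
      e (show 16 < 40 by norm_num), e (show 1 < 40 by norm_num), e (show 36 < 40 by norm_num),
      e (show 21 < 40 by norm_num), c4.reg1]
    simp [r32, h36, r16]
    split <;> simp
  · rintro s5 ⟨rfl, b5⟩
    refine ⟨⟨c4.setMem b5, fun x hx => ?_, stepMate_le hv h.mate_le, ?_, ?_⟩, fun r hr => ?_⟩
    · simp only [State.setMem, State.setReg_mem, Function.update_apply]
      by_cases hxu : x = u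
      · subst hxu; simp
      · rw [if_neg (by omega), f3.tab_eq 8 (by simp)]
        simp only [State.setMem, State.setReg_mem, Function.update_apply]
        rw [if_neg (by omega), h.mate_eq x hx, stepMate]
        split
        · rw [Function.update_of_ne hxu]
        · rfl
    · simpa [State.setMem] using r14
    · simpa [State.setMem] using r15
    · simp only [State.setMem, State.setReg_reg]
      rw [Function.update_of_ne (by omega)]; exact r32 r hr

/-- The partial matching `mate` extends to an odd number of solutions, gives a partner to all nodes
below `u`, and if `u` is free then its partner cannot be chosen below `v` without losing this
parity. -/
structure Good (J : CMData n t) (K : ℕ) (β : ℕ → Bool) (d : ℕ) (mate : ℕ → ℕ) (u v : ℕ) : Prop where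
  odd : Odd #(J.solSet K β mate d)
  matched : ∀ x < u, mate x ≠ n
  even : mate u = n → ∀ y < v, Even #(J.solSet K β (Function.update mate u y) d)

theorem Good.step {d u v : ℕ} {mate : ℕ → ℕ} (h : Good J K β d mate u v) (hv : v < n) :
    Good J K β d (stepMate J K β d mate u v) u (v + 1) := by
  rw [stepMate]
  split
  · rename_i h'
    refine ⟨h'.2, fun x hx => ?_, fun h1 => ?_⟩
    · rw [Function.update_of_ne hx.ne]; exact h.matched x hx
    · rw [Function.update_self] at h1; omega
  · rename_i h'
    refine ⟨h.odd, h.matched, fun h1 y hy => ?_⟩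
    rcases Nat.lt_succ_iff_lt_or_eq.1 hy with hy | rfl
    · exact h.even h1 y hy
    · exact Nat.not_odd_iff_even.1 fun h2 => h' ⟨h1, h2⟩

/-- Some choice of a partner keeps the parity odd, because the solutions are split according to the
partner. -/
theorem Good.next {d u : ℕ} {mate : ℕ → ℕ} (h : Good J K β d mate u n) (hu : u < n) :
    Good J K β d mate (u + 1) 0 := by
  refine ⟨h.odd, fun x hx => ?_, fun _ y hy => absurd hy (Nat.not_lt_zero y)⟩
  rcases Nat.lt_succ_iff_lt_or_eq.1 hx with hx | rfl
  · exact h.matched x hx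
  · intro h1
    refine Nat.not_even_iff_odd.2 h.odd ?_
    rw [CMData.card_solSet_eq_sum mate d hu h1, even_iff_two_dvd]
    exact dvd_sum fun y hy => even_iff_two_dvd.1 (h.even h1 y (mem_range.1 hy))

/-- The state without the registers of the outer loops. The invariants of these loops speak about
the truncated state, because they must not depend on the loop registers. -/
def State.trunc (s : State) : State := { s with reg := fun r => if r < 32 then s.reg r else 0 }

theorem State.trunc_congr {s' : State} (hr : ∀ r < 32, s'.reg r = s.reg r) (hm : s'.mem = s.mem)
    (hc : s'.coins = s.coins) : s'.trunc = s.trunc := by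
  simp only [State.trunc, hm, hc, State.mk.injEq, and_self, and_true]
  funext r
  split
  · exact hr r ‹_›
  · rfl

theorem Ext.trunc {d f : ℕ} {mate : ℕ → ℕ} (h : Ext Z J K β d f mate s) :
    Ext Z J K β d f mate s.trunc where
  toCtx := h.toCtx.congr ⟨fun r => by simp only [State.trunc]; split; exacts [h.reg_le r, by omega],
    h.mem_le, fun r hr => if_neg (by omega)⟩ (by simp [State.trunc]) (fun _ _ => rfl) fun _ => rfl
  mate_eq := h.mate_eq
  mate_le := h.mate_le
  reg14 := h.reg14
  reg15 := h.reg15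

theorem Ext.of_trunc {d f : ℕ} {mate : ℕ → ℕ} (h : Ext Z J K β d f mate s.trunc) (hb : Bdd Z s) :
    Ext Z J K β d f mate s where
  toCtx := h.toCtx.congr hb (by simp [State.trunc]) (fun _ _ => rfl) fun _ => rfl
  mate_eq := h.mate_eq
  mate_le := h.mate_le
  reg14 := h.reg14
  reg15 := h.reg15

theorem bdd_of_trunc (h : Bdd Z s.trunc) (hr : ∀ r, 32 ≤ r → s.reg r ≤ Z)
    (h0 : ∀ r, 40 ≤ r → s.reg r = 0) : Bdd Z s := by
  refine ⟨fun r => ?_, h.mem_le, h0⟩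
  rcases lt_or_ge r 32 with h1 | h1
  · simpa [State.trunc, h1] using h.reg_le r
  · exact hr r h1

include hZ hw in
theorem tri_matchNode (hJ : J.Valid) {d f u : ℕ} {mate : ℕ → ℕ} (h : Ext Z J K β d f mate s)
    (hZN : ∀ x < n * n, J.expo K β (x / n) (x % n) + 4 * J.cutoff K ≤ Z)
    (hd : d < J.cutoff K) (hu : u < n) (h32 : s.reg 32 = u) (h36 : ∀ r, 36 ≤ r → s.reg r = 0)
    (hg : f ≠ 0 → Good J K β d mate u 0) :
    Tri w (forP 36 1 Code.tryMate) (n * (2 ^ rank J.act (t * t) * Z ^ 245 + 5) + 5) s (fun s' =>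
      (∃ mate', Ext Z J K β d f mate' s'.trunc ∧ (f ≠ 0 → Good J K β d mate' (u + 1) 0)) ∧
        ∀ r, 32 ≤ r → s'.reg r = s.reg r) := by
  have hnZ := h.bdd_of
  refine (Tri.forP (one_lt_two_pow_of hZ hw) (by norm_num) (b := n)
    (fun v s' => (∃ mate', Ext Z J K β d f mate' s'.trunc ∧ (f ≠ 0 → Good J K β d mate' u v)) ∧
      ∀ r, 32 ≤ r → r < 36 → s'.reg r = s.reg r) ?_ ?_ ?_ (lt_two_pow_of hw hnZ) h36
    ⟨⟨mate, h.trunc, hg⟩, fun _ _ _ => rfl⟩).mono le_rfl ?_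
  · rintro v s1 s2 ⟨⟨mate', h1, h2⟩, h3⟩ hr hm hc
    refine ⟨⟨mate', ?_, h2⟩, fun r hr1 hr2 => (hr r hr2).trans (h3 r hr1 hr2)⟩
    rwa [State.trunc_congr (fun r hr' => hr r (by omega)) hm hc]
  · rintro v s1 ⟨⟨mate', h1, _⟩, _⟩
    simpa [State.trunc] using h1.reg1
  · rintro v hv s1 ⟨⟨mate', h1, h2⟩, h3⟩ e36 e37 e38 e39
    simp only [Nat.reduceAdd] at e37 e38
    have hb : Bdd Z s1 := by
      refine bdd_of_trunc h1.toBdd (fun r hr => ?_) fun r hr => e39 r (by omega)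
      rcases lt_or_ge r 36 with hr' | hr'
      · rw [h3 r hr hr']; exact h.reg_le r
      · rcases lt_or_ge r 39 with hr'' | hr''
        · interval_cases r <;> omega
        · rw [e39 r (by omega)]; omega
    refine (tri_tryMate hZ hw hJ (h1.of_trunc hb) hZN hd hu hv ((h3 32 le_rfl (by norm_num)).trans h32)
      e36).mono le_rfl ?_
    rintro s2 ⟨h4, h5⟩
    exact ⟨⟨⟨_, h4.trunc, fun hf => (h2 hf).step hv⟩, fun r hr hr' => (h5 r hr).trans (h3 r hr hr')⟩,
      fun r hr => h5 r (by omega)⟩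
  · rintro s1 ⟨⟨⟨mate', h1, h2⟩, h3⟩, h4⟩
    refine ⟨⟨mate', h1, fun hf => (h2 hf).next hu⟩, fun r hr => ?_⟩
    rcases lt_or_ge r 36 with hr' | hr'
    · exact h3 r hr hr'
    · rw [h4 r hr', h36 r hr']

include hZ hw in
theorem tri_matchAll (hJ : J.Valid) {d f : ℕ} {mate : ℕ → ℕ} (h : Ext Z J K β d f mate s)
    (hZN : ∀ x < n * n, J.expo K β (x / n) (x % n) + 4 * J.cutoff K ≤ Z)
    (hd : 0 < n → d < J.cutoff K) (h32 : ∀ r, 32 ≤ r → s.reg r = 0)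
    (hg : f ≠ 0 → Good J K β d mate 0 0) :
    Tri w (forP 32 1 (forP 36 1 Code.tryMate))
      (n * (n * (2 ^ rank J.act (t * t) * Z ^ 245 + 5) + 5 + 5) + 5) s (fun s' =>
      ∃ mate', Ext Z J K β d f mate' s' ∧ (f ≠ 0 → Good J K β d mate' n 0)) := by
  have hnZ := h.bdd_of
  refine (Tri.forP (one_lt_two_pow_of hZ hw) (by norm_num) (b := n)
    (fun u s' => ∃ mate', Ext Z J K β d f mate' s'.trunc ∧ (f ≠ 0 → Good J K β d mate' u 0))
    ?_ ?_ ?_ (lt_two_pow_of hw hnZ) h32 ⟨mate, h.trunc, hg⟩).mono le_rfl ?_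
  · rintro v s1 s2 ⟨mate', h1, h2⟩ hr hm hc
    refine ⟨mate', ?_, h2⟩
    rwa [State.trunc_congr hr hm hc]
  · rintro v s1 ⟨mate', h1, _⟩
    simpa [State.trunc] using h1.reg1
  · rintro u hu s1 ⟨mate', h1, h2⟩ e32 e33 e34 e35
    simp only [Nat.reduceAdd] at e33 e34
    have hb : Bdd Z s1 := by
      refine bdd_of_trunc h1.toBdd (fun r hr => ?_) fun r hr => e35 r (by omega)
      rcases lt_or_ge r 35 with hr'' | hr''
      · interval_cases r <;> omega
      · rw [e35 r (by omega)]; omega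
    exact tri_matchNode hZ hw hJ (h1.of_trunc hb) hZN (hd (by omega)) hu e32
      (fun r hr => e35 r (by omega)) h2
  · rintro s1 ⟨⟨mate', h1, h2⟩, h3⟩
    refine ⟨mate', h1.of_trunc (bdd_of_trunc h1.toBdd (fun r hr => ?_) fun r hr => h3 r (by omega)),
      h2⟩
    rw [h3 r hr]; omega

/-- The value of `Code.firstOdd`: at most one summand is nonzero. -/
theorem sum_firstOdd {q : ℕ → ℕ} (hq : ∀ d, q d ≤ 1) (N : ℕ) :
    (∃ d < N, q d = 1 ∧ ∑ x ∈ range N, x * (q x * if ∑ y ∈ range x, q y = 0 then 1 else 0) = d) ∨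
    (∀ d < N, q d = 0) ∧
      ∑ x ∈ range N, x * (q x * if ∑ y ∈ range x, q y = 0 then 1 else 0) = 0 := by
  induction N with
  | zero => right; simp
  | succ N ih =>
    rw [sum_range_succ]
    rcases ih with ⟨d, hd, h1, h2⟩ | ⟨h1, h2⟩
    · refine .inl ⟨d, by omega, h1, ?_⟩
      have : ∑ y ∈ range N, q y ≠ 0 := fun h => by
        have := sum_eq_zero_iff.1 h d (mem_range.2 hd); omega
      rw [if_neg this, h2]; simp
    · have h3 : ∑ y ∈ range N, q y = 0 := sum_eq_zero fun y hy => h1 y (mem_range.1 hy)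
      rw [h2, if_pos h3]
      rcases Nat.le_one_iff_eq_zero_or_eq_one.1 (hq N) with h | h
      · refine .inr ⟨fun d hd => ?_, by simp [h]⟩
        rcases Nat.lt_succ_iff_lt_or_eq.1 hd with hd | rfl
        · exact h1 d hd
        · exact h
      · exact .inl ⟨N, by omega, h, by simp [h]⟩

theorem cutoff_pos (hn : 0 < n) : 0 < J.cutoff K := by
  rw [CMData.cutoff, CMData.scale]; positivity

include hZ hw in
/-- The verdict and the output are correct if the random weights and an empty matching stand in
memory; a graph without nodes always has a solution. -/
theorem tri_extract (hJ : J.Valid) (h : Ctx Z J K β s)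
    (hmate : ∀ u < n, s.mem (M + 16 * u + 8) = n) (h32 : ∀ r, 32 ≤ r → s.reg r = 0)
    (hZN : ∀ x < n * n, J.expo K β (x / n) (x % n) + 4 * J.cutoff K ≤ Z) :
    Tri w Code.extract (2 ^ rank J.act (t * t) * Z ^ 249) s (fun s' =>
      (s'.reg 0 = 0 → 0 < n ∧ ∀ d < J.cutoff K, Even #(J.solSet K β (fun _ => n) d)) ∧
      (s'.reg 0 ≠ 0 → ∃ σ, J.IsSol σ ∧ ∀ u : Fin n, s'.mem u = σ u)) := by
  have hnZ : n ≤ Z := h.reg1 ▸ h.reg_le 1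
  have hNZ : J.cutoff K ≤ Z := h.reg8 ▸ h.reg_le 8
  set R := 2 ^ rank J.act (t * t) with hR
  have e : ∀ {s : State} {r : ℕ}, r < 40 → (s.reg ∘ regMap 40) r = s.reg r := regMap_eval
  refine (Tri.seq (t := R * Z ^ 244) (u := 4 * Z ^ 243 + (n * (n * (R * Z ^ 245 + 5) + 5 + 5) + 5))
    (tri_parity hZ hw h hJ hmate hZN) ?_).mono ?_ fun _ h => h
  swap
  · have h1 : 1 ≤ R := Nat.one_le_two_pow
    have hp : ∀ a, 1 ≤ Z ^ a := fun a => Nat.one_le_pow _ _ (by omega)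
    obtain ⟨A, hA⟩ : ∃ A, R * Z ^ 244 = A := ⟨_, rfl⟩
    have e2 : R * Z ^ 245 = A * Z := by rw [← hA, pow_succ, mul_assoc]
    have e3 : R * Z ^ 249 = A * Z ^ 5 := by rw [← hA, mul_assoc, ← pow_add]
    have e4 : Z ^ 243 ≤ A := by
      rw [← hA]
      exact (Nat.pow_le_pow_right (by omega) (by norm_num)).trans (Nat.le_mul_of_pos_left _ h1)
    have e5 : 1 ≤ A := (hp _).trans e4
    have e6 : 16 ≤ A * Z := by nlinarith
    have e7 : n * (A * Z + 5) + 5 + 5 ≤ 3 * (A * Z * Z) := by nlinarith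
    have e8 : n * (n * (A * Z + 5) + 5 + 5) ≤ Z * (3 * (A * Z * Z)) := Nat.mul_le_mul hnZ e7
    have e9 : A * Z * Z * Z * 256 ≤ A * Z ^ 5 := by
      have : A * Z ^ 5 = A * Z * Z * Z * (Z * Z) := by ring
      rw [this]; exact Nat.mul_le_mul_left _ (Nat.mul_le_mul hZ hZ)
    have e10 : A ≤ A * Z * Z * Z := by
      rw [mul_assoc, mul_assoc]
      exact Nat.le_mul_of_pos_right _ (by positivity)
    rw [hA, e2, e3]
    have e11 : Z * (3 * (A * Z * Z)) = 3 * (A * Z * Z * Z) := by ring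
    omega
  rintro s1 ⟨f1, p1⟩
  have c1 := f1.ctx h
  have hmate1 : ∀ u < n, s1.mem (M + 16 * u + 8) = n := fun u hu =>
    (f1.tab_eq 8 (by simp) u).trans (hmate u hu)
  set q := partialParity J K β (fun _ => n) R with hq
  have hq1 : ∀ d, q d ≤ 1 := fun d => Nat.lt_succ_iff.1 (Nat.mod_lt _ two_pos)
  have hqn : 0 < n → ∀ d < J.cutoff K, q d = #(J.solSet K β (fun _ => n) d) % 2 := fun hn d hd =>
    partialParity_eq hJ hn _ hd
  obtain ⟨d, hd⟩ : ∃ d, ∑ x ∈ range (J.cutoff K),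
    x * (q x * if ∑ y ∈ range x, q y = 0 then 1 else 0) = d := ⟨_, rfl⟩
  have hfirst := sum_firstOdd hq1 (J.cutoff K)
  rw [hd] at hfirst
  have hdN : 0 < n → d < J.cutoff K := fun hn => by
    rcases hfirst with ⟨d', h1, _, rfl⟩ | ⟨_, rfl⟩
    · exact h1
    · exact cutoff_pos hn
  have hdZ : d ≤ Z := by
    rcases hfirst with ⟨d', h1, _, rfl⟩ | ⟨_, rfl⟩
    · omega
    · omega
  refine (Tri.seq (t := Z ^ 243) (u := 3 * Z ^ 243 + (n * (n * (R * Z ^ 245 + 5) + 5 + 5) + 5))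
    (tri_assign hZ hw f1.toBdd (x := 14) (by norm_num) (e := Code.firstOdd) (by decide) (v := d) ?_
      hdZ) ?_).mono (by omega) fun _ h => h
  · rw [← hd, Code.firstOdd, Exp.eval_bsum, e (by norm_num), c1.reg8]
    refine sum_congr rfl fun x hx => ?_
    have hx := mem_range.1 hx
    have h9 : (s1.reg ∘ regMap 40) 9 = M := (e (by norm_num)).trans c1.reg9
    simp only [Exp.eval_mul, Exp.eval_eq, Exp.eval_bsum, Exp.eval_var, eval_tab,
      Function.update_self, update_fifty, h9, p1 x hx]
    congr 3
    refine congrArg (· = 0) (sum_congr rfl fun y hy => ?_)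
    have hy := mem_range.1 hy
    have : Function.update (Function.update (s1.reg ∘ regMap 40) 50 x) 51 y 9 = M := by simpa using h9
    rw [this, p1 y (by omega)]
  rintro s2 ⟨rfl, b2⟩
  have c2 := c1.setReg (by simp) b2
  obtain ⟨f, hf⟩ : ∃ f, (if 0 < ∑ x ∈ range (J.cutoff K), q x then 1 else 0) = f := ⟨_, rfl⟩
  have hf1 : f ≤ 1 := by rw [← hf]; split <;> omega
  refine (Tri.seq (t := Z ^ 243) (u := 2 * Z ^ 243 + (n * (n * (R * Z ^ 245 + 5) + 5 + 5) + 5))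
    (tri_assign hZ hw b2 (x := 15) (by norm_num) (e := .lt 0 (.bsum 50 8 (tab 5 (.var 50))))
      (by decide) (v := f) ?_ (by omega)) ?_).mono (by omega) fun _ h => h
  · have h9 : ((s1.setReg 14 d).reg ∘ regMap 40) 9 = M := (e (by norm_num)).trans c2.reg9
    rw [← hf, Exp.eval_lt, Exp.eval_ofNat, Exp.eval_bsum, e (by norm_num), c2.reg8]
    have : ∀ x ∈ range (J.cutoff K), (tab 5 (.var 50)).eval (s1.setReg 14 d).mem
        (Function.update ((s1.setReg 14 d).reg ∘ regMap 40) 50 x) = q x := fun x hx => by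
      rw [eval_tab, (update_fifty _ _).2.2.1, h9, Exp.eval_var, Function.update_self]
      exact p1 x (mem_range.1 hx)
    rw [sum_congr rfl this]
  rintro s3 ⟨rfl, b3⟩
  have c3 := c2.setReg (by simp) b3
  have hext : Ext Z J K β d f (fun _ => n) ((s1.setReg 14 d).setReg 15 f) :=
    ⟨c3, hmate1, fun _ _ => le_rfl, by simp, by simp⟩
  refine (Tri.seq (t := n * (n * (R * Z ^ 245 + 5) + 5 + 5) + 5) (u := 2 * Z ^ 243)
    (tri_matchAll hZ hw hJ hext hZN hdN (fun r hr => ?_) fun hf0 => ?_) ?_).mono (by omega)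
    fun _ h => h
  · simp only [State.setReg_reg]
    rw [Function.update_of_ne (by omega), Function.update_of_ne (by omega), f1.reg_eq r (by omega)]
    exact h32 r hr
  · rcases hfirst with ⟨d', h1, h2, rfl⟩ | ⟨h1, _⟩
    · have hn : 0 < n := Nat.pos_of_ne_zero fun hn => by
        subst hn; simp [CMData.cutoff, CMData.scale] at h1
      refine ⟨?_, fun x hx => absurd hx (Nat.not_lt_zero x), fun _ y hy => absurd hy (Nat.not_lt_zero y)⟩
      rw [Nat.odd_iff, ← hqn hn _ h1, h2]
    · rw [sum_eq_zero fun x hx => h1 x (mem_range.1 hx)] at hf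
      exact absurd hf.symm hf0
  rintro s4 ⟨mate, h4, g4⟩
  have r1 := h4.reg1
  refine (Tri.seq (t := Z ^ 243) (u := Z ^ 243) (tri_fill hZ hw h4.toBdd (y := 1) (by norm_num)
    (a := .var 40) (e := tab 8 (.var 40)) (by decide) (by decide) (A := fun x => x) (g := mate)
    (fun i _ j hj => hj.ne) (fun x hx => (h4.mate_le x (by omega)).trans hnZ) ?_) ?_).mono (by omega)
    fun _ h => h
  · intro x hx m _ h2
    have e9 := (eval_regs (s := s4) (x := x) (r := 9) (by norm_num)).trans h4.reg9
    have e40 : (Function.update s4.reg 40 x ∘ regMap 41) 40 = x := by simp [regMap]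
    rw [r1] at hx
    refine ⟨e40, ?_⟩
    rw [eval_tab, e9, Exp.eval_var, e40, h2 _ fun y hy => by rw [tableBase]; omega]
    exact h4.mate_eq x hx
  rintro s5 ⟨m, rfl, h5, -, b5⟩
  refine (tri_assign hZ hw b5 (x := 0) (by norm_num) (e := .var 15 + .eq (.var 1) 0) (by decide)
    (v := f + if n = 0 then 1 else 0) ?_ (by split <;> omega)).mono le_rfl ?_
  · rw [Exp.eval_add, Exp.eval_eq, Exp.eval_var, Exp.eval_var, e (by norm_num), e (by norm_num)]
    simp only [h4.reg15, r1]; rfl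
  rintro s6 ⟨rfl, -⟩
  simp only [State.setReg_reg, Function.update_self, State.setReg_mem]
  refine ⟨fun h0 => ?_, fun h0 => ?_⟩
  · have hn : n ≠ 0 := fun hn => by simp [hn] at h0
    refine ⟨by omega, fun x hx => ?_⟩
    rw [Nat.even_iff, ← hqn (by omega) x hx]
    have hf0 : f = 0 := by omega
    rw [hf0] at hf
    have : ∑ x ∈ range (J.cutoff K), q x = 0 := by
      by_contra h1
      rw [if_pos (by omega)] at hf
      omega
    exact sum_eq_zero_iff.1 this x (mem_range.2 hx)
  · rcases Nat.eq_zero_or_pos n with rfl | hn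
    · have ht : t = 0 := by have := hJ.t_le; omega
      subst ht
      exact ⟨1, ⟨rfl, fun u => u.elim0, by simp, fun p hp => by omega⟩, fun u => u.elim0⟩
    · have g := g4 (by rw [if_neg (by omega)] at h0; omega)
      obtain ⟨σ, hσ⟩ := card_pos.1 g.odd.pos
      simp only [CMData.solSet, mem_filter, mem_univ, true_and] at hσ
      refine ⟨σ, hσ.1, fun u => ?_⟩
      rw [h5 u (by rw [r1]; exact u.2)]
      exact (hσ.2.2 u).resolve_left (g.matched u u.2)

end

end WordRAM

/-! ### Reading the input and drawing the random weights -/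

namespace WordRAM

namespace Code

/-- Replace all entries of the weight matrix above `L + 1` by `0`, and also the common denominator in cell
2, which is not needed; then all words are small. -/
def readInput : Prog :=
  .seq (assignP 40 1 (.load (.const 0)))
  (.seq (assignP 40 3 (.load (.const 3)))
  (.seq (assignP 40 18 (.op .add (.const 4) (.var 1)))
  (.seq (assignP 40 4 (.op .mul (.var 1) (.var 1)))
  (.seq (assignP 40 22 (.op .add (.var 3) (.const 2)))
  (.seq (storeP 40 40 (.const 2) (.const 0))
  (fillP 40 4 (.op .add (.var 18) (.var 40)) (.op .mul (.load (.op .add (.var 18) (.var 40)))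
    (.op .lt (.load (.op .add (.var 18) (.var 40))) (.var 22)))))))))

/-- Compute `n ^ 2 * (n + L) ^ c` in register 5. -/
def power : ℕ → Prog
  | 0 => assignP 40 5 (.var 4)
  | c + 1 => .seq (power c) (assignP 40 5 (.var 5 * .var 23))

/-- The powers of two. -/
def twoPow : Exp := .eq (.var 40) 0 + .lt 0 (.var 40) * (2 * tab 1 (.var 40 - 1))

/-- See `CMData.rnd`. -/
def rnd (q : Exp) : Exp := .bsum 50 6 (tab 0 (q * .var 6 + .var 50) * tab 1 (.var 50))

/-- See `CMData.expo`. -/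
def expo : Exp :=
  .eq (.load (.var 18 + .var 40)) 0 * .var 8 + .lt 0 (.load (.var 18 + .var 40)) *
    (.var 20 * (.load (.var 18 + .var 40) - 1) +
      (rnd (.var 40) + rnd (.var 40 % .var 1 * .var 1 + .var 40 / .var 1)))

/-- Flip the coins into table 0. -/
def flips : Prog := forP 40 12 (flipP 41 43 (tabA 0 (.var 40)))

/-- Prepare the registers and tables for `extract`. Afterwards register 1 holds `n`, 2 holds `t`, 3
holds `L`, 4 holds `n ^ 2`, 6 the number `K` of random bits per pair, 8 the cutoff, 9 the start of
the tables, 10 the size of table 4, 11 holds `t ^ 2`, 12 the number of coins, 18 and 19 the starts of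
the weight matrix and the pattern matrix, 20 the scale. Registers from 32 on belong to the outer
loops, those from 40 on are scratch space. -/
def setup (c : ℕ) : Prog :=
  .seq (assignP 40 2 (.load 1))
  (.seq (assignP 40 11 (.var 2 * .var 2))
  (.seq (assignP 40 19 (.var 18 + .var 4))
  (.seq (assignP 40 9 (.var 19 + .var 11))
  (.seq (assignP 40 23 (.var 1 + .var 3))
  (.seq (power c)
  (.seq (assignP 40 6 (.bsum 50 5 (.lt 0 (.op .shr (.var 5) (.var 50)))))
  (.seq (assignP 40 17 (.var 6 + 1))
  (.seq (fillT 1 17 twoPow)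
  (.seq (assignP 40 20 (2 * .var 1 * tab 1 (.var 6)))
  (.seq (assignP 40 8 (.var 20 * (2 * .var 3 + 1)))
  (.seq (assignP 40 10 (.var 1 * .var 1 * .var 1 * .var 8))
  (.seq (assignP 40 12 (.var 4 * .var 6))
  (.seq flips
  (.seq (fillT 2 4 expo) (fillT 8 1 (.var 1))))))))))))))))

end Code

/-- The register contents given by a list of registers and values; the other registers are zero. -/
def regsOf : List (ℕ × ℕ) → ℕ → ℕ
  | [] => fun _ => 0
  | p :: l => Function.update (regsOf l) p.1 p.2

/-- The list mentions only registers below 40 and values up to `Z`. -/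
def RegsLe (Z : ℕ) (l : List (ℕ × ℕ)) : Prop := ∀ p ∈ l, p.1 < 40 ∧ p.2 ≤ Z

theorem RegsLe.bdd {Z : ℕ} {l : List (ℕ × ℕ)} (h : RegsLe Z l) {m : ℕ → ℕ} (hm : ∀ a, m a ≤ Z)
    (ρ : ℕ → Bool) : Bdd Z ⟨regsOf l, m, ρ⟩ := by
  suffices (∀ r, regsOf l r ≤ Z) ∧ ∀ r, 40 ≤ r → regsOf l r = 0 from ⟨this.1, hm, this.2⟩
  induction l with
  | nil => exact ⟨fun _ => Nat.zero_le _, fun _ _ => rfl⟩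
  | cons p l ih =>
    have hp := h p (by simp)
    have ih := ih fun q hq => h q (by simp [hq])
    refine ⟨fun r => ?_, fun r hr => ?_⟩
    · rw [regsOf, Function.update_apply]; split
      · exact hp.2
      · exact ih.1 r
    · rw [regsOf, Function.update_of_ne (by omega)]; exact ih.2 r hr

theorem RegsLe.cons {Z : ℕ} {l : List (ℕ × ℕ)} (h : RegsLe Z l) {x v : ℕ} (hx : x < 40)
    (hv : v ≤ Z) : RegsLe Z ((x, v) :: l) := by
  rintro p (_ | ⟨_, hp⟩)
  · exact ⟨hx, hv⟩
  · exact h p hp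

section

variable {w Z : ℕ} {l : List (ℕ × ℕ)} {m : ℕ → ℕ} {ρ : ℕ → Bool}

/-- An assignment before all words are known to be small. -/
theorem tri_raw (hw : 1 < 2 ^ w) (h0 : ∀ r, 40 ≤ r → regsOf l r = 0) {x : ℕ} (hx : x < 40)
    {e : Exp} {v T : ℕ} (he : e.Safe w m (regsOf l ∘ regMap 40))
    (hv : e.eval m (regsOf l ∘ regMap 40) = v) (hvw : v < 2 ^ w)
    (ht : e.time (regsOf l ∘ regMap 40) + 2 = T) {p : Prog} {u : ℕ} {Q : State → Prop}
    (h : (∀ r, 40 ≤ r → regsOf ((x, v) :: l) r = 0) →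
      Tri w p u ⟨regsOf ((x, v) :: l), m, ρ⟩ Q) :
    Tri w (.seq (assignP 40 x e) p) (T + u) ⟨regsOf l, m, ρ⟩ Q := by
  subst hv ht
  refine Tri.seq (Tri.of_runs (assignP_runs hw hx h0 he hvw) rfl) ?_
  rintro _ rfl
  refine h fun r hr => ?_
  rw [regsOf, Function.update_of_ne (by dsimp only; omega)]; exact h0 r hr

variable (hZ : 16 ≤ Z) (hw : Z ^ 240 < 2 ^ w)

include hZ hw in
theorem tri_set (hl : RegsLe Z l) (hm : ∀ a, m a ≤ Z) {x : ℕ} (hx : x < 40) {e : Exp}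
    (he : e.Small) (v : ℕ) (hv : e.eval m (regsOf l ∘ regMap 40) = v) (hvZ : v ≤ Z) {p : Prog}
    {u : ℕ} {Q : State → Prop}
    (h : RegsLe Z ((x, v) :: l) → Tri w p (u * Z ^ 243) ⟨regsOf ((x, v) :: l), m, ρ⟩ Q) :
    Tri w (.seq (assignP 40 x e) p) ((u + 1) * Z ^ 243) ⟨regsOf l, m, ρ⟩ Q := by
  rw [Nat.succ_mul, Nat.add_comm]
  refine Tri.seq (tri_assign hZ hw (hl.bdd hm ρ) hx he hv hvZ) ?_
  rintro _ ⟨rfl, -⟩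
  exact h (hl.cons hx hvZ)

include hZ hw in
theorem tri_power (hl : RegsLe Z l) (hm : ∀ a, m a ≤ Z) {a b : ℕ} (h4 : regsOf l 4 = a)
    (h23 : regsOf l 23 = b) (c : ℕ) (hc : ∀ i ≤ c, a * b ^ i ≤ Z) :
    Tri w (Code.power c) ((c + 1) * Z ^ 243) ⟨regsOf l, m, ρ⟩
      (fun s' => s' = ⟨regsOf ((5, a * b ^ c) :: l), m, ρ⟩) := by
  induction c with
  | zero =>
    refine (tri_assign hZ hw (hl.bdd hm ρ) (by norm_num) (e := .var 4) (by decide)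
      (v := a * b ^ 0) ?_ (hc 0 le_rfl)).mono (by omega) fun _ h => h.1
    simp [regMap, h4]
  | succ c ih =>
    rw [Nat.succ_mul (c + 1)]
    refine Tri.seq (ih fun i hi => hc i (by omega)) ?_
    rintro _ rfl
    refine (tri_assign hZ hw ((hl.cons (by norm_num) (hc c (by omega))).bdd hm ρ) (by norm_num)
      (e := .var 5 * .var 23) (by decide) (v := a * b ^ (c + 1)) ?_ (hc _ le_rfl)).mono le_rfl ?_
    · simp [regMap, regsOf, h23, pow_succ, mul_assoc]
    · rintro _ ⟨rfl, -⟩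
      simp [State.setReg, regsOf]

include hZ hw in
theorem tri_flips {s : State} (hs : Bdd Z s) {M : ℕ} (hM : s.reg 9 = M) :
    Tri w Code.flips (Z ^ 243) s (fun s' => s'.reg = s.reg ∧
      Upd M 0 (s.reg 12) (fun x => (s.coins x).toNat) s.mem s'.mem ∧ Bdd Z s') := by
  have hb := hs.reg_le 12
  refine (Tri.forP (one_lt_two_pow_of hZ hw) (by norm_num) (b := s.reg 12) (t := Z ^ 240 + 4)
    (fun i s' => (∀ r < 40, s'.reg r = s.reg r) ∧ s'.coins = (fun j => s.coins (i + j)) ∧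
      Upd M 0 i (fun x => (s.coins x).toNat) s.mem s'.mem ∧ ∀ a, s'.mem a ≤ Z) ?_ ?_ ?_
    (lt_two_pow_of hw hb) hs.high ?_).mono ?_ ?_
  · rintro i s1 s2 ⟨h1, h2, h3, h4⟩ hr hm hc
    exact ⟨fun r hr' => (hr r hr').trans (h1 r hr'), hc.trans h2, hm ▸ h3, hm ▸ h4⟩
  · rintro i s1 ⟨h1, _⟩; exact h1 12 (by norm_num)
  · rintro i hi s1 ⟨h1, h2, h3, h4⟩ e40 e41 e42 e43
    have hv : ∀ x, (s1.reg ∘ regMap 41) x ≤ Z := by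
      intro x
      have := regMap_lt (k := 41) (by norm_num) x
      simp only [Function.comp]
      rcases Nat.lt_succ_iff_lt_or_eq.1 this with h | h
      · rw [h1 _ h]; exact hs.reg_le _
      · rw [h, e40]; omega
    obtain ⟨a1, a2⟩ := small_spec hZ hw (e := tabA 0 (.var 40)) (by decide) h4 hv
    have ea : (tabA 0 (.var 40)).eval s1.mem (s1.reg ∘ regMap 41) = M + 16 * i + 0 := by
      simp [regMap, h1 9 (by norm_num), hM, e40]
    have := flipP_runs (one_lt_two_pow_of hZ hw) (l := 41) (k := 43) (by norm_num) (by norm_num)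
      (s := s1) e43 a1
    rw [ea] at this
    refine (Tri.of_runs this ⟨⟨h1, ?_, ⟨fun x hx => ?_, fun x hx => ?_, fun x j hj hj0 => ?_,
      fun c hc => ?_⟩, fun a => ?_⟩, fun _ _ => rfl⟩).mono (by omega) fun _ h => h
    · funext j
      simp only [h2]; congr 1; ring
    · simp only [State.setMem, Function.update_apply]
      by_cases hxi : x = i
      · subst hxi; simp [h2]
      · rw [if_neg (by omega)]; exact h3.new x (by omega)
    · simp only [State.setMem]
      rw [Function.update_of_ne (by omega)]; exact h3.old x (by omega)
    · simp only [State.setMem]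
      rw [Function.update_of_ne (by omega)]; exact h3.other x j hj hj0
    · simp only [State.setMem]
      rw [Function.update_of_ne (by omega)]; exact h3.low c hc
    · simp only [State.setMem, Function.update_apply]
      split
      · exact (Bool.toNat_le _).trans (by omega)
      · exact h4 a
  · exact ⟨fun _ _ => rfl, by simp, ⟨by simp, fun _ _ => rfl, fun _ _ _ _ => rfl, fun _ _ => rfl⟩,
      hs.mem_le⟩
  · have h2 : 1 ≤ Z ^ 240 := Nat.one_le_pow _ _ (by omega)
    have h3 : Z ^ 240 + 4 + 5 ≤ Z ^ 241 := by rw [pow_succ]; nlinarith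
    have h4 : s.reg 12 * (Z ^ 240 + 4 + 5) ≤ Z * Z ^ 241 := Nat.mul_le_mul hb h3
    refine (pow_add_le hZ 242 ?_)
    have : Z ^ 242 = Z * Z ^ 241 := by rw [pow_succ, mul_comm]
    omega
  · rintro s' ⟨⟨h1, h2, h3, h4⟩, h5⟩
    have hr : s'.reg = s.reg := by
      funext r
      rcases lt_or_ge r 40 with hr | hr
      · exact h1 r hr
      · rw [h5 r hr, hs.high r hr]
    exact ⟨hr, h3, by rw [hr]; exact hs.reg_le, h4, by rw [hr]; exact hs.high⟩

theorem sum_shiftRight (T : ℕ) : ∑ i ∈ range T, (if 0 < T >>> i then 1 else 0) = T.size := by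
  have h1 : ∀ i, 0 < T >>> i ↔ i < T.size := fun i => by
    rw [Nat.shiftRight_eq_div_pow, Nat.lt_size, Nat.div_pos_iff]
    exact ⟨fun h => h.2, fun h => ⟨Nat.two_pow_pos i, h⟩⟩
  have h2 : T.size ≤ T := Nat.size_le.2 Nat.lt_two_pow_self
  simp only [h1, sum_boole, Nat.cast_id]
  rw [show (range T).filter (fun i => i < T.size) = range T.size from by ext; simp; omega,
    card_range]

theorem two_pow_size_le (T : ℕ) : 2 ^ T.size ≤ 2 * T + 1 := by
  rcases Nat.eq_zero_or_pos T with rfl | hT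
  · simp
  · obtain ⟨k, hk⟩ := Nat.exists_eq_add_of_lt (Nat.size_pos.2 hT)
    have : 2 ^ k ≤ T := Nat.lt_size.1 (by omega)
    rw [hk, zero_add, pow_succ]; omega

include hZ hw in
theorem tri_tab (hl : RegsLe Z l) (hm : ∀ a, m a ≤ Z) {M : ℕ} (hM : regsOf l 9 = M) {i : ℕ}
    {y : ℕ} (hi : i < 16) (hy : y < 40) {b : ℕ} (hb : regsOf l y = b) {e : Exp} (he : e.Small)
    (g : ℕ → ℕ) (hg : ∀ x < b, g x ≤ Z)
    (h : ∀ x < b, ∀ m' : ℕ → ℕ, Upd M i x g m m' →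
      e.eval m' (Function.update (regsOf l) 40 x ∘ regMap 41) = g x) {p : Prog}
    {u : ℕ} {Q : State → Prop}
    (hp : ∀ m', Upd M i b g m m' → (∀ a, m' a ≤ Z) → Tri w p (u * Z ^ 243) ⟨regsOf l, m', ρ⟩ Q) :
    Tri w (.seq (fillT i y e) p) ((u + 1) * Z ^ 243) ⟨regsOf l, m, ρ⟩ Q := by
  subst hb
  rw [Nat.succ_mul, Nat.add_comm]
  refine Tri.seq (tri_table hZ hw (hl.bdd hm ρ) hM i hi hy he g hg h) ?_
  rintro ⟨r, m', ρ'⟩ ⟨h1, h2, h3, h4⟩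
  simp only at h1 h2
  subst h1 h2
  exact hp m' h3 h4.mem_le

/-- The memory holds the data `J`. -/
structure Input {n t : ℕ} (J : CMData n t) (m : ℕ → ℕ) : Prop where
  parts : m 1 = t
  part : ∀ v < n, m (4 + v) = J.pf v
  weight : ∀ x < n * n, m (4 + n + x) = J.wt x
  pattern : ∀ p < t * t, m (4 + n + n * n + p) = J.hm p

theorem two_pow_table {x : ℕ} {g : ℕ → ℕ} {M : ℕ} {m' : ℕ → ℕ}
    (h : Upd M 1 x (fun x => 2 ^ x) g m') :
    (if x = 0 then 1 else 0) + (if 0 < x then 1 else 0) * (2 * m' (M + 16 * (x - 1) + 1)) =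
      2 ^ x := by
  cases x with
  | zero => simp
  | succ x => rw [Nat.add_sub_cancel, h.new x (by omega)]; simp [pow_succ, mul_comm]

include hZ hw in
/-- The data in memory are turned into exponents, with the coin flips `ρ` as random bits. -/
theorem tri_setup {n t : ℕ} {J : CMData n t} (c : ℕ) {K : ℕ}
    (hK : K = (n * n * (n + J.L) ^ c).size) (hin : Input J m) (hm : ∀ a, m a ≤ Z)
    (hl : RegsLe Z [(22, J.L + 2), (4, n * n), (18, 4 + n), (3, J.L), (1, n)])
    (hT : ∀ i ≤ c, n * n * (n + J.L) ^ i ≤ Z) (hKZ : 2 ^ K ≤ Z) (hMZ : tableBase n t ≤ Z)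
    (hLZ : n + J.L ≤ Z) (hsc : CMData.scale n K ≤ Z) (hcut : J.cutoff K ≤ Z)
    (hvol : n * n * n * J.cutoff K ≤ Z) (hco : n * n * K ≤ Z)
    (hex : ∀ x < n * n, J.expo K ρ (x / n) (x % n) ≤ Z) :
    Tri w (Code.setup c) ((c + 16) * Z ^ 243)
      ⟨regsOf [(22, J.L + 2), (4, n * n), (18, 4 + n), (3, J.L), (1, n)], m, ρ⟩
      (fun s' => Ctx Z J K ρ s' ∧ (∀ u < n, s'.mem (tableBase n t + 16 * u + 8) = n) ∧
        ∀ r, 32 ≤ r → s'.reg r = 0) := by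
  have hKlt : K < 2 ^ K := Nat.lt_two_pow_self
  have htt : t ≤ t * t := Nat.le_mul_self t
  have hMZ' := hMZ
  rw [tableBase] at hMZ'
  refine tri_set hZ hw hl hm (by norm_num) (by decide) t (by simp [hin.parts]) (by omega)
    fun hl => ?_
  refine tri_set hZ hw hl hm (by norm_num) (by decide) (t * t) (by simp [regMap, regsOf]) (by omega)
    fun hl => ?_
  refine tri_set hZ hw hl hm (by norm_num) (by decide) (4 + n + n * n) (by simp [regMap, regsOf])
    (by omega) fun hl => ?_
  refine tri_set hZ hw hl hm (by norm_num) (by decide) (tableBase n t)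
    (by simp [regMap, regsOf, tableBase]) hMZ fun hl => ?_
  refine tri_set hZ hw hl hm (by norm_num) (by decide) (n + J.L) (by simp [regMap, regsOf]) hLZ
    fun hl => ?_
  refine (Tri.seq (t := (c + 1) * Z ^ 243) (u := 10 * Z ^ 243) (tri_power hZ hw hl hm
    (a := n * n) (b := n + J.L) (by simp [regsOf]) (by simp [regsOf]) c hT) ?_).mono
    (by rw [← add_mul]) fun _ h => h
  rintro _ rfl
  replace hl := hl.cons (x := 5) (by norm_num) (hT c le_rfl)
  refine tri_set hZ hw hl hm (by norm_num) (by decide) K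
    (by rw [hK, ← sum_shiftRight]; simp [regMap, regsOf]) (by omega) fun hl => ?_
  refine tri_set hZ hw hl hm (by norm_num) (by decide) (K + 1) (by simp [regMap, regsOf])
    (by omega) fun hl => ?_
  refine tri_tab hZ hw hl hm (M := tableBase n t) (by simp [regsOf]) (by norm_num) (by norm_num)
    (b := K + 1) (by simp [regsOf]) (by decide) (fun x => 2 ^ x)
    (fun x hx => (Nat.pow_le_pow_right two_pos (by omega)).trans hKZ)
    (fun x hx m' hm' => ?_) fun m1 u1 hm1 => ?_
  · rw [← two_pow_table hm']; simp [Code.twoPow, regMap, regsOf]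
  refine tri_set hZ hw hl hm1 (by norm_num) (by decide) (CMData.scale n K)
    (by simp [regMap, regsOf, u1.new, CMData.scale]) hsc fun hl => ?_
  refine tri_set hZ hw hl hm1 (by norm_num) (by decide) (J.cutoff K)
    (by simp [regMap, regsOf, CMData.cutoff]) hcut fun hl => ?_
  refine tri_set hZ hw hl hm1 (by norm_num) (by decide) (n * n * n * J.cutoff K)
    (by simp [regMap, regsOf]) hvol fun hl => ?_
  refine tri_set hZ hw hl hm1 (by norm_num) (by decide) (n * n * K)
    (by simp [regMap, regsOf]) hco fun hl => ?_
  refine (Tri.seq (t := Z ^ 243) (u := 2 * Z ^ 243) (tri_flips hZ hw (hl.bdd hm1 ρ)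
    (M := tableBase n t) (by simp [regsOf])) ?_).mono (by omega) fun _ h => h
  rintro ⟨r, m2, ρ'⟩ ⟨h2, u2, b2⟩
  simp only at h2 u2
  subst h2
  have hm2 := b2.mem_le
  simp only at hm2
  have low2 : ∀ c < tableBase n t, m2 c = m c := fun c hc => (u2.low c hc).trans (u1.low c hc)
  have hcoins : ∀ x < n * n * K, m2 (tableBase n t + 16 * x) = (ρ x).toNat := fun x hx =>
    u2.new x (by simpa [regsOf] using hx)
  have hpow : ∀ x < K, m2 (tableBase n t + 16 * x + 1) = 2 ^ x := fun x hx =>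
    (u2.other x 1 (by norm_num) (by norm_num)).trans (u1.new x (by omega))
  refine tri_tab hZ hw hl hm2 (M := tableBase n t) (by simp [regsOf]) (by norm_num) (by norm_num)
    (b := n * n) (by simp [regsOf]) (by decide) (fun x => J.expo K ρ (x / n) (x % n)) hex
    (fun x hx m' hm' => ?_) fun m3 u3 hm3 => ?_
  · obtain ⟨h1, h2⟩ := div_mod_lt hx
    have hwt : m' (4 + n + x) = J.wt x := by
      rw [hm'.low _ (by rw [tableBase]; omega), low2 _ (by rw [tableBase]; omega), hin.weight x hx]
    have hrnd : ∀ q < n * n, ∑ b ∈ range K, m' (tableBase n t + 16 * (q * K + b)) *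
        m' (tableBase n t + 16 * b + 1) = CMData.rnd K ρ q := by
      intro q hq
      refine sum_congr rfl fun b hb => ?_
      have hb := mem_range.1 hb
      have hlt : q * K + b < n * n * K := by
        have := Nat.mul_le_mul_right K (Nat.succ_le_of_lt hq)
        rw [Nat.succ_mul] at this; omega
      have h0 := hm'.other (q * K + b) 0 (by norm_num) (by norm_num)
      rw [add_zero] at h0
      rw [h0, hm'.other b 1 (by norm_num) (by norm_num), hcoins _ hlt, hpow b hb]
    have hx1 : x / n * n + x % n = x := Nat.div_add_mod' x n
    have hx2 : x % n * n + x / n < n * n := by nlinarith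
    rw [CMData.expo, hx1, ← hrnd x hx, ← hrnd _ hx2]
    simp [Code.expo, Code.rnd, regMap, regsOf, hwt]
    by_cases h0 : J.wt x = 0
    · simp [h0]
    · simp [h0, Nat.pos_of_ne_zero h0]
  refine (tri_table hZ hw (hl.bdd hm3 ρ') (M := tableBase n t) (by simp [regsOf]) 8 (y := 1)
    (by norm_num) (by norm_num) (e := .var 1) (by decide) (fun _ => n)
    (fun _ _ => by omega) fun x hx m' hm' => by simp [regMap, regsOf]).mono (by omega) ?_
  rintro ⟨r, m4, ρ''⟩ ⟨h4, -, u4, b4⟩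
  simp only at h4 u4
  subst h4
  have low4 : ∀ c < tableBase n t, m4 c = m c := fun c hc =>
    (u4.low c hc).trans ((u3.low c hc).trans (low2 c hc))
  refine ⟨⟨b4, ?_, ?_, ?_, ?_, ?_, ?_, ?_, ?_, fun v hv => ?_, fun p hp => ?_, fun x hx => ?_⟩,
    fun u hu => u4.new u (by simpa [regsOf] using hu), fun r hr => ?_⟩
  iterate 8 simp [regsOf]
  · exact (low4 _ (by rw [tableBase]; omega)).trans (hin.part v hv)
  · exact (low4 _ (by rw [tableBase]; omega)).trans (hin.pattern p hp)
  · exact (u4.other x 2 (by norm_num) (by norm_num)).trans (u3.new x hx)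
  · simp only [regsOf]
    iterate 17 rw [Function.update_of_ne (by omega)]

end

end WordRAM

/-! ### The algorithm -/

namespace WordRAM

/-- The whole algorithm; the exponent `c` determines the number of random bits. -/
def Code.solve (c : ℕ) : Prog := .seq readInput (.seq (setup c) extract)

/-- The words `inp` encode the data `J`. -/
structure Encodes {n t : ℕ} (J : CMData n t) (inp : ℕ → ℕ) : Prop where
  nodes : inp 0 = n
  parts : inp 1 = t
  bound : inp 3 = J.L
  part : ∀ v < n, J.pf v = inp (4 + v)
  weight : ∀ x < n * n, J.wt x = if inp (4 + n + x) < J.L + 2 then inp (4 + n + x) else 0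
  pattern : ∀ p < t * t, J.hm p = inp (4 + n + n * n + p)
  rest : ∀ a, tableBase n t ≤ a → inp a = 0

theorem encodes_data (I : CMInstance) (D : ℕ) :
    Encodes (I.data D) fun a => (I.encode D).getD a 0 where
  nodes := (I.encode_head D).1
  parts := (I.encode_head D).2.1
  bound := (I.encode_head D).2.2
  part _ _ := rfl
  weight _ _ := rfl
  pattern _ hp := if_pos hp
  rest _ ha := List.getD_eq_default _ _ (by rwa [I.encode_length])

theorem getD_lt {l : List ℕ} {b : ℕ} (hb : 0 < b) (h : ∀ x ∈ l, x < b) (a : ℕ) :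
    l.getD a 0 < b := by
  rcases lt_or_ge a l.length with ha | ha
  · rw [List.getD_eq_getElem _ _ ha]; exact h _ (List.getElem_mem ha)
  · rwa [List.getD_eq_default _ _ ha]

/-- The input words may be as large as `2 ^ w`; afterwards all words are at most `Z`. -/
theorem tri_readInput {n t : ℕ} {J : CMData n t} (hJ : J.Valid) {inp : ℕ → ℕ}
    (hin : Encodes J inp) {w Z : ℕ} (hlt : ∀ a, inp a < 2 ^ w) (hZw : Z < 2 ^ w)
    (hMZ : tableBase n t ≤ Z) (hLZ : n + J.L + 2 ≤ Z) (ρ : ℕ → Bool) :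
    Tri w Code.readInput (n * n * 27 + 36) ⟨regsOf [], inp, ρ⟩ (fun s' =>
      ∃ m, s' = ⟨regsOf [(22, J.L + 2), (4, n * n), (18, 4 + n), (3, J.L), (1, n)], m, ρ⟩ ∧
        Input J m ∧ ∀ a, m a ≤ Z) := by
  have hM := hMZ
  rw [tableBase] at hM
  have hw1 : 1 < 2 ^ w := by omega
  have hw4 : 4 < 2 ^ w := by omega
  have e0 := hin.nodes
  have e3 := hin.bound
  refine (tri_raw (T := 4) (u := 4 + (6 + (6 + (6 + (5 + (n * n * 27 + 5)))))) hw1 (fun _ _ => rfl)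
    (by norm_num) (v := n) ?_ ?_ (by omega) rfl fun h0 => ?_).mono (by omega) fun _ h => h
  · simp [Exp.Safe]
  · simp [e0]
  refine tri_raw (T := 4) hw1 h0 (by norm_num) (v := J.L) ?_ ?_ (by omega) rfl fun h0 => ?_
  · simp [Exp.Safe]; omega
  · simp [e3]
  refine tri_raw (T := 6) hw1 h0 (by norm_num) (v := 4 + n) ?_ ?_ (by omega) rfl fun h0 => ?_
  · simp [Exp.Safe, Op.eval, regMap, regsOf]; omega
  · simp [Exp.eval, Op.eval, regMap, regsOf]
  refine tri_raw (T := 6) hw1 h0 (by norm_num) (v := n * n) ?_ ?_ (by omega) rfl fun h0 => ?_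
  · simp [Exp.Safe, Op.eval, regMap, regsOf]; omega
  · simp [Exp.eval, Op.eval, regMap, regsOf]
  refine tri_raw (T := 6) hw1 h0 (by norm_num) (v := J.L + 2) ?_ ?_ (by omega) rfl fun h0 => ?_
  · simp [Exp.Safe, Op.eval, regMap, regsOf]; omega
  · simp [Exp.eval, Op.eval, regMap, regsOf]
  refine Tri.seq (Q := fun s' => s'.reg = regsOf [(22, J.L + 2), (4, n * n), (18, 4 + n), (3, J.L),
      (1, n)] ∧ s'.coins = ρ ∧ ∀ a, s'.mem a = if a = 2 then 0 else inp a)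
    (Tri.of_runs (storeP_runs hw1 (by norm_num) le_rfl h0 (by simp [Exp.Safe]; omega)
      (by simp [Exp.Safe])) ⟨rfl, rfl, fun a => by simp [State.setMem, Function.update_apply]⟩) ?_
  rintro ⟨r, m₀, ρ'⟩ ⟨hr, hρ, hmem⟩
  simp only at hr hρ hmem
  subst hr hρ
  have e1 : ∀ x, (Function.update (regsOf [(22, J.L + 2), (4, n * n), (18, 4 + n), (3, J.L),
      (1, n)]) 40 x ∘ regMap 41) 18 = 4 + n := fun x => by simp [regMap, regsOf]
  have e2 : ∀ x, (Function.update (regsOf [(22, J.L + 2), (4, n * n), (18, 4 + n), (3, J.L),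
      (1, n)]) 40 x ∘ regMap 41) 22 = J.L + 2 := fun x => by simp [regMap, regsOf]
  have e40 : ∀ (f : ℕ → ℕ) (x : ℕ), (Function.update f 40 x ∘ regMap 41) 40 = x := fun f x => by
    simp [regMap]
  have r4 : regsOf [(22, J.L + 2), (4, n * n), (18, 4 + n), (3, J.L), (1, n)] 4 = n * n := by
    simp [regsOf]
  generalize hl : regsOf [(22, J.L + 2), (4, n * n), (18, 4 + n), (3, J.L), (1, n)] = f at *
  refine (Tri.fillP hw1 (k := 40) (y := 4) (s := ⟨f, m₀, ρ'⟩) (by norm_num) (t := 19) (g := J.wt)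
    (A := fun x => 4 + n + x) (fun i _ j hj => by omega) (by dsimp only; omega) h0 ?_).mono
    (by dsimp only; omega) ?_
  · intro x hx m h1 h2
    simp only [r4] at hx h2
    have e3 : m (4 + n + x) = inp (4 + n + x) := by
      rw [h2 _ fun y hy => by omega, hmem, if_neg (by omega)]
    have e5 := hlt (4 + n + x)
    simp only [Exp.Safe, Exp.eval, Op.eval, Exp.time, e1, e2, e3, e40, Nat.reduceAdd]
    refine ⟨⟨by omega, by omega, by omega⟩, ⟨⟨by omega, by omega, by omega⟩,
      ⟨⟨by omega, by omega, by omega⟩, by omega, by split <;> omega⟩, by split <;> omega⟩,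
      le_rfl, trivial, ?_⟩
    rw [hin.weight x hx]; split <;> simp
  · rintro s2 ⟨m, rfl, h1, h2⟩
    simp only [r4] at h1 h2
    have h3 : ∀ c, c < 4 + n ∨ 4 + n + n * n ≤ c → c ≠ 2 → m c = inp c := fun c hc hc2 => by
      rw [h2 c fun x hx => by omega, hmem, if_neg hc2]
    refine ⟨m, rfl, ⟨?_, fun v hv => ?_, h1, fun p hp => ?_⟩, fun a => ?_⟩
    · rw [h3 1 (by omega) (by norm_num), hin.parts]
    · rw [h3 _ (by omega) (by omega), hin.part v hv]
    · rw [h3 _ (by omega) (by omega), hin.pattern p hp]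
    · have ht := hJ.t_le
      by_cases ha2 : a = 2
      · rw [h2 a fun x hx => by omega, hmem, if_pos ha2]; omega
      rcases lt_or_ge a 4 with ha | ha
      · rw [h3 a (by omega) ha2]
        interval_cases a
        · omega
        · rw [hin.parts]; omega
        · omega
        · omega
      rcases lt_or_ge a (4 + n) with ha' | ha'
      · obtain ⟨v, rfl⟩ := Nat.exists_eq_add_of_le ha
        rw [h3 _ (by omega) ha2, ← hin.part v (by omega)]
        have := hJ.pf_lt v (by omega)
        omega
      rcases lt_or_ge a (4 + n + n * n) with ha'' | ha''
      · obtain ⟨x, rfl⟩ := Nat.exists_eq_add_of_le ha'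
        have := h1 x (by omega)
        have h4 := hJ.wt_le x
        omega
      rw [h3 a (by omega) ha2]
      rcases lt_or_ge a (tableBase n t) with hb | hb
      · obtain ⟨p, rfl⟩ := Nat.exists_eq_add_of_le ha''
        rw [tableBase] at hb
        rw [← hin.pattern p (by omega)]
        have := hJ.hm_le p
        omega
      · rw [hin.rest a hb]; omega

theorem expo_le {n t : ℕ} {J : CMData n t} (hJ : J.Valid) (K : ℕ) (β : ℕ → Bool) (a b : ℕ) :
    J.expo K β a b ≤ J.cutoff K + 2 * 2 ^ K := by
  rw [CMData.expo]
  split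
  · omega
  · have h1 := CMData.rnd_lt K β (a * n + b)
    have h2 := CMData.rnd_lt K β (b * n + a)
    have h3 : CMData.scale n K * (J.wt (a * n + b) - 1) ≤ J.cutoff K := by
      have := hJ.wt_le (a * n + b)
      exact Nat.mul_le_mul_left _ (by omega)
    omega

/-- All quantities that occur are bounded by a fixed power of `n + L + 2`. -/
theorem bounds {n t : ℕ} {J : CMData n t} (hJ : J.Valid) (c : ℕ) {K Y Z : ℕ}
    (hK : K = (n * n * (n + J.L) ^ c).size) (hY : Y = n + J.L + 2) (hZ : Z = Y ^ (c + 16)) :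
    tableBase n t ≤ Z ∧ Y ≤ Z ∧ (∀ i ≤ c, n * n * (n + J.L) ^ i ≤ Z) ∧ 2 ^ K ≤ Z ∧
    CMData.scale n K ≤ Z ∧ n * n * n * J.cutoff K ≤ Z ∧ n * n * K ≤ Z ∧
    5 * J.cutoff K + 2 * 2 ^ K ≤ Z := by
  have hY2 : 2 ≤ Y := by omega
  have hpow : ∀ a, a ≤ c + 16 → Y ^ a ≤ Z := fun a ha => by
    rw [hZ]; exact Nat.pow_le_pow_right (by omega) ha
  have h1 : ∀ a, 1 ≤ Y ^ a := fun a => Nat.one_le_pow _ _ (by omega)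
  have hnn : n * n ≤ Y ^ 2 := by rw [pow_two]; exact Nat.mul_le_mul (by omega) (by omega)
  have hT : ∀ i ≤ c, n * n * (n + J.L) ^ i ≤ Y ^ (c + 2) := fun i hi => by
    rw [pow_add, mul_comm (Y ^ c)]
    exact Nat.mul_le_mul hnn ((Nat.pow_le_pow_left (by omega) i).trans
      (Nat.pow_le_pow_right (by omega) hi))
  have hdouble : ∀ a, 2 * Y ^ a ≤ Y ^ (a + 1) := fun a => by
    rw [pow_succ, mul_comm]; exact Nat.mul_le_mul_left _ hY2
  have h2K : 2 ^ K ≤ Y ^ (c + 4) := by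
    have h2 := two_pow_size_le (n * n * (n + J.L) ^ c)
    rw [← hK] at h2
    have h3 := hT c le_rfl
    have h4 := hdouble (c + 2)
    have h5 := hdouble (c + 3)
    have h6 := h1 (c + 2)
    simp only [add_assoc, Nat.reduceAdd] at h4 h5
    omega
  have hsc : CMData.scale n K ≤ Y ^ (c + 6) := by
    rw [CMData.scale]
    calc 2 * n * 2 ^ K ≤ Y * Y * Y ^ (c + 4) :=
          Nat.mul_le_mul (Nat.mul_le_mul hY2 (by omega)) h2K
      _ = Y ^ (c + 6) := by ring
  have hcut : J.cutoff K ≤ Y ^ (c + 8) := by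
    rw [CMData.cutoff]
    have : 2 * J.L + 1 ≤ Y * Y := by nlinarith
    calc _ ≤ Y ^ (c + 6) * (Y * Y) := Nat.mul_le_mul hsc this
      _ = Y ^ (c + 8) := by ring
  refine ⟨?_, Nat.le_self_pow (by omega) Y |>.trans hZ.ge, fun i hi => (hT i hi).trans
    (hpow _ (by omega)), h2K.trans (hpow _ (by omega)), hsc.trans (hpow _ (by omega)), ?_, ?_, ?_⟩
  · have ht : t * t ≤ Y ^ 2 := (Nat.mul_le_mul hJ.t_le hJ.t_le).trans hnn
    have h2 := hdouble 2
    have h3 := hdouble 3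
    have h4 := hdouble 1
    have h5 := hpow 4 (by omega)
    simp only [Nat.reduceAdd, pow_one] at h2 h3 h4
    have h6 : 4 + n ≤ 2 * Y := by omega
    rw [tableBase]
    omega
  · refine le_trans ?_ (hpow (c + 11) (by omega))
    calc n * n * n * J.cutoff K ≤ Y ^ 2 * Y * Y ^ (c + 8) :=
          Nat.mul_le_mul (Nat.mul_le_mul hnn (by omega)) hcut
      _ = Y ^ (c + 11) := by ring
  · refine le_trans ?_ (hpow (c + 6) (by omega))
    calc n * n * K ≤ Y ^ 2 * Y ^ (c + 4) :=
          Nat.mul_le_mul hnn (Nat.lt_two_pow_self.le.trans h2K)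
      _ = Y ^ (c + 6) := by ring
  · refine le_trans ?_ (hpow (c + 11) (by omega))
    have h2 := hdouble (c + 8)
    have h3 := hdouble (c + 9)
    have h4 := hdouble (c + 10)
    have h5 : Y ^ (c + 4) ≤ Y ^ (c + 8) := Nat.pow_le_pow_right (by omega) (by omega)
    simp only [add_assoc, Nat.reduceAdd] at h2 h3 h4
    omega

/-- Total correctness of the algorithm for every sequence of coin flips `ρ`. The answer `0` is given
only if the numbers of solutions are even for all exponents. -/
theorem tri_solve {n t : ℕ} {J : CMData n t} (hJ : J.Valid) {inp : ℕ → ℕ} (hin : Encodes J inp)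
    (c : ℕ) {w K Z : ℕ} (hK : K = (n * n * (n + J.L) ^ c).size)
    (hZ : Z = (n + J.L + 2) ^ (c + 16)) (hlt : ∀ a, inp a < 2 ^ w) (hw : Z ^ 240 < 2 ^ w)
    (ρ : ℕ → Bool) :
    Tri w (Code.solve c) (2 ^ rank J.act (t * t) * Z ^ 250) ⟨regsOf [], inp, ρ⟩ (fun s' =>
      (s'.reg 0 = 0 → 0 < n ∧ ∀ d < J.cutoff K, Even #(J.solSet K ρ (fun _ => n) d)) ∧
      (s'.reg 0 ≠ 0 → ∃ σ, J.IsSol σ ∧ ∀ u : Fin n, s'.mem u = σ u)) := by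
  obtain ⟨b1, b2, b3, b4, b5, b6, b7, b8⟩ := bounds hJ c hK rfl hZ
  have hcZ : c + 16 ≤ Z := by
    rw [hZ]
    exact Nat.lt_two_pow_self.le.trans (Nat.pow_le_pow_left (by omega) _)
  have hZ16 : 16 ≤ Z := by omega
  have hex := fun x => expo_le hJ K ρ (x / n) (x % n)
  refine (Tri.seq (t := n * n * 27 + 36) (u := (c + 16) * Z ^ 243 +
    2 ^ rank J.act (t * t) * Z ^ 249) (tri_readInput hJ hin hlt (lt_two_pow_of hw le_rfl) b1 b2 ρ)
    ?_).mono ?_ fun _ h => h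
  · rintro _ ⟨m, rfl, hin', hm⟩
    have hM := b1
    rw [tableBase] at hM
    refine Tri.seq (tri_setup hZ16 hw c hK hin' hm ?_ b3 b4 b1 (by omega) b5 (by omega) b6 b7
      fun x _ => (hex x).trans (by omega)) ?_
    · simp only [RegsLe, List.mem_cons, List.not_mem_nil, or_false, forall_eq_or_imp, forall_eq]
      omega
    rintro s1 ⟨h1, h2, h3⟩
    exact tri_extract hZ16 hw hJ h1 h2 h3 fun x _ => by have := hex x; omega
  · have hM := b1
    rw [tableBase] at hM
    have h1 : 1 ≤ 2 ^ rank J.act (t * t) := Nat.one_le_two_pow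
    have h2 : n * n * 27 + 36 ≤ Z ^ 244 := by
      have h2 : Z ^ 3 ≤ Z ^ 244 := Nat.pow_le_pow_right (by omega) (by norm_num)
      have h3 : 16 * 16 * Z ≤ Z ^ 3 := by
        rw [pow_succ, pow_two]; exact Nat.mul_le_mul_right _ (Nat.mul_le_mul hZ16 hZ16)
      omega
    have h3 : (c + 16) * Z ^ 243 ≤ Z ^ 244 := by
      rw [pow_succ, mul_comm]; exact Nat.mul_le_mul_left _ hcZ
    have h4 : Z ^ 244 ≤ 2 ^ rank J.act (t * t) * Z ^ 249 :=
      (Nat.pow_le_pow_right (by omega) (by norm_num)).trans (Nat.le_mul_of_pos_left _ h1)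
    have h5 : 2 ^ rank J.act (t * t) * Z ^ 249 * 16 ≤ 2 ^ rank J.act (t * t) * Z ^ 250 := by
      rw [pow_succ Z 249, ← mul_assoc]; exact Nat.mul_le_mul_left _ hZ16
    omega

end WordRAM

end

/-- Register `0` of the final state holds the verdict: zero means "no", nonzero means that a
solution is output. -/
theorem mainTheorem3 (c : ℕ) :
    ∃ (P : WordRAM.Prog) (κ C d : ℕ), ∀ (I : CMInstance) (D : ℕ), I.IsCommonDenominator D →
      ∀ w : ℕ, I.WordLengthOK D κ w →
        (∀ ρ : ℕ → Bool, ∃ (T : ℕ) (s : WordRAM.State),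
          WordRAM.Runs w P (WordRAM.init (I.encode D) ρ) T s ∧
          T ≤ C * 2 ^ I.H.card * (I.n + 1) ^ d * (I.bound D + 1) ^ d ∧
          (s.reg 0 ≠ 0 → ∃ M : I.G.Subgraph, I.IsSolution M ∧ I.Outputs s M)) ∧
        ((∃ M : I.G.Subgraph, I.IsSolution M) →
          WordRAM.coinMeasure {ρ : ℕ → Bool | ∃ (T : ℕ) (s : WordRAM.State),
              WordRAM.Runs w P (WordRAM.init (I.encode D) ρ) T s ∧ s.reg 0 = 0} ≤
            (((I.n + I.bound D : ℕ) : ENNReal) ^ c)⁻¹) := by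
  obtain ⟨a, ha⟩ : ∃ a, a = (c + 16) * 250 := ⟨_, rfl⟩
  refine ⟨WordRAM.Code.solve c, (c + 16) * 241, 2 ^ a, a, ?_⟩
  rintro I D hD w ⟨hwords, hw⟩
  have hJ := I.data_valid D
  have hin := WordRAM.encodes_data I D
  set J := I.data D with hJdef
  have hL : J.L = I.bound D := rfl
  obtain ⟨Z, hZ⟩ : ∃ Z, Z = (I.n + J.L + 2) ^ (c + 16) := ⟨_, rfl⟩
  obtain ⟨K, hK⟩ : ∃ K, K = (I.n * I.n * (I.n + J.L) ^ c).size := ⟨_, rfl⟩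
  have hZw : Z ^ 240 < 2 ^ w := by
    rw [pow_mul, ← hL, ← hZ] at hw
    -- the exponent `241` instead of `240` makes the inequality strict
    refine (Nat.pow_lt_pow_right ?_ (by norm_num)).trans_le hw
    rw [hZ]; exact Nat.one_lt_pow (by omega) (by omega)
  have key : ∀ ρ, WordRAM.Tri w (WordRAM.Code.solve c) _ (WordRAM.init (I.encode D) ρ) _ := fun ρ =>
    WordRAM.tri_solve hJ hin c hK hZ (WordRAM.getD_lt (Nat.two_pow_pos w) hwords) hZw ρ
  refine ⟨fun ρ => ?_, fun ⟨M, hM⟩ => ?_⟩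
  · obtain ⟨T, s, hT, hrun, -, hs⟩ := key ρ
    refine ⟨T, s, hrun, hT.trans ?_, fun h0 => ?_⟩
    · have h1 : 2 ^ rank J.act (I.t * I.t) ≤ 2 ^ I.H.card :=
        Nat.pow_le_pow_right two_pos (I.rank_act_le D)
      have h2 : I.n + J.L + 2 ≤ 2 * ((I.n + 1) * (I.bound D + 1)) := by rw [hL]; nlinarith
      have h3 : Z ^ 250 ≤ 2 ^ a * ((I.n + 1) ^ a * (I.bound D + 1) ^ a) := by
        rw [hZ, ← pow_mul, ← ha, ← mul_pow, ← mul_pow]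
        exact Nat.pow_le_pow_left h2 _
      calc _ ≤ 2 ^ I.H.card * _ := Nat.mul_le_mul h1 h3
        _ = _ := by ring
    · obtain ⟨σ, hσ, hmem⟩ := hs h0
      exact CMInstance.exists_isSolution_of_isSol hD hσ hmem
  · have hsol := CMInstance.exists_isSol_of_isSolution hD hM
    have hsub : {ρ : ℕ → Bool | ∃ (T : ℕ) (s : WordRAM.State),
        WordRAM.Runs w (WordRAM.Code.solve c) (WordRAM.init (I.encode D) ρ) T s ∧ s.reg 0 = 0} ⊆
        {ρ | 0 < I.n ∧ ∀ d < J.cutoff K, Even (J.solSet K ρ (fun _ => I.n) d).card} := by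
      rintro ρ ⟨T, s, hrun, h0⟩
      obtain ⟨T', s', -, hrun', hs', -⟩ := key ρ
      obtain rfl := hrun.det hrun'
      exact hs' h0
    refine (MeasureTheory.measure_mono hsub).trans ?_
    rcases Nat.eq_zero_or_pos I.n with hn | hn
    · simp [hn]
    · refine (MeasureTheory.measure_mono fun ρ hρ => hρ.2).trans
        ((CMData.coinMeasure_even_le hn hsol).trans ?_)
      have hlt : I.n * I.n * (I.n + I.bound D) ^ c ≤ 2 ^ K := by
        rw [hK]; exact (Nat.lt_size_self _).le
      rw [ENNReal.le_inv_iff_mul_le, mul_right_comm, ← div_eq_mul_inv]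
      refine ENNReal.div_le_of_le_mul ?_
      rw [one_mul]
      exact_mod_cast hlt
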